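/- **Setting.** Let $d\ge 1$, $s\in\mathbb{R}$, $s\ge 1+\frac d2$, and let $\Omega\subset\mathbb{R}^d$ be a bounded domain with piecewise $C^1$ boundary: $\mathcal{H}^{d-1}(\partial\Omega)<\infty$, and outside a set of $\mathcal{H}^{d-1}$-measure zero $\partial\Omega$ is locally a $C^1$ hypersurface with $\Omega$ on one side. Let $\mathbf n$ be the outward unit normal on this regular part $\partial_{r}\Omega$; boundary integrals are with respect to $d\sigma=d\mathcal{H}^{d-1}$. Let $A^{(1)},\dots,A^{(d)}$ be symmetric $n\times n$ real matrix functions, continuous on $\overline\Omega$ and $C^1$ with bounded derivatives in $\Omega$, and let $B$ be a bounded continuous $n\times n$ real matrix function on $\Omega$. Consider $$\partial_t w+\sum_{k=1}^d A^{(k)}(x)\,\partial_{x_k}w+B(x)\,w=0\quad\text{in }(0,\tau)\times\Omega,\qquad w(0,\cdot)=w_0\in L^2(\Omega)^n,\qquad 0<\tau\le\infty. \tag{1}$$ For $x\in\partial\Omega$ and unit vectors $\nu$ let $T(x,\nu)$ be orthogonal with $$T(x,\nu)^T\Big(\sum_{k}\nu_kA^{(k)}(x)\Big)T(x,\nu)=\mathrm{diag}(\lambda_1(x,\nu),\dots,\lambda_n(x,\nu)),$$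 where $x\mapsto T(x,\mathbf n(x))$ is measurable on $\partial\Omega$ (for instance continuous on each smooth boundary part), and put $$\Gamma_i^+=\{x\in\partial_r\Omega:\lambda_i(x,\mathbf n(x))\ge 0\},\qquad \Gamma_i^-=\{x\in\partial_r\Omega:\lambda_i(x,\mathbf n(x))<0\}.$$ Here $H^s(\Omega)$ is the Sobolev(–Slobodeckij) space, and its elements $\mu$ and $w(t,\cdot)$ below are identified with their representatives that are continuous on $\overline\Omega$. **Theorem.** Let $C_A>C_B\ge 0$ and let $\mu\in H^s(\Omega)$ be such that $m=\nabla\mu$ satisfies, in the sense of quadratic forms, $$C_A\,\mathrm{Id}+\sum_{k=1}^d m_k(x)A^{(k)}(x)\le 0\qquad\text{for a.e. }x\in\Omega.$$ Then there are constants $C_1,C_2>0$, independent of $\tau$, $w$ and the controls below, with the following property. Let $w\in C^1((0,\tau),H^s(\Omega))^n$ be a solution of (1) that attains its initial values $w_0$ in $L^2(\Omega)^n$ as $t\to0^+$, such that for $t\in(0,\tau)$, $x\in\Omega$ $$w^T\Big(\sum_{k=1}^d\partial_{x_k}A^{(k)}-2B^{sym}\Big)w\le C_B|w|^2,\qquad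 B^{sym}=\tfrac12(B+B^T).$$ Let the feedback controls be $u=T\tilde u$ on $\partial_r\Omega$ (with $T=T(x,\mathbf n(x))$), suppose that the characteristic variables $q=T^Tw$ satisfy the boundary conditions $$q_i(t,x)=(T^Tu)_i(t,x)=\tilde u_i(t,x),\qquad x\in\Gamma_i^-,\ i=1,\dots,n,\ t\in(0,\tau),$$ and suppose that for all $t\in(0,\tau)$ $$-\sum_{i=1}^n\int_{\Gamma_i^-}\lambda_i(x,\mathbf n(x))\,\tilde u_i(t,x)^2e^{\mu(x)}\,d\sigma\ \le\ \sum_{i=1}^n\int_{\Gamma_i^+}\lambda_i(x,\mathbf n(x))\,q_i(t,x)^2e^{\mu(x)}\,d\sigma .$$ Then $L(t)=\int_\Omega w(t,x)^Tw(t,x)\,e^{\mu(x)}\,dx$ is differentiable on $(0,\tau)$ with $$\frac{d}{dt}L(t)\le-(C_A-C_B)\,L(t),$$ and $w$ is exponentially stable in the $L^2$ sense: $$\|w(t,\cdot)\|_{L^2(\Omega)}\le C_1e^{-C_2t}\,\|w(0,\cdot)\|_{L^2(\Omega)}\qquad\text{for all }0\le t<\tau .$$ -/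

import Mathlib

open MeasureTheory Set Filter Topology
open scoped ContDiff ENNReal Matrix

noncomputable section

/-- Euclidean space `ℝᵈ`. -/
abbrev RVec (d : ℕ) : Type := EuclideanSpace ℝ (Fin d)

/-! ### Partial derivatives of classical functions -/

/-- The partial derivative `∂f/∂x_k` of a real function on `ℝᵈ`. -/
def partialD {d : ℕ} (k : Fin d) (f : RVec d → ℝ) : RVec d → ℝ :=
  fun x => fderiv ℝ f x (EuclideanSpace.single k 1)

/-- The mixed partial derivative `∂^α f` for a multi-index `α`. -/
def multiD {d : ℕ} (α : Fin d → ℕ) (f : RVec d → ℝ) : RVec d → ℝ :=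
  (List.finRange d).foldr (fun k g => (partialD k)^[α k] g) f

/-- Test functions `C_c^∞(Ω)`. -/
structure IsTestFun {d : ℕ} (Ω : Set (RVec d)) (φ : RVec d → ℝ) : Prop where
  smooth : ContDiff ℝ ∞ φ
  compactSupp : HasCompactSupport φ
  supp_subset : tsupport φ ⊆ Ω

theorem partialD_smooth {d : ℕ} (k : Fin d) {f : RVec d → ℝ}
    (hf : ContDiff ℝ ∞ f ∧ HasCompactSupport f) :
    ContDiff ℝ ∞ (partialD k f) ∧ HasCompactSupport (partialD k f) := by
  refine ⟨?_, ?_⟩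
  · have h : ContDiff ℝ ∞ (fderiv ℝ f) := hf.1.fderiv_right (by simp)
    exact h.clm_apply contDiff_const
  · exact hf.2.fderiv_apply ℝ _

theorem multiD_smooth {d : ℕ} (α : Fin d → ℕ) {f : RVec d → ℝ}
    (hf : ContDiff ℝ ∞ f ∧ HasCompactSupport f) :
    ContDiff ℝ ∞ (multiD α f) ∧ HasCompactSupport (multiD α f) := by
  unfold multiD
  induction List.finRange d with
  | nil => simpa using hf
  | cons k l ih =>
    rw [List.foldr_cons]
    generalize α k = m
    induction m with
    | zero => simpa using ih
    | succ m ihm =>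
      rw [Function.iterate_succ_apply']
      exact partialD_smooth k ihm

/-! ### Sobolev spaces `H^s(Ω; F)`, `s ≥ 0` real -/

/-- Multi-indices of order at most `N`. -/
abbrev MIdx (d N : ℕ) : Type := {α : Fin d → ℕ // ∑ k, α k ≤ N}

instance instFintypeMIdx (d N : ℕ) : Fintype (MIdx d N) :=
  Fintype.ofInjective
    (fun (α : MIdx d N) (k : Fin d) => (⟨α.1 k, Nat.lt_succ_of_le
      ((Finset.single_le_sum (f := α.1) (fun _ _ => Nat.zero_le _)
        (Finset.mem_univ k)).trans α.2)⟩ : Fin (N + 1)))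
    (fun α β h => Subtype.ext (funext fun k => by
      have := congrFun h k
      simpa using this))

section Sobolev

variable {d : ℕ} {F : Type} [NormedAddCommGroup F] [NormedSpace ℝ F]

/-- `g` is the weak derivative `∂^α f` in `Ω`. -/
def IsWeakD (Ω : Set (RVec d)) (α : Fin d → ℕ) (f g : RVec d → F) : Prop :=
  ∀ φ : RVec d → ℝ, IsTestFun Ω φ →
    ∫ x in Ω, multiD α φ x • f x = (-1 : ℝ) ^ (∑ k, α k) • ∫ x in Ω, φ x • g x

/-- The Gagliardo difference quotient `|x - y|^{-(d/2 + θ)} (f x - f y)`. -/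
def gagliardo (θ : ℝ) (f : RVec d → F) : RVec d × RVec d → F :=
  fun p => (‖p.1 - p.2‖ ^ (-((d : ℝ) / 2 + θ))) • (f p.1 - f p.2)

/-- The ambient Hilbert sum: one `L²(Ω)` slot for every multi-index `|α| ≤ ⌊s⌋`, and one
`L²(Ω × Ω)` slot for every such multi-index (used only for `|α| = ⌊s⌋`, and only if `s` is not
an integer). -/
abbrev SobolevAmbient (Ω : Set (RVec d)) (s : ℝ) (F : Type) [NormedAddCommGroup F]
    [NormedSpace ℝ F] : Type :=
  WithLp 2
    (PiLp 2 (fun _ : MIdx d ⌊s⌋₊ => Lp F 2 (volume.restrict Ω)) ×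
     PiLp 2 (fun _ : MIdx d ⌊s⌋₊ =>
      Lp F 2 ((volume.restrict Ω).prod (volume.restrict Ω : Measure (RVec d)))))

theorem integrable_test_smul {Ω : Set (RVec d)} {φ : RVec d → ℝ}
    (hφ : ContDiff ℝ ∞ φ ∧ HasCompactSupport φ) (f : Lp F 2 (volume.restrict Ω)) :
    Integrable (fun x => φ x • f x) (volume.restrict Ω) := by
  have h1 : MemLp φ 2 (volume.restrict Ω) :=
    (hφ.1.continuous.memLp_of_hasCompactSupport hφ.2).restrict Ω
  have h2 : MemLp f 2 (volume.restrict Ω) := Lp.memLp f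
  exact memLp_one_iff_integrable.mp (h2.smul h1)

theorem isWeakD_congr {Ω : Set (RVec d)} {α : Fin d → ℕ} {f g f' g' : RVec d → F}
    (hf : f =ᵐ[volume.restrict Ω] f') (hg : g =ᵐ[volume.restrict Ω] g')
    (h : IsWeakD Ω α f' g') : IsWeakD Ω α f g := by
  intro φ hφ
  have h1 : ∫ x in Ω, multiD α φ x • f x = ∫ x in Ω, multiD α φ x • f' x :=
    integral_congr_ae (hf.mono fun x hx => by simp only [hx])
  have h2 : ∫ x in Ω, φ x • g x = ∫ x in Ω, φ x • g' x :=
    integral_congr_ae (hg.mono fun x hx => by simp only [hx])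
  rw [h1, h2]
  exact h φ hφ

theorem isWeakD_zero {Ω : Set (RVec d)} {α : Fin d → ℕ} :
    IsWeakD Ω α (0 : RVec d → F) 0 := by
  intro φ _
  simp

theorem isWeakD_add {Ω : Set (RVec d)} {α : Fin d → ℕ}
    {f g f' g' : Lp F 2 (volume.restrict Ω)}
    (h : IsWeakD Ω α f g) (h' : IsWeakD Ω α f' g') :
    IsWeakD Ω α (f + f' : Lp F 2 (volume.restrict Ω)) (g + g' : Lp F 2 (volume.restrict Ω)) := by
  refine isWeakD_congr (Lp.coeFn_add f f') (Lp.coeFn_add g g') ?_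
  intro φ hφ
  have hs := hφ.smooth
  have hc := hφ.compactSupp
  simp only [Pi.add_apply, smul_add]
  rw [integral_add (integrable_test_smul (multiD_smooth α ⟨hs, hc⟩) f)
      (integrable_test_smul (multiD_smooth α ⟨hs, hc⟩) f'),
    integral_add (integrable_test_smul ⟨hs, hc⟩ g) (integrable_test_smul ⟨hs, hc⟩ g'),
    smul_add, h φ hφ, h' φ hφ]

theorem isWeakD_smul {Ω : Set (RVec d)} {α : Fin d → ℕ} (c : ℝ)
    {f g : Lp F 2 (volume.restrict Ω)} (h : IsWeakD Ω α f g) :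
    IsWeakD Ω α (c • f : Lp F 2 (volume.restrict Ω)) (c • g : Lp F 2 (volume.restrict Ω)) := by
  refine isWeakD_congr (Lp.coeFn_smul c f) (Lp.coeFn_smul c g) ?_
  intro φ hφ
  simp only [Pi.smul_apply]
  simp_rw [smul_comm _ c]
  rw [integral_smul, integral_smul, h φ hφ, smul_comm]

theorem gagliardo_congr {Ω : Set (RVec d)} {θ : ℝ} {f g : RVec d → F}
    (h : f =ᵐ[volume.restrict Ω] g) :
    gagliardo θ f =ᵐ[(volume.restrict Ω).prod (volume.restrict Ω)] gagliardo θ g := by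
  have h1 := Measure.quasiMeasurePreserving_fst (μ := volume.restrict Ω)
    (ν := volume.restrict Ω) |>.ae_eq_comp h
  have h2 := Measure.quasiMeasurePreserving_snd (μ := volume.restrict Ω)
    (ν := volume.restrict Ω) |>.ae_eq_comp h
  filter_upwards [h1, h2] with p hp1 hp2
  simp only [Function.comp] at hp1 hp2
  simp only [gagliardo, hp1, hp2]

/-- The Sobolev space `H^s(Ω; F)` for real `s ≥ 0`, with its Hilbert norm
`∑_{|α| ≤ ⌊s⌋} ‖∂^α u‖²_{L²}`, plus, for non-integer `s = ⌊s⌋ + θ`, the squared Slobodeckij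
seminorms `∫∫ |∂^α u(x) - ∂^α u(y)|² / |x - y|^{d + 2θ}` for `|α| = ⌊s⌋`. An element is the
family of weak derivatives of its component of index `0`. -/
def SobolevH (Ω : Set (RVec d)) (s : ℝ) (F : Type) [NormedAddCommGroup F]
    [NormedSpace ℝ F] : Submodule ℝ (SobolevAmbient Ω s F) where
  carrier := {u |
    (∀ α : MIdx d ⌊s⌋₊, IsWeakD Ω α.1 (u.fst ⟨0, by simp⟩) (u.fst α)) ∧
    (∀ α : MIdx d ⌊s⌋₊, (u.snd α : RVec d × RVec d → F)
      =ᵐ[(volume.restrict Ω).prod (volume.restrict Ω)]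
        if Int.fract s ≠ 0 ∧ ∑ k, α.1 k = ⌊s⌋₊ then gagliardo (Int.fract s) (u.fst α) else 0)}
  zero_mem' := by
    refine ⟨fun α => ?_, fun α => ?_⟩
    · exact isWeakD_congr (Lp.coeFn_zero F 2 _) (Lp.coeFn_zero F 2 _) isWeakD_zero
    · refine (Lp.coeFn_zero F 2 _).trans ?_
      split_ifs
      · refine EventuallyEq.symm ((gagliardo_congr (Lp.coeFn_zero F 2 _)).trans ?_)
        exact Eventually.of_forall fun p => by simp [gagliardo]
      · rfl
  add_mem' := by
    rintro u v ⟨hu, hu'⟩ ⟨hv, hv'⟩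
    refine ⟨fun α => isWeakD_add (hu α) (hv α), fun α => ?_⟩
    refine (Lp.coeFn_add (u.snd α) (v.snd α)).trans (((hu' α).add (hv' α)).trans ?_)
    split_ifs
    · refine EventuallyEq.symm ((gagliardo_congr (Lp.coeFn_add (u.fst α) (v.fst α))).trans ?_)
      exact Eventually.of_forall fun p => by
        simp only [gagliardo, Pi.add_apply, ← smul_add]
        congr 1
        abel
    · exact Eventually.of_forall fun p => by simp
  smul_mem' := by
    rintro c u ⟨hu, hu'⟩
    refine ⟨fun α => isWeakD_smul c (hu α), fun α => ?_⟩
    refine (Lp.coeFn_smul c (u.snd α)).trans (((hu' α).const_smul c).trans ?_)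
    split_ifs
    · refine EventuallyEq.symm ((gagliardo_congr (Lp.coeFn_smul c (u.fst α))).trans ?_)
      exact Eventually.of_forall fun p => by
        simp only [gagliardo, Pi.smul_apply, ← smul_sub]
        rw [smul_comm]
    · exact Eventually.of_forall fun p => by simp

/-- The weak derivative `∂^α u` of `u ∈ H^s(Ω; F)`, `|α| ≤ ⌊s⌋`, as an element of `L²(Ω; F)`. -/
def sobD {Ω : Set (RVec d)} {s : ℝ} (u : SobolevH Ω s F) (α : MIdx d ⌊s⌋₊) :
    Lp F 2 (volume.restrict Ω) :=
  (u : SobolevAmbient Ω s F).fst α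

/-- The function class in `L²(Ω; F)` underlying `u ∈ H^s(Ω; F)`. -/
def sobFun {Ω : Set (RVec d)} {s : ℝ} (u : SobolevH Ω s F) :
    Lp F 2 (volume.restrict Ω) :=
  sobD u ⟨0, by simp⟩

/-- The weak partial derivative `∂u/∂x_k` of `u ∈ H^s(Ω; F)`, for `s ≥ 1` (and `0` if `s < 1`). -/
def sobPD {Ω : Set (RVec d)} {s : ℝ} (u : SobolevH Ω s F) (k : Fin d) :
    Lp F 2 (volume.restrict Ω) :=
  if h : 1 ≤ ⌊s⌋₊ then sobD u ⟨Pi.single k 1, by simpa using h⟩ else 0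

/-- `f` is the representative of the class `u ∈ H^s(Ω; F)` that is continuous on the closure
of `Ω`. -/
structure IsContRep {Ω : Set (RVec d)} {s : ℝ} (u : SobolevH Ω s F) (f : RVec d → F) :
    Prop where
  ae_eq : f =ᵐ[volume.restrict Ω] sobFun u
  cont : ContinuousOn f (closure Ω)

end Sobolev

/-! ### Domains with piecewise `C¹` boundary -/

section Domain

variable {d : ℕ}

/-- `ν` is the outward unit normal at the boundary point `x` of `Ω`, near which the boundary is a
`C¹` hypersurface with `Ω` on one side: locally `Ω = {φ < 0}` with `φ` of class `C¹`,
`∇φ(x) ≠ 0`, and `ν = ∇φ(x) / |∇φ(x)|`. -/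
def IsOutwardNormal (Ω : Set (RVec d)) (x ν : RVec d) : Prop :=
  x ∈ frontier Ω ∧ ∃ (U : Set (RVec d)) (φ : RVec d → ℝ), IsOpen U ∧ x ∈ U ∧
    ContDiffOn ℝ 1 φ U ∧ gradient φ x ≠ 0 ∧ Ω ∩ U = {y ∈ U | φ y < 0} ∧
    ν = ‖gradient φ x‖⁻¹ • gradient φ x

/-- The part of the boundary that is locally a `C¹` hypersurface with `Ω` on one side. -/
def regBoundary (Ω : Set (RVec d)) : Set (RVec d) :=
  {x | ∃ ν, IsOutwardNormal Ω x ν}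

open Classical in
/-- The outward unit normal field on the regular part of the boundary (`0` elsewhere). -/
def outNormal (Ω : Set (RVec d)) (x : RVec d) : RVec d :=
  if h : ∃ ν, IsOutwardNormal Ω x ν then h.choose else 0

/-- The surface measure: the `(d-1)`-dimensional Hausdorff measure on the boundary. -/
def surfMeasure (Ω : Set (RVec d)) : Measure (RVec d) :=
  (Measure.hausdorffMeasure ((d : ℝ) - 1)).restrict (frontier Ω)

/-- A bounded domain (non-empty, open, connected) with piecewise `C¹` boundary: the boundary has
finite surface measure, and is a `C¹` hypersurface with the domain on one side except for a
(closed) set of surface measure zero (edges, corners, ...). -/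
structure IsPiecewiseC1Domain (Ω : Set (RVec d)) : Prop where
  isOpen : IsOpen Ω
  isConnected : IsConnected Ω
  isBounded : Bornology.IsBounded Ω
  finite_boundary : surfMeasure Ω univ < ⊤
  null_singular : surfMeasure Ω (frontier Ω \ regBoundary Ω) = 0

end Domain

/-! ### The hyperbolic system -/

section System

variable {d n : ℕ}

/-- Standing assumptions on the coefficients: the `A k` are symmetric, continuous on the closure
of `Ω`, and `C¹` with bounded derivatives in `Ω`; `B` is continuous and bounded in `Ω`. -/
structure IsSymmetricSystem (Ω : Set (RVec d)) (A : Fin d → RVec d → Matrix (Fin n) (Fin n) ℝ)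
    (B : RVec d → Matrix (Fin n) (Fin n) ℝ) : Prop where
  symm : ∀ k, ∀ x ∈ closure Ω, (A k x).IsSymm
  contA : ∀ k i j, ContinuousOn (fun x => A k x i j) (closure Ω)
  smoothA : ∀ k i j, ContDiffOn ℝ 1 (fun x => A k x i j) Ω
  bddA : ∀ k i j, ∃ M : ℝ, ∀ x ∈ Ω, ‖fderiv ℝ (fun y => A k y i j) x‖ ≤ M
  contB : ∀ i j, ContinuousOn (fun x => B x i j) Ω
  bddB : ∀ i j, ∃ M : ℝ, ∀ x ∈ Ω, |B x i j| ≤ M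

/-- The pencil matrix `A*(x, ν) = ∑ ν_k A^(k)(x)`. -/
def pencil (A : Fin d → RVec d → Matrix (Fin n) (Fin n) ℝ) (x ν : RVec d) :
    Matrix (Fin n) (Fin n) ℝ :=
  ∑ k, ν k • A k x

/-- Orthogonal diagonalisation `Tᵀ A*(x, ν) T = diag(λ₁, ..., λ_n)` of the pencil matrix for
boundary points `x` and unit vectors `ν`, measurable along the boundary (with the outward
normal inserted). -/
structure IsPencilDiag (Ω : Set (RVec d)) (A : Fin d → RVec d → Matrix (Fin n) (Fin n) ℝ)
    (lam : RVec d → RVec d → Fin n → ℝ) (T : RVec d → RVec d → Matrix (Fin n) (Fin n) ℝ) :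
    Prop where
  orth : ∀ x ∈ frontier Ω, ∀ ν : RVec d, ‖ν‖ = 1 → (T x ν)ᵀ * T x ν = 1
  diag : ∀ x ∈ frontier Ω, ∀ ν : RVec d, ‖ν‖ = 1 →
    (T x ν)ᵀ * pencil A x ν * T x ν = Matrix.diagonal (lam x ν)
  meas : ∀ i j, AEStronglyMeasurable (fun x => T x (outNormal Ω x) i j) (surfMeasure Ω)

/-- The outflow part `Γ_i⁺` of the boundary. -/
def gammaPlus (Ω : Set (RVec d)) (lam : RVec d → RVec d → Fin n → ℝ) (i : Fin n) :
    Set (RVec d) :=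
  {x ∈ regBoundary Ω | 0 ≤ lam x (outNormal Ω x) i}

/-- The inflow (controllable) part `Γ_i⁻` of the boundary. -/
def gammaMinus (Ω : Set (RVec d)) (lam : RVec d → RVec d → Fin n → ℝ) (i : Fin n) :
    Set (RVec d) :=
  {x ∈ regBoundary Ω | lam x (outNormal Ω x) i < 0}

/-- The matrix `∑_k ∂A^(k)/∂x_k - 2 B^sym`. -/
def sourceMatrix (A : Fin d → RVec d → Matrix (Fin n) (Fin n) ℝ)
    (B : RVec d → Matrix (Fin n) (Fin n) ℝ) (x : RVec d) : Matrix (Fin n) (Fin n) ℝ :=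
  (∑ k, Matrix.of fun i j => partialD k (fun y => A k y i j) x)
    - (2 : ℝ) • ((1 / 2 : ℝ) • (B x + (B x)ᵀ))

/-- `μ` (continuous on the closure of `Ω`) belongs to `H^s(Ω)` and its gradient `m = ∇μ`
satisfies the linear matrix inequality `C_A Id + ∑ m_k A^(k) ≤ 0`. -/
def IsLyapunovPotential (Ω : Set (RVec d)) (s : ℝ)
    (A : Fin d → RVec d → Matrix (Fin n) (Fin n) ℝ) (CA : ℝ) (μ : RVec d → ℝ) : Prop :=
  ∃ m : SobolevH Ω s ℝ, IsContRep m μ ∧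
    ∀ᵐ x ∂volume.restrict Ω,
      (-(CA • (1 : Matrix (Fin n) (Fin n) ℝ) + ∑ k, sobPD m k x • A k x)).PosSemidef

/-- `w` solves the system on `[0, τ) × Ω` and is of class `C¹((0, τ), H^s(Ω)ⁿ)`; the initial
values `w 0 ∈ L²` are attained in `L²(Ω)`. Here `0 < τ ≤ ∞`. -/
structure IsSolution (Ω : Set (RVec d)) (s : ℝ)
    (A : Fin d → RVec d → Matrix (Fin n) (Fin n) ℝ) (B : RVec d → Matrix (Fin n) (Fin n) ℝ)
    (τ : EReal) (w : ℝ → RVec d → RVec n) : Prop where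
  pde : ∃ W : ℝ → SobolevH Ω s (RVec n),
    ContDiffOn ℝ 1 W {t : ℝ | 0 < t ∧ (t : EReal) < τ} ∧
    ∀ t : ℝ, 0 < t → (t : EReal) < τ → IsContRep (W t) (w t) ∧
      ∀ᵐ x ∂volume.restrict Ω,
        WithLp.ofLp (sobFun (deriv W t) x) + ∑ k, A k x *ᵥ WithLp.ofLp (sobPD (W t) k x)
          + B x *ᵥ WithLp.ofLp (w t x) = 0
  initial_memLp : MemLp (w 0) 2 (volume.restrict Ω)
  initial : Tendsto (fun t => eLpNorm (w t - w 0) 2 (volume.restrict Ω)) (𝓝[>] 0) (𝓝 0)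

/-- The characteristic variables `Tᵀ v` at the boundary point `x`, with `T = T(x, n(x))`. -/
def charVar (Ω : Set (RVec d)) (T : RVec d → RVec d → Matrix (Fin n) (Fin n) ℝ)
    (x : RVec d) (v : RVec n) : Fin n → ℝ :=
  (T x (outNormal Ω x))ᵀ *ᵥ WithLp.ofLp v

/-- The Lyapunov function `L(t) = ∫_Ω wᵀ w exp(μ) dx`. -/
def lyapunovL (Ω : Set (RVec d)) (μ : RVec d → ℝ) (w : ℝ → RVec d → RVec n) (t : ℝ) : ℝ :=
  ∫ x in Ω, (WithLp.ofLp (w t x) ⬝ᵥ WithLp.ofLp (w t x)) * Real.exp (μ x)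

end System

end

/-! Differentiating the weighted energy gives `L' = ∫ 2 w·w_t e^μ`. Substituting the equation and
using the symmetry of the `A k`, the integrand becomes minus the divergence of the field with
components `(wᵀ A k w) e^μ`, plus `wᵀ(∑ ∂_k A k - 2 Bˢʸᵐ) w e^μ`, plus `wᵀ(∑ m_k A k) w e^μ`. The
last two terms are at most `C_B |w|² e^μ` and `-C_A |w|² e^μ`; this is the pointwise inequality
`energy_density_le`. By the divergence theorem the first term integrates to minus the boundary flux
of `wᵀ A* w e^μ`. In characteristic variables the flux density is `∑ λ_i q_i² e^μ`, and the boundary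
inequality for the controls says exactly that its integral is nonnegative
(`IsPencilDiag.flux_nonneg`). Hence `L' ≤ -(C_A - C_B) L`. Gronwall's argument gives exponential
decay of `L`, and `e^μ` is bounded above and below on the compact closure, so the plain `L²` norm
decays too.

Most of the work is the divergence theorem (`IsPiecewiseC1Domain.gaussGreen`), because the flux is
merely continuous up to the boundary with an integrable weak derivative, and the boundary is only
piecewise `C¹`. Near a regular point the domain is `{φ < 0}`. A test function is multiplied by a
smooth step in `φ / δ`, so that it is admissible in the weak formulation; as `δ → 0` the derivative
of the step concentrates on the boundary (`tendsto_integral_layer`). In a small enough chart the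
gradient of `φ` is nearly constant and the boundary is a nearly flat graph, so no area formula is
needed: Lipschitz bounds identify Hausdorff measure on the graph with the measure of the base up to
a factor close to `1`. Each local identity thus has an error of at most `η ∫ |f ψ|`
(`exists_nhds_abs_gaussGreenDefect_le`). Such errors add up exactly under a partition of unity, and
`η → 0` makes the defect vanish (`gaussGreenDefect_eq_zero`).

The singular boundary set is compact and null for the surface measure. It is covered by finitely
many balls with small `∑ r_i ^ m`, and the corresponding cut-offs have gradients that are small in
`L¹` (`exists_cutoff_of_hausdorffMeasure_eq_zero`), so edges and corners contribute nothing in the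
limit.

The flux itself is a sum of products of coefficients, components of `w` and `e^μ`. Its weak
derivative comes from product and chain rules for continuous functions with integrable weak
derivatives, proved by mollification. The Hausdorff measure is not normalised, so a positive factor
`hausdorffRatio` appears in the formula; only its sign matters for the energy estimate. -/

/-! ### Calculus of weak partial derivatives -/

/-- `g` is the weak partial derivative `∂f/∂x_k` in `Ω`, for real functions. -/
def IsWeakPD {d : ℕ} (Ω : Set (RVec d)) (k : Fin d) (f g : RVec d → ℝ) : Prop :=
  ∀ φ : RVec d → ℝ, IsTestFun Ω φ →
    ∫ x in Ω, partialD k φ x * f x = -∫ x in Ω, φ x * g x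

/-! ### Mollification and local smooth approximation. -/

section Mollify

open scoped Convolution

variable {d : ℕ}

/-- Move the absolute value inside the convolution; the integral of a convolution is the product of
the integrals. This `L¹` contraction is what lets convergence be checked on a dense class. -/
theorem integral_abs_convolution_le {ρ u : RVec d → ℝ} (hρ : Integrable ρ) (hρ0 : ∀ x, 0 ≤ ρ x)
    (hρ1 : ∫ x, ρ x = 1) (hu : Integrable u) :
    ∫ x, |(ρ ⋆[ContinuousLinearMap.lsmul ℝ ℝ, volume] u) x| ≤ ∫ x, |u x| := by
  have h1 : ∫ x, (ρ ⋆[ContinuousLinearMap.lsmul ℝ ℝ, volume] fun x => |u x|) x = ∫ x, |u x| := by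
    rw [integral_convolution _ hρ hu.abs]
    simp [hρ1]
  rw [← h1]
  refine integral_mono (Integrable.integrable_convolution _ hρ hu).abs
    (Integrable.integrable_convolution _ hρ hu.abs) fun x => ?_
  simp only [convolution_def, ContinuousLinearMap.lsmul_apply, smul_eq_mul]
  refine (abs_integral_le_integral_abs).trans (le_of_eq ?_)
  congr 1
  ext t
  rw [abs_mul, abs_of_nonneg (hρ0 t)]

/-- A sequence of bump functions with support shrinking to the origin. -/
noncomputable def bumpSeq (d : ℕ) (j : ℕ) : ContDiffBump (0 : RVec d) where
  rIn := 1 / (j + 1 : ℝ)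
  rOut := 2 / (j + 1 : ℝ)
  rIn_pos := by positivity
  rIn_lt_rOut := by
    have : (0 : ℝ) < j + 1 := by positivity
    gcongr
    norm_num

theorem tendsto_bumpSeq_rOut (d : ℕ) : Tendsto (fun j => (bumpSeq d j).rOut) atTop (𝓝 0) := by
  have := (tendsto_one_div_add_atTop_nhds_zero_nat (𝕜 := ℝ)).const_mul 2
  simpa [bumpSeq, div_eq_mul_inv] using this

/-- Mollification with the `j`-th bump function. -/
noncomputable def mollify (j : ℕ) (u : RVec d → ℝ) : RVec d → ℝ :=
  (bumpSeq d j).normed volume ⋆[ContinuousLinearMap.lsmul ℝ ℝ, volume] u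

theorem integrable_bump (j : ℕ) : Integrable ((bumpSeq d j).normed (volume : Measure (RVec d))) :=
  (bumpSeq d j).integrable_normed

theorem tendstoUniformly_mollify {u : RVec d → ℝ} (hu : Continuous u) (hc : HasCompactSupport u) :
    TendstoUniformly (fun j => mollify j u) u atTop := by
  rw [Metric.tendstoUniformly_iff]
  intro ε hε
  have huc := hc.uniformContinuous_of_continuous hu
  obtain ⟨δ, hδ, h⟩ := Metric.uniformContinuous_iff.mp huc (ε / 2) (half_pos hε)
  filter_upwards [(tendsto_bumpSeq_rOut d).eventually (gt_mem_nhds hδ)] with j hj x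
  rw [dist_comm]
  refine (ContDiffBump.dist_normed_convolution_le hu.aestronglyMeasurable (ε := ε / 2)
    fun y hy => ?_).trans_lt (half_lt_self hε)
  exact (h (lt_trans (Metric.mem_ball.mp hy) hj)).le

theorem integrable_mollify (j : ℕ) {u : RVec d → ℝ} (hu : Integrable u) :
    Integrable (mollify j u) :=
  Integrable.integrable_convolution _ (integrable_bump j) hu

theorem mollify_sub (j : ℕ) {u v : RVec d → ℝ} (hu : LocallyIntegrable u)
    (hv : LocallyIntegrable v) : mollify j (u - v) = mollify j u - mollify j v := by
  have hc : HasCompactSupport ((bumpSeq d j).normed (volume : Measure (RVec d))) :=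
    (bumpSeq d j).hasCompactSupport_normed
  have hn : Continuous ((bumpSeq d j).normed (volume : Measure (RVec d))) :=
    (bumpSeq d j).continuous_normed
  ext x
  have h1 := hc.convolutionExists_left (ContinuousLinearMap.lsmul ℝ ℝ) hn hu x
  have h2 := hc.convolutionExists_left (ContinuousLinearMap.lsmul ℝ ℝ) hn hv x
  simp only [mollify, convolution_def, Pi.sub_apply, map_sub]
  exact integral_sub h1 h2

/-- Density argument: for continuous compactly supported `v` convergence is uniform on a fixed
compact set, and the error `u - v` is not increased by mollification. -/
theorem tendsto_integral_abs_mollify_sub {u : RVec d → ℝ} (hu : Integrable u) :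
    Tendsto (fun j => ∫ x, |mollify j u x - u x|) atTop (𝓝 0) := by
  rw [Metric.tendsto_atTop]
  intro ε hε
  obtain ⟨v, hvc, hv, hvcont, hvi⟩ :=
    hu.exists_hasCompactSupport_integral_sub_le (show (0 : ℝ) < ε / 4 by positivity)
  -- all mollifications of `v` live in a fixed compact set
  set K := Metric.cthickening 2 (tsupport v) with hK
  have hKc : IsCompact K := hvc.isCompact.cthickening
  have hsupp : ∀ j x, x ∉ K → mollify j v x = 0 := by
    intro j x hx
    have hne : x ∉ Function.support (mollify j v) := by
      intro hx'
      apply hx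
      have := support_convolution_subset (L := ContinuousLinearMap.lsmul ℝ ℝ) (μ := volume) hx'
      obtain ⟨a, ha, b, hb, rfl⟩ := Set.mem_add.mp this
      rw [(bumpSeq d j).support_normed_eq] at ha
      refine Metric.mem_cthickening_of_dist_le _ b _ _ (subset_tsupport _ hb) ?_
      -- The largest outer radius occurs at `j = 0`, which is why `K` is a thickening by `2`.
      have h2 : (bumpSeq d j).rOut ≤ 2 := by
        simp only [bumpSeq]
        rw [div_le_iff₀ (by positivity)]
        have : (0 : ℝ) ≤ j := by positivity
        nlinarith
      have : ‖a‖ < (bumpSeq d j).rOut := by simpa using ha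
      simpa [dist_eq_norm] using (this.le.trans h2)
    simpa using hne
  have hv0 : ∀ x, x ∉ K → v x = 0 := by
    intro x hx
    by_contra h
    exact hx (Metric.self_subset_cthickening _ (subset_tsupport _ h))
  set M := (volume : Measure (RVec d)).real K with hM
  have hM0 : 0 ≤ M := measureReal_nonneg
  have hunif := tendstoUniformly_mollify hvcont hvc
  rw [Metric.tendstoUniformly_iff] at hunif
  -- A uniform error of this size integrates over `K` to at most `ε / 4`; the `+ 1` covers the case
  -- `M = 0`.
  obtain ⟨N, hN⟩ := eventually_atTop.mp (hunif (ε / (4 * (M + 1))) (by positivity))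
  refine ⟨N, fun j hj => ?_⟩
  rw [Real.dist_eq, sub_zero, abs_of_nonneg (integral_nonneg fun _ => abs_nonneg _)]
  have hi1 : Integrable (fun x => |mollify j (u - v) x|) := (integrable_mollify j (hu.sub hvi)).abs
  have hi2 : Integrable (fun x => |mollify j v x - v x|) := ((integrable_mollify j hvi).sub hvi).abs
  have hi3 : Integrable (fun x => |u x - v x|) := (hu.sub hvi).abs
  have e1 : ∫ x, |mollify j (u - v) x| ≤ ε / 4 := by
    refine (integral_abs_convolution_le (integrable_bump j) (fun x => (bumpSeq d j).nonneg_normed x)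
      (bumpSeq d j).integral_normed (hu.sub hvi)).trans ?_
    simpa using hv
  have e2 : ∫ x, |mollify j v x - v x| ≤ ε / 4 := by
    have : ∫ x, |mollify j v x - v x| = ∫ x in K, |mollify j v x - v x| := by
      rw [setIntegral_eq_integral_of_forall_compl_eq_zero]
      intro x hx
      simp [hsupp j x hx, hv0 x hx]
    rw [this]
    have hb : ∫ x in K, |mollify j v x - v x| ≤ ∫ x in K, ε / (4 * (M + 1)) := by
      refine setIntegral_mono_on hi2.integrableOn (by simp [hKc.measure_lt_top]) hKc.measurableSet
        fun x _ => ?_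
      have := hN j hj x
      rw [dist_comm, Real.dist_eq] at this
      exact this.le
    refine hb.trans ?_
    rw [setIntegral_const, smul_eq_mul, ← hM]
    rw [mul_div_assoc', div_le_div_iff₀ (by positivity) (by positivity)]
    nlinarith
  calc ∫ x, |mollify j u x - u x|
      ≤ ∫ x, (|mollify j (u - v) x| + |mollify j v x - v x| + |u x - v x|) := by
        refine integral_mono ((integrable_mollify j hu).sub hu).abs ((hi1.add hi2).add hi3) fun x => ?_
        have := congrFun (mollify_sub j hu.locallyIntegrable hvi.locallyIntegrable) x
        simp only [Pi.sub_apply] at this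
        have h3 : mollify j u x - u x
            = mollify j (u - v) x + (mollify j v x - v x) - (u x - v x) := by
          rw [this]; ring
        simp only [h3]
        exact (abs_sub _ _).trans (add_le_add_left (abs_add_le _ _) _)
    _ = (∫ x, |mollify j (u - v) x|) + (∫ x, |mollify j v x - v x|) + ∫ x, |u x - v x| := by
        have h12 : Integrable (fun x => |mollify j (u - v) x| + |mollify j v x - v x|) := hi1.add hi2
        rw [integral_add h12 hi3, integral_add hi1 hi2]
    _ ≤ ε / 4 + ε / 4 + ε / 4 := by gcongr; simpa using hv
    _ < ε := by linarith

theorem partialD_mul {k : Fin d} {f g : RVec d → ℝ} {x : RVec d} (hf : DifferentiableAt ℝ f x)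
    (hg : DifferentiableAt ℝ g x) :
    partialD k (fun y => f y * g y) x = partialD k f x * g x + f x * partialD k g x := by
  unfold partialD
  rw [fderiv_fun_mul hf hg]
  simp only [add_apply, smul_apply, smul_eq_mul]
  ring

theorem partialD_comp_sub_left {k : Fin d} {ρ : RVec d → ℝ} (x t : RVec d)
    (hρ : Differentiable ℝ ρ) :
    partialD k (fun s => ρ (x - s)) t = -partialD k ρ (x - t) := by
  unfold partialD
  have h1 : HasFDerivAt (fun s : RVec d => x - s) (-ContinuousLinearMap.id ℝ (RVec d)) t :=
    (hasFDerivAt_id t).const_sub x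
  have h2 := (hρ (x - t)).hasFDerivAt.comp t h1
  have h3 : fderiv ℝ (fun s => ρ (x - s)) t = _ := h2.fderiv
  rw [h3]
  simp

theorem IsTestFun.mul_smooth {Ω : Set (RVec d)} {φ f : RVec d → ℝ} (hφ : IsTestFun Ω φ)
    (hf : ContDiff ℝ ∞ f) : IsTestFun Ω (fun x => φ x * f x) where
  smooth := hφ.smooth.mul hf
  compactSupp := hφ.compactSupp.mul_right
  supp_subset := (closure_mono (Function.support_mul_subset_left φ f)).trans hφ.supp_subset

theorem continuous_partialD {k : Fin d} {f : RVec d → ℝ} (hf : ContDiff ℝ 1 f) :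
    Continuous (partialD k f) :=
  (hf.continuous_fderiv one_ne_zero).clm_apply continuous_const

theorem tsupport_partialD_subset {k : Fin d} {f : RVec d → ℝ} :
    tsupport (partialD k f) ⊆ tsupport f :=
  closure_minimal (fun x hx => by
    have : fderiv ℝ f x ≠ 0 := fun h => hx (by simp [partialD, h])
    exact support_fderiv_subset ℝ this) (isClosed_tsupport f)

theorem contDiff_mollify (j : ℕ) {u : RVec d → ℝ} (hu : LocallyIntegrable u) :
    ContDiff ℝ ∞ (mollify j u) :=
  (bumpSeq d j).hasCompactSupport_normed.contDiff_convolution_left _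
    (bumpSeq d j).contDiff_normed hu

theorem partialD_mollify (j : ℕ) (k : Fin d) {u : RVec d → ℝ} (hu : LocallyIntegrable u)
    (x : RVec d) : partialD k (mollify j u) x
      = ∫ t, partialD k ((bumpSeq d j).normed volume) (x - t) * u t := by
  set ρ := (bumpSeq d j).normed (volume : Measure (RVec d)) with hρ
  have hc : HasCompactSupport ρ := (bumpSeq d j).hasCompactSupport_normed
  have hs : ContDiff ℝ 1 ρ := (bumpSeq d j).contDiff_normed
  have hcf : HasCompactSupport (fderiv ℝ ρ) := hc.fderiv ℝ
  have h1 := hc.hasFDerivAt_convolution_left (ContinuousLinearMap.lsmul ℝ ℝ) hs hu x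
  unfold partialD
  have h2 : fderiv ℝ (mollify j u) x = _ := h1.fderiv
  rw [h2, convolution_eq_swap]
  have hint : Integrable (fun t => ((ContinuousLinearMap.lsmul ℝ ℝ).precompL (RVec d)
      (fderiv ℝ ρ (x - t))) (u t)) := by
    have := hcf.convolutionExists_left ((ContinuousLinearMap.lsmul ℝ ℝ).precompL (RVec d))
      (hs.continuous_fderiv one_ne_zero) hu x
    exact this.integrable_swap
  rw [ContinuousLinearMap.integral_apply hint]
  rfl

theorem exists_test_one {Ω K : Set (RVec d)} (hΩ : IsOpen Ω) (hK : IsCompact K) (hKΩ : K ⊆ Ω) :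
    ∃ χ : RVec d → ℝ, IsTestFun Ω χ ∧ (∃ U, IsOpen U ∧ K ⊆ U ∧ ∀ x ∈ U, χ x = 1) ∧
      ∀ x, χ x ∈ Icc (0 : ℝ) 1 := by
  obtain ⟨L, hL, hKL, hLΩ⟩ := exists_compact_between hK hΩ hKΩ
  obtain ⟨f, h1, h0, hf⟩ := exists_contMDiffMap_one_nhds_of_subset_interior (n := (⊤ : ℕ∞))
    (modelWithCornersSelf ℝ (RVec d)) hK.isClosed hKL
  have hsub : tsupport f ⊆ L := closure_minimal (fun x hx => by
    by_contra h
    exact hx (h0 x h)) hL.isClosed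
  obtain ⟨U, hU, hKU, hU1⟩ := mem_nhdsSet_iff_exists.mp h1
  exact ⟨f, ⟨f.contMDiff.contDiff, hL.of_isClosed_subset (isClosed_tsupport _) hsub,
    hsub.trans hLΩ⟩, ⟨U, hU, hKU, hU1⟩, hf⟩

/-- Local smooth approximation of a continuous function with integrable weak derivative. -/
theorem IsWeakPD.exists_smooth_approx {Ω : Set (RVec d)} (hΩ : IsOpen Ω) {k : Fin d}
    {f g : RVec d → ℝ} (hf : Continuous f) (hg : IntegrableOn g Ω) (h : IsWeakPD Ω k f g)
    {K : Set (RVec d)} (hK : IsCompact K) (hKΩ : K ⊆ Ω) :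
    ∃ F : ℕ → RVec d → ℝ, (∀ j, ContDiff ℝ ∞ (F j)) ∧ TendstoUniformlyOn F f atTop K ∧
      Tendsto (fun j => ∫ x in K, |partialD k (F j) x - g x|) atTop (𝓝 0) := by
  obtain ⟨χ, hχ, ⟨U, hU, hKU, hχ1⟩, -⟩ := exists_test_one hΩ hK hKΩ
  have hχ0 : ∀ x, x ∉ Ω → χ x = 0 := fun x hx =>
    image_eq_zero_of_notMem_tsupport fun h' => hx (hχ.supp_subset h')
  have hχ0' : ∀ x, x ∉ Ω → partialD k χ x = 0 := fun x hx =>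
    image_eq_zero_of_notMem_tsupport fun h' => hx (hχ.supp_subset (tsupport_partialD_subset h'))
  have hχs : ContDiff ℝ 1 χ := hχ.smooth.of_le (by exact_mod_cast le_top)
  -- Localisation: `v` is the weak derivative of `u = χ f` on the whole space, and on `K`, where `χ
  -- = 1`, the pair agrees with `f`, `g`.
  set u : RVec d → ℝ := fun x => χ x * f x with hu
  set v : RVec d → ℝ := fun x => partialD k χ x * f x + χ x * g x with hv
  have huc : Continuous u := hχ.smooth.continuous.mul hf
  have hus : HasCompactSupport u := hχ.compactSupp.mul_right
  have hui : Integrable u := huc.integrable_of_hasCompactSupport hus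
  have hχg : Integrable (fun x => χ x * g x) := by
    have : (fun x => χ x * g x) = fun x => χ x * Ω.indicator g x := by
      ext x
      by_cases hx : x ∈ Ω
      · simp [hx]
      · simp [hx, hχ0 x hx]
    rw [this]
    obtain ⟨C, hC⟩ := hχ.compactSupp.exists_bound_of_continuous hχ.smooth.continuous
    exact (hg.integrable_indicator hΩ.measurableSet).bdd_mul
      hχ.smooth.continuous.aestronglyMeasurable (Eventually.of_forall hC)
  have hdχf : Integrable (fun x => partialD k χ x * f x) :=
    ((continuous_partialD hχs).mul hf).integrable_of_hasCompactSupport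
      (HasCompactSupport.mul_right (hχ.compactSupp.of_isClosed_subset (isClosed_tsupport _)
        tsupport_partialD_subset))
  have hvi : Integrable v := hdχf.add hχg
  have key : ∀ j x, partialD k (mollify j u) x = mollify j v x := by
    intro j x
    rw [partialD_mollify j k hui.locallyIntegrable]
    set ρ := (bumpSeq d j).normed (volume : Measure (RVec d)) with hρ
    have hρs : ContDiff ℝ ∞ ρ := (bumpSeq d j).contDiff_normed
    have hρ1 : ContDiff ℝ 1 ρ := (bumpSeq d j).contDiff_normed
    have hρd : Differentiable ℝ ρ := hρ1.differentiable one_ne_zero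
    have hρc : HasCompactSupport ρ := (bumpSeq d j).hasCompactSupport_normed
    have hshift : ContDiff ℝ ∞ (fun t => ρ (x - t)) := hρs.comp (contDiff_const.sub contDiff_id)
    -- Testing with `t ↦ χ t * ρ (x - t)` moves the derivative from the mollifier onto `u`.
    have htest := h _ (hχ.mul_smooth hshift)
    have hpd : ∀ t, partialD k (fun t => χ t * ρ (x - t)) t
        = partialD k χ t * ρ (x - t) - χ t * partialD k ρ (x - t) := by
      intro t
      rw [partialD_mul (hχs.differentiable one_ne_zero t)
        ((hshift.differentiable (by simp)) t), partialD_comp_sub_left x t hρd]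
      ring
    rw [setIntegral_eq_integral_of_forall_compl_eq_zero
      (fun t ht => by rw [hpd, hχ0 t ht, hχ0' t ht]; simp),
      setIntegral_eq_integral_of_forall_compl_eq_zero
      (fun t ht => by rw [hχ0 t ht]; simp)] at htest
    have hmv : mollify j v x = ∫ t, ρ (x - t) * v t := by
      simp only [mollify, convolution_eq_swap]
      rfl
    obtain ⟨C, hC⟩ := hρc.exists_bound_of_continuous hρ1.continuous
    have hρm : AEStronglyMeasurable (fun t => ρ (x - t)) :=
      (hρ1.continuous.comp (continuous_const.sub continuous_id)).aestronglyMeasurable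
    have i1 : Integrable (fun t => ρ (x - t) * (partialD k χ t * f t)) :=
      hdχf.bdd_mul hρm (Eventually.of_forall fun t => hC (x - t))
    have i2 : Integrable (fun t => ρ (x - t) * (χ t * g t)) :=
      hχg.bdd_mul hρm (Eventually.of_forall fun t => hC (x - t))
    have i3 : Integrable (fun t => partialD k ρ (x - t) * u t) := by
      have hdc : HasCompactSupport (partialD k ρ) :=
        hρc.of_isClosed_subset (isClosed_tsupport _) tsupport_partialD_subset
      obtain ⟨C', hC'⟩ := hdc.exists_bound_of_continuous (continuous_partialD hρ1)
      exact hui.bdd_mul ((continuous_partialD hρ1).comp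
        (continuous_const.sub continuous_id)).aestronglyMeasurable
        (Eventually.of_forall fun t => hC' (x - t))
    have e1 : ∫ t, partialD k (fun t => χ t * ρ (x - t)) t * f t
        = (∫ t, ρ (x - t) * (partialD k χ t * f t)) - ∫ t, partialD k ρ (x - t) * u t := by
      rw [← integral_sub i1 i3]
      congr 1
      ext t
      rw [hpd]
      simp only [hu]
      ring
    have e2 : ∫ t, ρ (x - t) * v t
        = (∫ t, ρ (x - t) * (partialD k χ t * f t)) + ∫ t, ρ (x - t) * (χ t * g t) := by
      rw [← integral_add i1 i2]
      congr 1
      ext t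
      simp only [hv]
      ring
    have e3 : ∫ t, χ t * ρ (x - t) * g t = ∫ t, ρ (x - t) * (χ t * g t) := by
      congr 1
      ext t
      ring
    rw [hmv, e2]
    rw [e1, e3] at htest
    linarith
  refine ⟨fun j => mollify j u, fun j => contDiff_mollify j hui.locallyIntegrable, ?_, ?_⟩
  · refine ((tendstoUniformly_mollify huc hus).tendstoUniformlyOn (s := K)).congr_right ?_
    intro x hx
    simp [hu, hχ1 x (hKU hx)]
  · refine squeeze_zero (fun j => integral_nonneg fun _ => abs_nonneg _) (fun j => ?_)
      (tendsto_integral_abs_mollify_sub hvi)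
    have hvg : ∀ x ∈ K, v x = g x := by
      intro x hx
      have h1 : χ =ᶠ[𝓝 x] fun _ => 1 :=
        Filter.eventually_of_mem (hU.mem_nhds (hKU hx)) hχ1
      have h2 : partialD k χ x = 0 := by simp [partialD, h1.fderiv_eq]
      simp [hv, h2, hχ1 x (hKU hx)]
    calc ∫ x in K, |partialD k (mollify j u) x - g x|
        = ∫ x in K, |mollify j v x - v x| := by
          refine setIntegral_congr_fun hK.measurableSet fun x hx => ?_
          simp only [key, hvg x hx]
      _ ≤ ∫ x, |mollify j v x - v x| :=
          setIntegral_le_integral ((integrable_mollify j hvi).sub hvi).abs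
            (Eventually.of_forall fun _ => abs_nonneg _)

end Mollify

/-! ### Product rule, chain rule and wider test functions for weak derivatives. -/

section Calculus

variable {d : ℕ} {Ω : Set (RVec d)} {k : Fin d}

/-- Split `a_j b_j - a₀ b₀ = a_j (b_j - b₀) + (a_j - a₀) b₀`. This is the limit passage behind all
the rules below: functions converge uniformly, derivatives in `L¹`. -/
theorem tendsto_setIntegral_mul {K : Set (RVec d)} (hK : IsCompact K) {a : ℕ → RVec d → ℝ}
    {a₀ : RVec d → ℝ} {b : ℕ → RVec d → ℝ} {b₀ : RVec d → ℝ}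
    (ha : ∀ j, Continuous (a j)) (ha₀ : Continuous a₀) (hu : TendstoUniformlyOn a a₀ atTop K)
    (hb : ∀ j, IntegrableOn (b j) K) (hb₀ : IntegrableOn b₀ K)
    (hL : Tendsto (fun j => ∫ x in K, |b j x - b₀ x|) atTop (𝓝 0)) :
    Tendsto (fun j => ∫ x in K, a j x * b j x) atTop (𝓝 (∫ x in K, a₀ x * b₀ x)) := by
  obtain ⟨C, hC⟩ := hK.exists_bound_of_continuousOn ha₀.continuousOn
  set I := ∫ x in K, |b₀ x| with hI
  have hI0 : 0 ≤ I := integral_nonneg fun _ => abs_nonneg _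
  rw [Metric.tendsto_atTop] at hL ⊢
  rw [Metric.tendstoUniformlyOn_iff] at hu
  intro ε hε
  set C' := |C| + 1 with hC'
  have hC'0 : 0 < C' := by positivity
  -- The cap at `1` keeps `|a j|` below `C'` on `K`.
  set η := min 1 (ε / (2 * (I + 1))) with hη
  have hη0 : 0 < η := by positivity
  obtain ⟨N₁, hN₁⟩ := hL (ε / (2 * C')) (by positivity)
  obtain ⟨N₂, hN₂⟩ := eventually_atTop.mp (hu η hη0)
  refine ⟨max N₁ N₂, fun j hj => ?_⟩
  have h1 := hN₁ j (le_of_max_le_left hj)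
  have h2 := hN₂ j (le_of_max_le_right hj)
  rw [Real.dist_eq, sub_zero, abs_of_nonneg (integral_nonneg fun _ => abs_nonneg _)] at h1
  have i1 : IntegrableOn (fun x => a j x * b j x) K := (hb j).continuousOn_mul (ha j).continuousOn hK
  have i2 : IntegrableOn (fun x => a₀ x * b₀ x) K := hb₀.continuousOn_mul ha₀.continuousOn hK
  rw [Real.dist_eq, ← integral_sub i1 i2]
  have i3 : IntegrableOn (fun x => |b j x - b₀ x|) K := ((hb j).sub hb₀).abs
  have i4 : IntegrableOn (fun x => |b₀ x|) K := hb₀.abs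
  calc |∫ x in K, (a j x * b j x - a₀ x * b₀ x)|
      ≤ ∫ x in K, |a j x * b j x - a₀ x * b₀ x| := abs_integral_le_integral_abs
    _ ≤ ∫ x in K, (C' * |b j x - b₀ x| + η * |b₀ x|) := by
        refine setIntegral_mono_on (i1.sub i2).abs ((i3.const_mul _).add (i4.const_mul _))
          hK.measurableSet fun x hx => ?_
        have h3 := h2 x hx
        rw [Real.dist_eq, abs_sub_comm] at h3
        have h4 := hC x hx
        rw [Real.norm_eq_abs] at h4
        have h5 : |a j x| ≤ C' := by
          have : |a j x| ≤ |a₀ x| + |a j x - a₀ x| := by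
            have := abs_add_le (a₀ x) (a j x - a₀ x)
            simpa using this
          have h6 : η ≤ 1 := min_le_left _ _
          have := le_abs_self C
          linarith
        have h7 : a j x * b j x - a₀ x * b₀ x = a j x * (b j x - b₀ x) + (a j x - a₀ x) * b₀ x := by
          ring
        rw [h7]
        refine (abs_add_le _ _).trans ?_
        rw [abs_mul, abs_mul]
        gcongr
    _ = C' * (∫ x in K, |b j x - b₀ x|) + η * I := by
        rw [integral_add (i3.const_mul _) (i4.const_mul _), integral_const_mul, integral_const_mul]
    _ < ε := by
        have h8 : C' * (∫ x in K, |b j x - b₀ x|) < ε / 2 := by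
          have := mul_lt_mul_of_pos_left h1 hC'0
          have h9 : C' * (ε / (2 * C')) = ε / 2 := by field_simp
          linarith
        have h10 : η * I ≤ ε / 2 := by
          have : η * (I + 1) ≤ ε / 2 := by
            have := mul_le_mul_of_nonneg_right (min_le_right 1 (ε / (2 * (I + 1))))
              (by positivity : (0 : ℝ) ≤ I + 1)
            have h9 : ε / (2 * (I + 1)) * (I + 1) = ε / 2 := by field_simp
            linarith
          nlinarith
        linarith

theorem tendstoUniformlyOn_mul_left {K : Set (RVec d)} (hK : IsCompact K) {c : RVec d → ℝ}
    (hc : Continuous c) {a : ℕ → RVec d → ℝ} {a₀ : RVec d → ℝ}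
    (hu : TendstoUniformlyOn a a₀ atTop K) :
    TendstoUniformlyOn (fun j x => c x * a j x) (fun x => c x * a₀ x) atTop K := by
  obtain ⟨C, hC⟩ := hK.exists_bound_of_continuousOn hc.continuousOn
  rw [Metric.tendstoUniformlyOn_iff] at hu ⊢
  intro ε hε
  filter_upwards [hu (ε / (|C| + 1)) (by positivity)] with j hj x hx
  have h1 := hj x hx
  have h2 := (hC x hx).trans (le_abs_self C)
  rw [Real.dist_eq] at h1 ⊢
  rw [← mul_sub, abs_mul]
  rw [Real.norm_eq_abs] at h2
  rw [lt_div_iff₀ (by positivity)] at h1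
  have := abs_nonneg (a₀ x - a j x)
  nlinarith

/-- Integration by parts against the constant function `1`. -/
theorem integral_partialD_eq_zero {f : RVec d → ℝ} (hf : ContDiff ℝ 1 f)
    (hc : HasCompactSupport f) : ∫ x, partialD k f x = 0 := by
  have hd : Integrable (fun x => (1 : ℝ) * fderiv ℝ f x (EuclideanSpace.single k 1)) := by
    have hdc : HasCompactSupport (partialD k f) :=
      hc.of_isClosed_subset (isClosed_tsupport _) tsupport_partialD_subset
    simp only [one_mul]
    exact (continuous_partialD hf).integrable_of_hasCompactSupport hdc
  have h := integral_mul_fderiv_eq_neg_fderiv_mul_of_integrable (μ := (volume : Measure (RVec d)))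
    (f := fun _ => (1 : ℝ)) (g := f) (v := EuclideanSpace.single k 1) (by simp)
    hd (by simpa using hf.continuous.integrable_of_hasCompactSupport (μ := volume) hc)
    (fun _ _ => differentiableAt_const _) (fun x _ => hf.differentiable one_ne_zero x)
  simpa [partialD] using h

theorem setIntegral_eq_of_subset_of_forall_notMem {Ω K : Set (RVec d)} {f : RVec d → ℝ} (hK : MeasurableSet K)
    (hKΩ : K ⊆ Ω) (h0 : ∀ x, x ∉ K → f x = 0) : ∫ x in Ω, f x = ∫ x in K, f x := by
  have h : f = K.indicator f := by
    ext x
    by_cases hx : x ∈ K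
    · simp [hx]
    · simp [hx, h0 x hx]
  conv_lhs => rw [h]
  rw [setIntegral_indicator hK, inter_eq_self_of_subset_right hKΩ]

theorem IsWeakPD.congr {f g f' g' : RVec d → ℝ} (h : IsWeakPD Ω k f g)
    (hf : f =ᵐ[volume.restrict Ω] f') (hg : g =ᵐ[volume.restrict Ω] g') : IsWeakPD Ω k f' g' := by
  intro φ hφ
  have h1 : ∫ x in Ω, partialD k φ x * f x = ∫ x in Ω, partialD k φ x * f' x :=
    integral_congr_ae (hf.mono fun x hx => by simp only [hx])
  have h2 : ∫ x in Ω, φ x * g x = ∫ x in Ω, φ x * g' x :=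
    integral_congr_ae (hg.mono fun x hx => by simp only [hx])
  rw [← h1, ← h2]
  exact h φ hφ

/-- The definition of weak derivatives extends to test functions of class `C¹`. -/
theorem IsWeakPD.integral_of_contDiff_one (hΩ : IsOpen Ω) {f g : RVec d → ℝ} (hf : Continuous f)
    (hg : IntegrableOn g Ω) (h : IsWeakPD Ω k f g) {φ : RVec d → ℝ} (hφ : ContDiff ℝ 1 φ)
    (hc : HasCompactSupport φ) (hs : tsupport φ ⊆ Ω) :
    ∫ x in Ω, partialD k φ x * f x = -∫ x in Ω, φ x * g x := by
  set K := tsupport φ with hKdef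
  have hK : IsCompact K := hc
  -- It is `f` that is smoothed, not `φ`: for smooth `F j` the identity says that `∂_k (φ F_j)` has
  -- integral zero, which needs `φ` only `C¹`.
  obtain ⟨F, hF, hFu, hFL⟩ := h.exists_smooth_approx hΩ hf hg hK hs
  have hF1 : ∀ j, ContDiff ℝ 1 (F j) := fun j => (hF j).of_le (by exact_mod_cast le_top)
  have z1 : ∀ x, x ∉ K → φ x = 0 := fun x hx => image_eq_zero_of_notMem_tsupport hx
  have z2 : ∀ x, x ∉ K → partialD k φ x = 0 := fun x hx =>
    image_eq_zero_of_notMem_tsupport fun h' => hx (tsupport_partialD_subset h')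
  rw [setIntegral_eq_of_subset_of_forall_notMem hK.measurableSet hs (fun x hx => by simp [z2 x hx]),
    setIntegral_eq_of_subset_of_forall_notMem hK.measurableSet hs (fun x hx => by simp [z1 x hx])]
  have t1 := tendsto_setIntegral_mul hK (a := F) (b := fun _ => partialD k φ)
    (b₀ := partialD k φ)
    (fun j => (hF j).continuous) hf hFu
    (fun j => (continuous_partialD hφ).continuousOn.integrableOn_compact hK)
    ((continuous_partialD hφ).continuousOn.integrableOn_compact hK) (by simp)
  have t2 := tendsto_setIntegral_mul hK (a := fun _ => φ) (b := fun j => partialD k (F j))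
    (fun j => hφ.continuous) hφ.continuous
    (Metric.tendstoUniformlyOn_iff.mpr fun ε hε => by simp [hε])
    (fun j => (continuous_partialD (hF1 j)).continuousOn.integrableOn_compact hK)
    (hg.mono_set hs) hFL
  have e : ∀ j, ∫ x in K, F j x * partialD k φ x = -∫ x in K, φ x * partialD k (F j) x := by
    intro j
    have h0 := integral_partialD_eq_zero (k := k) (hφ.mul (hF1 j)) hc.mul_right
    have h1 : ∀ x, partialD k (fun x => φ x * F j x) x
        = F j x * partialD k φ x + φ x * partialD k (F j) x := fun x => by
      rw [partialD_mul (hφ.differentiable one_ne_zero x) ((hF1 j).differentiable one_ne_zero x)]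
      ring
    change ∫ x, partialD k (fun x => φ x * F j x) x = 0 at h0
    simp_rw [h1] at h0
    rw [← setIntegral_univ, setIntegral_eq_of_subset_of_forall_notMem hK.measurableSet (subset_univ _)
      (fun x hx => by simp [z1 x hx, z2 x hx]), integral_add
      (f := fun x => F j x * partialD k φ x) (g := fun x => φ x * partialD k (F j) x)
      (((hF j).continuous.mul (continuous_partialD hφ)).continuousOn.integrableOn_compact hK)
      ((hφ.continuous.mul (continuous_partialD (hF1 j))).continuousOn.integrableOn_compact hK)] at h0
    linarith
  simp_rw [e] at t1
  have := tendsto_nhds_unique t1 t2.neg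
  simp_rw [mul_comm (f _)] at this
  exact this

/-- Only the first factor has to be smoothed: `φ * F j` is then a legitimate test function for the
second, and the limit pairs uniform with `L¹` convergence. -/
theorem IsWeakPD.mul (hΩ : IsOpen Ω) {f₁ g₁ f₂ g₂ : RVec d → ℝ} (hf₁ : Continuous f₁)
    (hg₁ : IntegrableOn g₁ Ω) (h₁ : IsWeakPD Ω k f₁ g₁) (hf₂ : Continuous f₂)
    (hg₂ : IntegrableOn g₂ Ω) (h₂ : IsWeakPD Ω k f₂ g₂) :
    IsWeakPD Ω k (fun x => f₁ x * f₂ x) (fun x => f₁ x * g₂ x + g₁ x * f₂ x) := by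
  intro φ hφ
  set K := tsupport φ with hKdef
  have hK : IsCompact K := hφ.compactSupp
  have hs : K ⊆ Ω := hφ.supp_subset
  have hφ1 : ContDiff ℝ 1 φ := hφ.smooth.of_le (by exact_mod_cast le_top)
  obtain ⟨F, hF, hFu, hFL⟩ := h₁.exists_smooth_approx hΩ hf₁ hg₁ hK hs
  have hF1 : ∀ j, ContDiff ℝ 1 (F j) := fun j => (hF j).of_le (by exact_mod_cast le_top)
  have z1 : ∀ x, x ∉ K → φ x = 0 := fun x hx => image_eq_zero_of_notMem_tsupport hx
  have z2 : ∀ x, x ∉ K → partialD k φ x = 0 := fun x hx =>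
    image_eq_zero_of_notMem_tsupport fun h' => hx (tsupport_partialD_subset h')
  rw [setIntegral_eq_of_subset_of_forall_notMem hK.measurableSet hs (fun x hx => by simp [z2 x hx]),
    setIntegral_eq_of_subset_of_forall_notMem hK.measurableSet hs (fun x hx => by simp [z1 x hx])]
  have i2 : IntegrableOn g₂ K := hg₂.mono_set hs
  have i1 : IntegrableOn g₁ K := hg₁.mono_set hs
  have cdφ := continuous_partialD (k := k) hφ1
  have t1 := tendsto_setIntegral_mul hK (a := F) (b := fun _ x => partialD k φ x * f₂ x)
    (b₀ := fun x => partialD k φ x * f₂ x)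
    (fun j => (hF j).continuous) hf₁ hFu
    (fun j => (cdφ.mul hf₂).continuousOn.integrableOn_compact hK)
    ((cdφ.mul hf₂).continuousOn.integrableOn_compact hK) (by simp)
  have t2 := tendsto_setIntegral_mul hK (a := F) (b := fun _ x => φ x * g₂ x)
    (b₀ := fun x => φ x * g₂ x)
    (fun j => (hF j).continuous) hf₁ hFu
    (fun j => i2.continuousOn_mul hφ1.continuous.continuousOn hK)
    (i2.continuousOn_mul hφ1.continuous.continuousOn hK) (by simp)
  have t3 := tendsto_setIntegral_mul hK (a := fun _ x => φ x * f₂ x)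
    (a₀ := fun x => φ x * f₂ x) (b := fun j => partialD k (F j))
    (fun j => hφ1.continuous.mul hf₂) (hφ1.continuous.mul hf₂)
    (Metric.tendstoUniformlyOn_iff.mpr fun ε hε => by simp [hε])
    (fun j => (continuous_partialD (hF1 j)).continuousOn.integrableOn_compact hK)
    i1 hFL
  have e : ∀ j, ∫ x in K, F j x * (partialD k φ x * f₂ x)
      = -(∫ x in K, F j x * (φ x * g₂ x)) - ∫ x in K, φ x * f₂ x * partialD k (F j) x := by
    intro j
    have h0 := h₂ _ (hφ.mul_smooth (hF j))
    have h1 : ∀ x, partialD k (fun x => φ x * F j x) x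
        = F j x * partialD k φ x + φ x * partialD k (F j) x := fun x => by
      rw [partialD_mul (hφ1.differentiable one_ne_zero x) ((hF1 j).differentiable one_ne_zero x)]
      ring
    simp_rw [h1] at h0
    rw [setIntegral_eq_of_subset_of_forall_notMem hK.measurableSet hs (fun x hx => by simp [z1 x hx, z2 x hx]),
      setIntegral_eq_of_subset_of_forall_notMem hK.measurableSet hs (fun x hx => by simp [z1 x hx])] at h0
    have h2 : ∫ x in K, (F j x * partialD k φ x + φ x * partialD k (F j) x) * f₂ x
        = (∫ x in K, F j x * (partialD k φ x * f₂ x))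
          + ∫ x in K, φ x * f₂ x * partialD k (F j) x := by
      rw [← integral_add (f := fun x => F j x * (partialD k φ x * f₂ x))
        (g := fun x => φ x * f₂ x * partialD k (F j) x)
        (((hF j).continuous.mul (cdφ.mul hf₂)).continuousOn.integrableOn_compact hK)
        (((hφ1.continuous.mul hf₂).mul
          (continuous_partialD (hF1 j))).continuousOn.integrableOn_compact hK)]
      congr 1
      ext x
      ring
    have h3 : ∫ x in K, φ x * F j x * g₂ x = ∫ x in K, F j x * (φ x * g₂ x) := by
      congr 1
      ext x
      ring
    rw [h2, h3] at h0
    linarith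
  simp_rw [e] at t1
  have hlim := tendsto_nhds_unique t1 (t2.neg.sub t3)
  have e4 : ∫ x in K, partialD k φ x * (f₁ x * f₂ x) = ∫ x in K, f₁ x * (partialD k φ x * f₂ x) := by
    congr 1
    ext x
    ring
  have e5 : ∫ x in K, φ x * (f₁ x * g₂ x + g₁ x * f₂ x)
      = (∫ x in K, f₁ x * (φ x * g₂ x)) + ∫ x in K, φ x * f₂ x * g₁ x := by
    rw [← integral_add (f := fun x => f₁ x * (φ x * g₂ x)) (g := fun x => φ x * f₂ x * g₁ x)
      ((i2.continuousOn_mul hφ1.continuous.continuousOn hK).continuousOn_mul hf₁.continuousOn hK)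
      (i1.continuousOn_mul (hφ1.continuous.mul hf₂).continuousOn hK)]
    congr 1
    ext x
    ring
  rw [e4, e5, hlim]
  ring

/-- For the approximants this is the classical chain rule; `exp (F j)` converges uniformly on the
support of the test function while the derivatives converge in `L¹`. -/
theorem IsWeakPD.exp (hΩ : IsOpen Ω) {f g : RVec d → ℝ} (hf : Continuous f)
    (hg : IntegrableOn g Ω) (h : IsWeakPD Ω k f g) :
    IsWeakPD Ω k (fun x => Real.exp (f x)) (fun x => Real.exp (f x) * g x) := by
  intro φ hφ
  set K := tsupport φ with hKdef
  have hK : IsCompact K := hφ.compactSupp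
  have hs : K ⊆ Ω := hφ.supp_subset
  have hφ1 : ContDiff ℝ 1 φ := hφ.smooth.of_le (by exact_mod_cast le_top)
  obtain ⟨F, hF, hFu, hFL⟩ := h.exists_smooth_approx hΩ hf hg hK hs
  have hF1 : ∀ j, ContDiff ℝ 1 (F j) := fun j => (hF j).of_le (by exact_mod_cast le_top)
  have z1 : ∀ x, x ∉ K → φ x = 0 := fun x hx => image_eq_zero_of_notMem_tsupport hx
  have z2 : ∀ x, x ∉ K → partialD k φ x = 0 := fun x hx =>
    image_eq_zero_of_notMem_tsupport fun h' => hx (tsupport_partialD_subset h')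
  rw [setIntegral_eq_of_subset_of_forall_notMem hK.measurableSet hs (fun x hx => by simp [z2 x hx]),
    setIntegral_eq_of_subset_of_forall_notMem hK.measurableSet hs (fun x hx => by simp [z1 x hx])]
  have cdφ := continuous_partialD (k := k) hφ1
  have heu : TendstoUniformlyOn (fun j x => Real.exp (F j x)) (fun x => Real.exp (f x)) atTop K := by
    -- On one compact interval containing the values of `f` and eventually those of `F j`, the
    -- exponential is uniformly continuous.
    obtain ⟨C, hC⟩ := hK.exists_bound_of_continuousOn hf.continuousOn
    have hcomp : IsCompact (Icc (-(C + 1)) (C + 1)) := isCompact_Icc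
    have hunif := hcomp.uniformContinuousOn_of_continuous Real.continuous_exp.continuousOn
    have hev : ∀ᶠ j in atTop, ∀ x ∈ K, F j x ∈ Icc (-(C + 1)) (C + 1) := by
      filter_upwards [Metric.tendstoUniformlyOn_iff.mp hFu 1 one_pos] with j hj x hx
      have h1 := hj x hx
      have h2 := hC x hx
      rw [Real.dist_eq, abs_lt] at h1
      rw [Real.norm_eq_abs, abs_le] at h2
      constructor <;> linarith
    have hmem : ∀ x ∈ K, f x ∈ Icc (-(C + 1)) (C + 1) := by
      intro x hx
      have h2 := hC x hx
      rw [Real.norm_eq_abs, abs_le] at h2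
      constructor <;> linarith
    rw [Metric.uniformContinuousOn_iff] at hunif
    rw [Metric.tendstoUniformlyOn_iff] at hFu ⊢
    intro ε hε
    obtain ⟨δ, hδ, hunif⟩ := hunif ε hε
    filter_upwards [hev, hFu δ hδ] with j hj hj' x hx
    exact hunif _ (hmem x hx) _ (hj x hx) (hj' x hx)
  have t1 := tendsto_setIntegral_mul hK (b := fun _ => partialD k φ)
    (a := fun j x => Real.exp (F j x)) (a₀ := fun x => Real.exp (f x))
    (fun j => Real.continuous_exp.comp (hF j).continuous) (Real.continuous_exp.comp hf) heu
    (fun j => cdφ.continuousOn.integrableOn_compact hK)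
    (cdφ.continuousOn.integrableOn_compact hK) (by simp)
  have t2 := tendsto_setIntegral_mul hK (b := fun j => partialD k (F j))
    (a := fun j x => φ x * Real.exp (F j x)) (a₀ := fun x => φ x * Real.exp (f x))
    (fun j => hφ1.continuous.mul (Real.continuous_exp.comp (hF j).continuous))
    (hφ1.continuous.mul (Real.continuous_exp.comp hf))
    (tendstoUniformlyOn_mul_left hK hφ1.continuous heu)
    (fun j => (continuous_partialD (hF1 j)).continuousOn.integrableOn_compact hK)
    (hg.mono_set hs) hFL
  have e : ∀ j, ∫ x in K, Real.exp (F j x) * partialD k φ x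
      = -∫ x in K, φ x * Real.exp (F j x) * partialD k (F j) x := by
    intro j
    have hE : ContDiff ℝ 1 (fun x => Real.exp (F j x)) := (hF1 j).exp
    have h0 := integral_partialD_eq_zero (k := k) (hφ1.mul hE) hφ.compactSupp.mul_right
    have h1 : ∀ x, partialD k (fun x => φ x * Real.exp (F j x)) x
        = Real.exp (F j x) * partialD k φ x + φ x * Real.exp (F j x) * partialD k (F j) x := by
      intro x
      rw [partialD_mul (hφ1.differentiable one_ne_zero x) (hE.differentiable one_ne_zero x)]
      have : partialD k (fun x => Real.exp (F j x)) x = Real.exp (F j x) * partialD k (F j) x := by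
        unfold partialD
        rw [fderiv_exp ((hF1 j).differentiable one_ne_zero x)]
        simp
      rw [this]
      ring
    change ∫ x, partialD k (fun x => φ x * Real.exp (F j x)) x = 0 at h0
    simp_rw [h1] at h0
    rw [← setIntegral_univ, setIntegral_eq_of_subset_of_forall_notMem hK.measurableSet (subset_univ _)
      (fun x hx => by simp [z1 x hx, z2 x hx]), integral_add
      (f := fun x => Real.exp (F j x) * partialD k φ x)
      (g := fun x => φ x * Real.exp (F j x) * partialD k (F j) x)
      ((hE.continuous.mul cdφ).continuousOn.integrableOn_compact hK)
      (((hφ1.continuous.mul hE.continuous).mul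
        (continuous_partialD (hF1 j))).continuousOn.integrableOn_compact hK)] at h0
    linarith
  simp_rw [e] at t1
  have := tendsto_nhds_unique t1 t2.neg
  simp_rw [mul_comm (partialD k φ _), ← mul_assoc]
  exact this

/-- Classical derivatives are weak derivatives. -/
theorem IsWeakPD.of_contDiffOn (hΩ : IsOpen Ω) {f : RVec d → ℝ} (hf : ContDiffOn ℝ 1 f Ω) :
    IsWeakPD Ω k f (partialD k f) := by
  intro φ hφ
  have hφ1 : ContDiff ℝ 1 φ := hφ.smooth.of_le (by exact_mod_cast le_top)
  -- The support of `φ` lies in `Ω`, so the values of `f` elsewhere do not affect smoothness of the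
  -- product.
  have hprod : ContDiff ℝ 1 (fun x => φ x * f x) := by
    rw [contDiff_iff_contDiffAt]
    intro x
    by_cases hx : x ∈ tsupport φ
    · exact hφ1.contDiffAt.mul (hf.contDiffAt (hΩ.mem_nhds (hφ.supp_subset hx)))
    · have : (fun x => φ x * f x) =ᶠ[𝓝 x] fun _ => 0 := by
        filter_upwards [(isClosed_tsupport φ).isOpen_compl.mem_nhds hx] with y hy
        simp [image_eq_zero_of_notMem_tsupport hy]
      exact contDiffAt_const.congr_of_eventuallyEq this
  have h0 := integral_partialD_eq_zero (k := k) hprod hφ.compactSupp.mul_right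
  set K := tsupport φ with hKdef
  have hK : IsCompact K := hφ.compactSupp
  have hs : K ⊆ Ω := hφ.supp_subset
  have z1 : ∀ x, x ∉ K → φ x = 0 := fun x hx => image_eq_zero_of_notMem_tsupport hx
  have z2 : ∀ x, x ∉ K → partialD k φ x = 0 := fun x hx =>
    image_eq_zero_of_notMem_tsupport fun h' => hx (tsupport_partialD_subset h')
  have z3 : ∀ x, x ∉ K → partialD k (fun x => φ x * f x) x = 0 := fun x hx =>
    image_eq_zero_of_notMem_tsupport fun h' => hx
      (closure_mono (Function.support_mul_subset_left φ f) (tsupport_partialD_subset h'))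
  rw [← setIntegral_univ, setIntegral_eq_of_subset_of_forall_notMem hK.measurableSet (subset_univ _) z3] at h0
  rw [setIntegral_eq_of_subset_of_forall_notMem hK.measurableSet hs (fun x hx => by simp [z2 x hx]),
    setIntegral_eq_of_subset_of_forall_notMem hK.measurableSet hs (fun x hx => by simp [z1 x hx])]
  have hdf : ContinuousOn (partialD k f) K :=
    ((hf.continuousOn_fderiv_of_isOpen hΩ le_rfl).clm_apply continuousOn_const).mono hs
  have h1 : ∫ x in K, partialD k (fun x => φ x * f x) x
      = ∫ x in K, (partialD k φ x * f x + φ x * partialD k f x) :=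
    setIntegral_congr_fun hK.measurableSet fun x hx =>
      partialD_mul (hφ1.differentiable one_ne_zero x)
        ((hf.contDiffAt (hΩ.mem_nhds (hs hx))).differentiableAt one_ne_zero)
  rw [h1, integral_add
    (f := fun x => partialD k φ x * f x) (g := fun x => φ x * partialD k f x)
    (((continuous_partialD hφ1).continuousOn.mul
      (hf.continuousOn.mono hs)).integrableOn_compact hK)
    ((hφ1.continuous.continuousOn.mul hdf).integrableOn_compact hK)] at h0
  linarith

end Calculus

/-! ### Boundary charts adapted to a normal direction -/

section Chart

variable {m : ℕ}

/-- Orthogonal splittings of Euclidean space into a hyperplane and a normal line. -/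
abbrev Splitting (m : ℕ) : Type := WithLp 2 (RVec m × ℝ) ≃ₗᵢ[ℝ] RVec (m + 1)

/-- The normal direction of a splitting. -/
noncomputable def Splitting.normal (e : Splitting m) : RVec (m + 1) := e (WithLp.toLp 2 (0, 1))

/-- Take any isometric identification and compose it with the reflection that exchanges the image of
the vertical unit vector with `ν`. -/
theorem exists_splitting {ν : RVec (m + 1)} (hν : ‖ν‖ = 1) : ∃ e : Splitting m, e.normal = ν := by
  have hfr : Module.finrank ℝ (WithLp 2 (RVec m × ℝ)) = m + 1 := by
    rw [LinearEquiv.finrank_eq (WithLp.linearEquiv 2 ℝ (RVec m × ℝ))]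
    simp
  let b := (stdOrthonormalBasis ℝ (WithLp 2 (RVec m × ℝ))).reindex (finCongr hfr)
  let e₀ : Splitting m := b.repr
  set v := e₀ (WithLp.toLp 2 (0, 1)) with hv
  have hvn : ‖v‖ = ‖ν‖ := by
    rw [hv, LinearIsometryEquiv.norm_map, hν]
    simp
  refine ⟨e₀.trans (Submodule.span ℝ {v - ν})ᗮ.reflection, ?_⟩
  simp only [Splitting.normal, LinearIsometryEquiv.trans_apply]
  exact Submodule.reflection_sub hvn

/-- The chart `(y, s) ↦ x₀ + e (y, s)`. -/
noncomputable def normalChart (e : Splitting m) (x₀ : RVec (m + 1)) : RVec m × ℝ ≃ₜ RVec (m + 1) :=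
  (WithLp.homeomorphProd 2 _ _).symm.trans (e.toHomeomorph.trans (Homeomorph.addLeft x₀))

variable (e : Splitting m) (x₀ : RVec (m + 1))

theorem normalChart_apply (p : RVec m × ℝ) : normalChart e x₀ p = x₀ + e (WithLp.toLp 2 p) := rfl

theorem normalChart_zero : normalChart e x₀ 0 = x₀ := by
  rw [normalChart_apply]
  simp

theorem normalChart_sub (p q : RVec m × ℝ) :
    normalChart e x₀ p - normalChart e x₀ q = e (WithLp.toLp 2 (p - q)) := by
  rw [normalChart_apply, normalChart_apply, add_sub_add_left_eq_sub, ← map_sub, ← WithLp.toLp_sub]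

theorem norm_normalChart_sub_sq (p q : RVec m × ℝ) :
    ‖normalChart e x₀ p - normalChart e x₀ q‖ ^ 2 = ‖p.1 - q.1‖ ^ 2 + (p.2 - q.2) ^ 2 := by
  rw [normalChart_sub, LinearIsometryEquiv.norm_map, WithLp.prod_norm_sq_eq_of_L2]
  simp

theorem norm_normalChart_sub_le (p q : RVec m × ℝ) :
    ‖normalChart e x₀ p - normalChart e x₀ q‖ ≤ ‖p.1 - q.1‖ + |p.2 - q.2| := by
  refine abs_le_of_sq_le_sq' ?_ (by positivity) |>.2
  rw [norm_normalChart_sub_sq, ← sq_abs (p.2 - q.2)]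
  nlinarith [norm_nonneg (p.1 - q.1), abs_nonneg (p.2 - q.2)]

theorem norm_fst_sub_le (p q : RVec m × ℝ) :
    ‖p.1 - q.1‖ ≤ ‖normalChart e x₀ p - normalChart e x₀ q‖ := by
  refine abs_le_of_sq_le_sq' ?_ (by positivity) |>.2
  rw [norm_normalChart_sub_sq]
  nlinarith [sq_nonneg (p.2 - q.2)]

theorem norm_normal : ‖e.normal‖ = 1 := by
  have h := norm_normalChart_sub_sq e 0 (0, 1) 0
  rw [normalChart_sub] at h
  simp only [sub_zero] at h
  have h' : ‖e.normal‖ ^ 2 = 1 := by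
    rw [Splitting.normal, h]
    norm_num
  have h0 := norm_nonneg e.normal
  nlinarith

theorem inner_normal_normalChart_sub (p q : RVec m × ℝ) :
    inner ℝ e.normal (normalChart e x₀ p - normalChart e x₀ q) = p.2 - q.2 := by
  rw [normalChart_sub, Splitting.normal, LinearIsometryEquiv.inner_map_map, WithLp.prod_inner_apply]
  simp

theorem measurePreserving_normalChart :
    MeasurePreserving (normalChart e x₀) (volume.prod volume) volume :=
  (measurePreserving_add_left volume x₀).comp
    (e.measurePreserving.comp (WithLp.volume_preserving_toLp (RVec m) ℝ))

theorem normalChart_add_smul (y : RVec m) (s t : ℝ) :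
    normalChart e x₀ (y, s + t) = normalChart e x₀ (y, s) + t • e.normal := by
  have h := normalChart_sub e x₀ (y, s + t) (y, s)
  rw [sub_eq_iff_eq_add'] at h
  rw [h, Splitting.normal, ← map_smul, ← WithLp.toLp_smul]
  simp

theorem normalChart_mem_ball {ρ : ℝ} {p : RVec m × ℝ} (hy : p.1 ∈ Metric.ball (0 : RVec m) ρ)
    (hs : p.2 ∈ Icc (-ρ) ρ) : normalChart e x₀ p ∈ Metric.ball x₀ (2 * ρ) := by
  rw [Metric.mem_ball, dist_eq_norm]
  nth_rewrite 2 [← normalChart_zero e x₀]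
  refine (norm_normalChart_sub_le e x₀ p 0).trans_lt ?_
  have h1 : ‖p.1‖ < ρ := by simpa using hy
  have h2 : |p.2| ≤ ρ := abs_le.mpr hs
  simp only [Prod.fst_zero, Prod.snd_zero, sub_zero]
  linarith

/-- The function `φ` of class `C¹` vanishes at `x₀`, and its derivative stays within relative
distance `ε` of `a` times the normal direction, on the ball of radius `2ρ` around `x₀`. -/
structure IsGraphChart (φ : RVec (m + 1) → ℝ) (a ε ρ : ℝ) : Prop where
  a_pos : 0 < a
  eps_pos : 0 < ε
  eps_le : ε ≤ 1 / 4
  rho_pos : 0 < ρ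
  smooth : ContDiffOn ℝ 1 φ (Metric.ball x₀ (2 * ρ))
  zero : φ x₀ = 0
  close : ∀ x ∈ Metric.ball x₀ (2 * ρ), ‖fderiv ℝ φ x - a • innerSL ℝ e.normal‖ ≤ ε * a

namespace IsGraphChart

variable {e x₀} {φ : RVec (m + 1) → ℝ} {a ε ρ : ℝ} (h : IsGraphChart e x₀ φ a ε ρ)

include h

theorem differentiableAt {x : RVec (m + 1)} (hx : x ∈ Metric.ball x₀ (2 * ρ)) :
    DifferentiableAt ℝ φ x :=
  (h.smooth.contDiffAt (Metric.isOpen_ball.mem_nhds hx)).differentiableAt one_ne_zero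

/-- Mean value inequality, on a convex ball, for `φ` minus its linear model `a ⟨normal, ·⟩`. -/
theorem abs_sub_le {x x' : RVec (m + 1)} (hx : x ∈ Metric.ball x₀ (2 * ρ))
    (hx' : x' ∈ Metric.ball x₀ (2 * ρ)) :
    |φ x - φ x' - a * inner ℝ e.normal (x - x')| ≤ ε * a * ‖x - x'‖ := by
  have := Convex.norm_image_sub_le_of_norm_fderiv_le' (𝕜 := ℝ) (f := φ)
    (fun y hy => h.differentiableAt hy) h.close (convex_ball x₀ (2 * ρ)) hx' hx
  simpa using this

theorem continuousOn_line {y : RVec m} (hy : y ∈ Metric.ball (0 : RVec m) ρ) :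
    ContinuousOn (fun s => φ (normalChart e x₀ (y, s))) (Icc (-ρ) ρ) :=
  h.smooth.continuousOn.comp
    ((normalChart e x₀).continuous.comp (Continuous.prodMk_right y)).continuousOn
    fun _ hs => normalChart_mem_ball e x₀ hy hs

theorem abs_line_sub_le {y : RVec m} (hy : y ∈ Metric.ball (0 : RVec m) ρ) {s t : ℝ}
    (hs : s ∈ Icc (-ρ) ρ) (ht : t ∈ Icc (-ρ) ρ) :
    |φ (normalChart e x₀ (y, s)) - φ (normalChart e x₀ (y, t)) - a * (s - t)|
      ≤ ε * a * |s - t| := by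
  have := h.abs_sub_le (normalChart_mem_ball e x₀ (p := (y, s)) hy hs) (normalChart_mem_ball e x₀ (p := (y, t)) hy ht)
  rw [inner_normal_normalChart_sub] at this
  refine this.trans ?_
  have h1 := norm_normalChart_sub_le e x₀ (y, s) (y, t)
  simp only [sub_self, norm_zero, zero_add] at h1
  have := h.a_pos
  have := h.eps_pos
  gcongr

/-- Since `ε ≤ 1 / 4`, the slope of `φ` along vertical lines is at least `3a / 4`. This strict
monotonicity makes the height unique. -/
theorem half_mul_le_line_sub {y : RVec m} (hy : y ∈ Metric.ball (0 : RVec m) ρ) {s t : ℝ}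
    (hs : s ∈ Icc (-ρ) ρ) (ht : t ∈ Icc (-ρ) ρ) (hst : s ≤ t) :
    a / 2 * (t - s) ≤ φ (normalChart e x₀ (y, t)) - φ (normalChart e x₀ (y, s)) := by
  have h1 := h.abs_line_sub_le hy ht hs
  rw [abs_of_nonneg (sub_nonneg.mpr hst)] at h1
  have h2 := (abs_le.mp h1).1
  have h3 : ε * a * (t - s) ≤ 1 / 4 * a * (t - s) := by
    have := h.a_pos
    have := h.eps_le
    have := sub_nonneg.mpr hst
    gcongr
  nlinarith [mul_nonneg h.a_pos.le (sub_nonneg.mpr hst)]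

/-- At the ends of the vertical segment the linear model equals `± a ρ`, and its error `ε a ‖x - x₀‖
≤ (1 / 4) a (2 ρ)` is only half of that. The sign change produces the height by the intermediate
value theorem. -/
theorem line_right {y : RVec m} (hy : y ∈ Metric.ball (0 : RVec m) ρ) :
    a * ρ / 2 ≤ φ (normalChart e x₀ (y, ρ)) ∧ φ (normalChart e x₀ (y, -ρ)) ≤ -(a * ρ / 2) := by
  have hρ := h.rho_pos
  have key : ∀ s : ℝ, |s| = ρ → |φ (normalChart e x₀ (y, s)) - a * s| ≤ a * ρ / 2 := by
    intro s hs
    have hs' : s ∈ Icc (-ρ) ρ := abs_le.mp hs.le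
    have h1 := h.abs_sub_le (normalChart_mem_ball e x₀ (p := (y, s)) hy hs')
      (Metric.mem_ball_self (by linarith : 0 < 2 * ρ))
    have h2 := inner_normal_normalChart_sub e x₀ (y, s) 0
    have h3 := norm_normalChart_sub_le e x₀ (y, s) 0
    rw [normalChart_zero] at h2 h3
    rw [h2, h.zero] at h1
    simp only [sub_zero, Prod.fst_zero, Prod.snd_zero, hs] at h1 h3
    have h4 : ‖y‖ < ρ := by simpa using hy
    refine h1.trans ?_
    have h5 : ‖normalChart e x₀ (y, s) - x₀‖ ≤ 2 * ρ := by linarith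
    have h6 := h.eps_le
    have h7 := h.a_pos
    have h8 := h.eps_pos
    calc ε * a * ‖normalChart e x₀ (y, s) - x₀‖ ≤ 1 / 4 * a * (2 * ρ) := by gcongr
      _ = a * ρ / 2 := by ring
  constructor
  · have := abs_le.mp (key ρ (abs_of_pos hρ))
    linarith [this.1]
  · have := abs_le.mp (key (-ρ) (by rw [abs_neg, abs_of_pos hρ]))
    linarith [this.2]

theorem exists_height : ∃ γ : RVec m → ℝ, ∀ y ∈ Metric.ball (0 : RVec m) ρ,
    γ y ∈ Ioo (-ρ) ρ ∧ φ (normalChart e x₀ (y, γ y)) = 0 := by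
  have : ∀ y : RVec m, ∃ s, y ∈ Metric.ball (0 : RVec m) ρ →
      s ∈ Ioo (-ρ) ρ ∧ φ (normalChart e x₀ (y, s)) = 0 := by
    intro y
    by_cases hy : y ∈ Metric.ball (0 : RVec m) ρ
    · have hρ := h.rho_pos
      have h1 := h.line_right hy
      have hpos : 0 < a * ρ / 2 := by have := h.a_pos; positivity
      obtain ⟨s, hs, hs0⟩ := intermediate_value_Ioo (by linarith : -ρ ≤ ρ) (h.continuousOn_line hy)
        (show (0 : ℝ) ∈ Ioo _ _ from ⟨by linarith [h1.2], by linarith [h1.1]⟩)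
      exact ⟨s, fun _ => ⟨hs, hs0⟩⟩
    · exact ⟨0, fun h => absurd h hy⟩
  choose γ hγ using this
  exact ⟨γ, hγ⟩

end IsGraphChart

/-- The height function of a graph chart. -/
noncomputable def IsGraphChart.height {e : Splitting m} {x₀ : RVec (m + 1)} {φ : RVec (m + 1) → ℝ}
    {a ε ρ : ℝ} (h : IsGraphChart e x₀ φ a ε ρ) : RVec m → ℝ := h.exists_height.choose

/-- The parametrisation of the hypersurface in a graph chart. -/
noncomputable def IsGraphChart.graph {e : Splitting m} {x₀ : RVec (m + 1)} {φ : RVec (m + 1) → ℝ}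
    {a ε ρ : ℝ} (h : IsGraphChart e x₀ φ a ε ρ) (y : RVec m) : RVec (m + 1) :=
  normalChart e x₀ (y, h.height y)

namespace IsGraphChart

variable {e x₀} {φ : RVec (m + 1) → ℝ} {a ε ρ : ℝ} (h : IsGraphChart e x₀ φ a ε ρ)

include h

theorem height_mem {y : RVec m} (hy : y ∈ Metric.ball (0 : RVec m) ρ) : h.height y ∈ Ioo (-ρ) ρ :=
  (h.exists_height.choose_spec y hy).1

theorem map_graph {y : RVec m} (hy : y ∈ Metric.ball (0 : RVec m) ρ) : φ (h.graph y) = 0 :=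
  (h.exists_height.choose_spec y hy).2

theorem graph_mem_ball {y : RVec m} (hy : y ∈ Metric.ball (0 : RVec m) ρ) :
    h.graph y ∈ Metric.ball x₀ (2 * ρ) :=
  normalChart_mem_ball e x₀ (p := (y, h.height y)) hy (Ioo_subset_Icc_self (h.height_mem hy))

theorem eq_height {y : RVec m} (hy : y ∈ Metric.ball (0 : RVec m) ρ) {s : ℝ}
    (hs : s ∈ Icc (-ρ) ρ) (h0 : φ (normalChart e x₀ (y, s)) = 0) : s = h.height y := by
  have hγ := Ioo_subset_Icc_self (h.height_mem hy)
  have hm := h.map_graph hy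
  rw [graph] at hm
  have ha := h.a_pos
  rcases le_total s (h.height y) with hle | hle
  · have := h.half_mul_le_line_sub hy hs hγ hle
    rw [h0, hm] at this
    nlinarith
  · have := h.half_mul_le_line_sub hy hγ hs hle
    rw [h0, hm] at this
    nlinarith

/-- Points of a vertical line with small negative values of `φ` are close to the graph. -/
theorem abs_sub_height_le {y : RVec m} (hy : y ∈ Metric.ball (0 : RVec m) ρ) {s : ℝ}
    (hs : s ∈ Icc (-ρ) ρ) : |s - h.height y| ≤ 2 / a * |φ (normalChart e x₀ (y, s))| := by
  have hγ := Ioo_subset_Icc_self (h.height_mem hy)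
  have hm := h.map_graph hy
  rw [graph] at hm
  have ha := h.a_pos
  rw [div_mul_eq_mul_div, le_div_iff₀ ha]
  rcases le_total s (h.height y) with hle | hle
  · have := h.half_mul_le_line_sub hy hs hγ hle
    rw [hm] at this
    rw [abs_of_nonpos (sub_nonpos.mpr hle)]
    have := neg_le_abs (φ (normalChart e x₀ (y, s)))
    nlinarith
  · have := h.half_mul_le_line_sub hy hγ hs hle
    rw [hm] at this
    rw [abs_of_nonneg (sub_nonneg.mpr hle)]
    have := le_abs_self (φ (normalChart e x₀ (y, s)))
    nlinarith

/-- Both graph points are zeros of `φ`, so the height difference is at most `ε` times the distance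
of the points, which is bounded by base distance plus height difference. Absorbing the latter with
`ε ≤ 1 / 4` leaves slope at most `2 ε`: the graph is almost flat. -/
theorem abs_height_sub_le {y y' : RVec m} (hy : y ∈ Metric.ball (0 : RVec m) ρ)
    (hy' : y' ∈ Metric.ball (0 : RVec m) ρ) :
    |h.height y - h.height y'| ≤ 2 * ε * ‖y - y'‖ := by
  have h1 := h.abs_sub_le (h.graph_mem_ball hy) (h.graph_mem_ball hy')
  rw [h.map_graph hy, h.map_graph hy', graph, graph, inner_normal_normalChart_sub] at h1
  have h2 := norm_normalChart_sub_le e x₀ (y, h.height y) (y', h.height y')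
  simp only at h1 h2
  have ha := h.a_pos
  have hε := h.eps_pos
  have hε' := h.eps_le
  rw [sub_zero, zero_sub, abs_neg, abs_mul, abs_of_pos ha] at h1
  have h3 : |h.height y - h.height y'| ≤ ε * (‖y - y'‖ + |h.height y - h.height y'|) := by
    have h4 : a * |h.height y - h.height y'|
        ≤ a * (ε * (‖y - y'‖ + |h.height y - h.height y'|)) := by
      refine h1.trans ?_
      have := mul_le_mul_of_nonneg_left h2 (mul_pos hε ha).le
      linarith
    exact le_of_mul_le_mul_left h4 ha
  have h5 := norm_nonneg (y - y')
  have h6 := abs_nonneg (h.height y - h.height y')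
  nlinarith

theorem lipschitzOnWith_graph :
    LipschitzOnWith (Real.toNNReal (1 + 2 * ε)) h.graph (Metric.ball (0 : RVec m) ρ) := by
  have hε := h.eps_pos
  refine LipschitzOnWith.of_dist_le_mul fun y hy y' hy' => ?_
  rw [dist_eq_norm, dist_eq_norm, Real.coe_toNNReal _ (by linarith)]
  have h2 := norm_normalChart_sub_le e x₀ (y, h.height y) (y', h.height y')
  have h3 := h.abs_height_sub_le hy hy'
  simp only at h2
  simp only [graph]
  linarith

theorem continuousOn_graph : ContinuousOn h.graph (Metric.ball (0 : RVec m) ρ) :=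
  h.lipschitzOnWith_graph.continuousOn

end IsGraphChart

/-- The horizontal coordinate of the chart. -/
noncomputable def horiz (x : RVec (m + 1)) : RVec m := ((normalChart e x₀).symm x).1

theorem continuous_horiz : Continuous (horiz e x₀) :=
  continuous_fst.comp (normalChart e x₀).symm.continuous

theorem lipschitzWith_horiz : LipschitzWith 1 (horiz e x₀) := by
  refine LipschitzWith.of_dist_le_mul fun x x' => ?_
  have := norm_fst_sub_le e x₀ ((normalChart e x₀).symm x) ((normalChart e x₀).symm x')
  simpa [dist_eq_norm, horiz] using this

@[simp]
theorem horiz_normalChart (p : RVec m × ℝ) : horiz e x₀ (normalChart e x₀ p) = p.1 := by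
  simp [horiz]

theorem IsGraphChart.horiz_graph {e x₀} {φ : RVec (m + 1) → ℝ} {a ε ρ : ℝ}
    (h : IsGraphChart e x₀ φ a ε ρ) (y : RVec m) : horiz e x₀ (h.graph y) = y := by
  simp [IsGraphChart.graph]

/-- The open cylinder of a graph chart. -/
def chartCyl (ρ : ℝ) : Set (RVec (m + 1)) :=
  normalChart e x₀ '' (Metric.ball (0 : RVec m) ρ ×ˢ Ioo (-ρ) ρ)

theorem isOpen_chartCyl (ρ : ℝ) : IsOpen (chartCyl e x₀ ρ) :=
  (normalChart e x₀).isOpenMap _ (Metric.isOpen_ball.prod isOpen_Ioo)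

theorem mem_chartCyl_self {ρ : ℝ} (hρ : 0 < ρ) : x₀ ∈ chartCyl e x₀ ρ :=
  ⟨0, ⟨by simpa using hρ, by simpa using hρ⟩, normalChart_zero e x₀⟩

theorem normalChart_mem_chartCyl {ρ : ℝ} {p : RVec m × ℝ} :
    normalChart e x₀ p ∈ chartCyl e x₀ ρ ↔ p.1 ∈ Metric.ball (0 : RVec m) ρ ∧ p.2 ∈ Ioo (-ρ) ρ := by
  rw [chartCyl, (normalChart e x₀).injective.mem_set_image, mem_prod]

theorem chartCyl_subset_ball (ρ : ℝ) : chartCyl e x₀ ρ ⊆ Metric.ball x₀ (2 * ρ) := by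
  rintro _ ⟨p, ⟨h1, h2⟩, rfl⟩
  exact normalChart_mem_ball e x₀ h1 (Ioo_subset_Icc_self h2)

end Chart

/-- The difference `ν₂ - ν₁` is a positive measure, and integrating `|F|` against it costs at most
`(K - 1) ∫ |F| dν₁`. It converts two-sided comparability of measures into a relative error for
signed integrands. -/
theorem abs_integral_sub_integral_le {α : Type*} [MeasurableSpace α] {ν₁ ν₂ : Measure α}
    [IsFiniteMeasure ν₁] {K : ℝ} (hK : 0 ≤ K) (h₁ : ν₁ ≤ ν₂) (h₂ : ν₂ ≤ ENNReal.ofReal K • ν₁)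
    {F : α → ℝ} (hF : Integrable F ν₂) :
    |(∫ x, F x ∂ν₂) - ∫ x, F x ∂ν₁| ≤ (K - 1) * ∫ x, |F x| ∂ν₁ := by
  have hF₁ : Integrable F ν₁ := hF.mono_measure h₁
  have hle : ν₂ - ν₁ ≤ ν₂ := Measure.sub_le
  have hFd : Integrable F (ν₂ - ν₁) := hF.mono_measure hle
  have hsum : (ν₂ - ν₁) + ν₁ = ν₂ := Measure.sub_add_cancel_of_le h₁
  have e1 : (∫ x, F x ∂ν₂) - ∫ x, F x ∂ν₁ = ∫ x, F x ∂(ν₂ - ν₁) := by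
    conv_lhs => rw [← hsum]
    rw [integral_add_measure hFd hF₁]
    ring
  have e2 : ∫ x, |F x| ∂ν₂ = (∫ x, |F x| ∂(ν₂ - ν₁)) + ∫ x, |F x| ∂ν₁ := by
    conv_lhs => rw [← hsum]
    rw [integral_add_measure hFd.abs hF₁.abs]
  have e3 : ∫ x, |F x| ∂ν₂ ≤ K * ∫ x, |F x| ∂ν₁ := by
    have := integral_mono_measure h₂ (Eventually.of_forall fun x => abs_nonneg (F x))
      (hF₁.abs.smul_measure ENNReal.ofReal_ne_top)
    rwa [integral_smul_measure, ENNReal.toReal_ofReal hK, smul_eq_mul] at this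
  rw [e1]
  refine abs_integral_le_integral_abs.trans ?_
  linarith

/-! ### Hausdorff measure on a nearly flat graph versus measure on its base. -/

namespace IsGraphChart

variable {m : ℕ} {e : Splitting m} {x₀ : RVec (m + 1)} {φ : RVec (m + 1) → ℝ} {a ε ρ : ℝ}
  (h : IsGraphChart e x₀ φ a ε ρ)

include h

theorem graph_image_inter (E : Set (RVec m)) :
    horiz e x₀ ⁻¹' E ∩ h.graph '' Metric.ball 0 ρ = h.graph '' (E ∩ Metric.ball 0 ρ) := by
  ext x
  constructor
  · rintro ⟨hx, y, hy, rfl⟩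
    rw [mem_preimage, h.horiz_graph] at hx
    exact ⟨y, ⟨hx, hy⟩, rfl⟩
  · rintro ⟨y, ⟨hyE, hy⟩, rfl⟩
    exact ⟨by rwa [mem_preimage, h.horiz_graph], y, hy, rfl⟩

/-- An injective continuous image of a Borel set in a Polish space is Borel; injectivity holds
because `horiz` inverts the graph map. -/
theorem measurableSet_graph : MeasurableSet (h.graph '' Metric.ball 0 ρ) :=
  Metric.isOpen_ball.measurableSet.image_of_continuousOn_injOn h.continuousOn_graph
    fun y _ y' _ hyy => by rw [← h.horiz_graph y, ← h.horiz_graph y', hyy]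

/-- The projected surface measure of a graph dominates the measure of the base. -/
theorem le_map_horiz :
    (μH[(m : ℝ)] : Measure (RVec m)).restrict (Metric.ball 0 ρ)
      ≤ ((μH[(m : ℝ)] : Measure (RVec (m + 1))).restrict (h.graph '' Metric.ball 0 ρ)).map
        (horiz e x₀) := by
  refine Measure.le_iff.mpr fun E hE => ?_
  have hm := (continuous_horiz e x₀).measurable
  rw [Measure.restrict_apply hE, Measure.map_apply hm hE, Measure.restrict_apply (hm hE),
    h.graph_image_inter]
  -- The base piece is the image of the graph piece under the `1`-Lipschitz projection, so its
  -- Hausdorff measure cannot be larger.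
  have himg : E ∩ Metric.ball 0 ρ = horiz e x₀ '' (h.graph '' (E ∩ Metric.ball 0 ρ)) := by
    rw [image_image]
    simp [h.horiz_graph]
  conv_lhs => rw [himg]
  have := (lipschitzWith_horiz e x₀).hausdorffMeasure_image_le (d := (m : ℝ)) (by positivity)
    (h.graph '' (E ∩ Metric.ball 0 ρ))
  simpa using this

/-- The graph map is `(1 + 2ε)`-Lipschitz, hence enlarges `m`-dimensional Hausdorff measure by at
most the `m`-th power of that constant. -/
theorem map_horiz_le :
    ((μH[(m : ℝ)] : Measure (RVec (m + 1))).restrict (h.graph '' Metric.ball 0 ρ)).map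
        (horiz e x₀)
      ≤ ENNReal.ofReal ((1 + 2 * ε) ^ m) •
        (μH[(m : ℝ)] : Measure (RVec m)).restrict (Metric.ball 0 ρ) := by
  refine Measure.le_iff.mpr fun E hE => ?_
  have hm := (continuous_horiz e x₀).measurable
  have hε := h.eps_pos
  rw [Measure.smul_apply, Measure.restrict_apply hE, Measure.map_apply hm hE,
    Measure.restrict_apply (hm hE), h.graph_image_inter]
  have := (h.lipschitzOnWith_graph.mono (inter_subset_right (s := E))).hausdorffMeasure_image_le
    (d := (m : ℝ)) (by positivity)
  refine this.trans (le_of_eq ?_)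
  rw [smul_eq_mul, ENNReal.rpow_natCast, ENNReal.ofReal_pow (by linarith)]
  rfl

instance isFiniteMeasure_ball {r : ℝ} : IsFiniteMeasure
    ((μH[(m : ℝ)] : Measure (RVec m)).restrict (Metric.ball 0 r)) := by
  have h1 : Measure.IsAddHaarMeasure (μH[(m : ℝ)] : Measure (RVec m)) := by
    have := isAddHaarMeasure_hausdorffMeasure (E := RVec m)
    rwa [finrank_euclideanSpace_fin] at this
  exact ⟨by simpa using measure_ball_lt_top⟩

/-- Integrals over a graph versus integrals over its base. -/
theorem abs_integral_graph_sub_le {F : RVec (m + 1) → ℝ} (hF : Continuous F)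
    (hc : HasCompactSupport F) :
    |(∫ x in h.graph '' Metric.ball 0 ρ, F x ∂μH[(m : ℝ)])
        - ∫ y in Metric.ball 0 ρ, F (h.graph y) ∂μH[(m : ℝ)]|
      ≤ ((1 + 2 * ε) ^ m - 1) * ∫ y in Metric.ball 0 ρ, |F (h.graph y)| ∂μH[(m : ℝ)] ∧
    ∫ y in Metric.ball 0 ρ, |F (h.graph y)| ∂μH[(m : ℝ)]
      ≤ ∫ x in h.graph '' Metric.ball 0 ρ, |F x| ∂μH[(m : ℝ)] := by
  set ν₁ := (μH[(m : ℝ)] : Measure (RVec m)).restrict (Metric.ball 0 ρ) with hν₁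
  set τ := (μH[(m : ℝ)] : Measure (RVec (m + 1))).restrict (h.graph '' Metric.ball 0 ρ) with hτ
  set ν₂ := τ.map (horiz e x₀) with hν₂
  have hε := h.eps_pos
  have h₁ : ν₁ ≤ ν₂ := h.le_map_horiz
  have h₂ : ν₂ ≤ ENNReal.ofReal ((1 + 2 * ε) ^ m) • ν₁ := h.map_horiz_le
  have hfin : IsFiniteMeasure ν₂ := by
    refine ⟨(h₂ univ).trans_lt ?_⟩
    rw [Measure.smul_apply, smul_eq_mul]
    exact ENNReal.mul_lt_top ENNReal.ofReal_lt_top (measure_lt_top _ _)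
  have hm := (continuous_horiz e x₀).measurable
  -- Pulled back to the base and extended by zero, the integrand becomes one function integrated
  -- against the two comparable measures `ν₁` and `ν₂`.
  set G : RVec m → ℝ := (Metric.ball 0 ρ).indicator fun y => F (h.graph y) with hG
  have hGm : Measurable G := by
    classical
    rw [hG, ← piecewise_eq_indicator]
    exact (hF.comp_continuousOn h.continuousOn_graph).measurable_piecewise continuousOn_const
      Metric.isOpen_ball.measurableSet
  obtain ⟨C, hC⟩ := hc.exists_bound_of_continuous hF
  have hGi : Integrable G ν₂ := by
    refine Integrable.of_bound hGm.aestronglyMeasurable C (Eventually.of_forall fun y => ?_)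
    by_cases hy : y ∈ Metric.ball (0 : RVec m) ρ
    · simpa [hG, hy] using hC _
    · simp only [hG, hy, not_false_eq_true, indicator_of_notMem, norm_zero]
      exact (norm_nonneg _).trans (hC x₀)
  -- Quantifying over `T` handles `F` (identity) and `|F|` (absolute value) at once.
  have e1 : ∀ T : ℝ → ℝ, Continuous T → ∫ y, T (G y) ∂ν₂
      = ∫ x in h.graph '' Metric.ball 0 ρ, T (F x) ∂μH[(m : ℝ)] := by
    intro T hT
    rw [hν₂, integral_map (f := fun y => T (G y)) hm.aemeasurable (hT.measurable.comp hGm).aestronglyMeasurable]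
    refine setIntegral_congr_fun h.measurableSet_graph ?_
    rintro _ ⟨y, hy, rfl⟩
    simp [h.horiz_graph, hG, hy]
  have e2 : ∀ T : ℝ → ℝ, ∫ y, T (G y) ∂ν₁
      = ∫ y in Metric.ball 0 ρ, T (F (h.graph y)) ∂μH[(m : ℝ)] := by
    intro T
    refine setIntegral_congr_fun Metric.isOpen_ball.measurableSet fun y hy => ?_
    simp [hG, hy]
  have key := abs_integral_sub_integral_le (by positivity) h₁ h₂ hGi
  have e1' := e1 id continuous_id
  have e2' := e2 id
  simp only [id] at e1' e2'
  rw [e1', e2', e2 abs] at key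
  refine ⟨key, ?_⟩
  rw [← e1 abs continuous_abs, ← e2 abs]
  exact integral_mono_measure h₁ (Eventually.of_forall fun x => abs_nonneg (G x)) hGi.abs

end IsGraphChart

/-! ### Boundary layers and their concentration on the graph. -/

/-- A smooth decreasing step: `1` left of `-2`, and `0` right of `-1`. -/
noncomputable def stepDown (s : ℝ) : ℝ := Real.smoothTransition (-1 - s)

theorem contDiff_stepDown : ContDiff ℝ 1 stepDown :=
  (Real.smoothTransition.contDiff (n := 1)).comp (contDiff_const.sub contDiff_id)

theorem stepDown_of_le {s : ℝ} (hs : s ≤ -2) : stepDown s = 1 :=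
  Real.smoothTransition.one_of_one_le (by linarith)

theorem stepDown_of_ge {s : ℝ} (hs : -1 ≤ s) : stepDown s = 0 :=
  Real.smoothTransition.zero_of_nonpos (by linarith)

theorem stepDown_mem (s : ℝ) : stepDown s ∈ Icc (0 : ℝ) 1 :=
  ⟨Real.smoothTransition.nonneg _, Real.smoothTransition.le_one _⟩

theorem deriv_stepDown_nonpos (s : ℝ) : deriv stepDown s ≤ 0 :=
  Antitone.deriv_nonpos fun _ _ hst => Real.smoothTransition.monotone (by linarith)

theorem deriv_stepDown_eq_zero {s : ℝ} (hs : s ∉ Icc (-2 : ℝ) (-1)) : deriv stepDown s = 0 := by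
  rcases lt_or_ge s (-2) with h | h
  · have : stepDown =ᶠ[𝓝 s] fun _ => 1 := by
      filter_upwards [gt_mem_nhds h] with t ht using stepDown_of_le (le_of_lt ht)
    rw [this.deriv_eq, deriv_const]
  · have h' : -1 < s := by
      by_contra h'
      exact hs ⟨h, not_lt.mp h'⟩
    have : stepDown =ᶠ[𝓝 s] fun _ => 0 := by
      filter_upwards [lt_mem_nhds h'] with t ht using stepDown_of_ge (le_of_lt ht)
    rw [this.deriv_eq, deriv_const]

/-- The density of the boundary layer of width `δ` of `{φ < 0}` in the direction `v`. -/
noncomputable def layer {E : Type*} [NormedAddCommGroup E] [NormedSpace ℝ E] (φ : E → ℝ) (v : E)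
    (δ : ℝ) (x : E) : ℝ := -(deriv stepDown (φ x / δ) / δ) * fderiv ℝ φ x v

theorem layer_eq_zero {E : Type*} [NormedAddCommGroup E] [NormedSpace ℝ E] {φ : E → ℝ} {v : E}
    {δ : ℝ} (hδ : 0 < δ) {x : E} (hx : φ x ∉ Icc (-(2 * δ)) (-δ)) : layer φ v δ x = 0 := by
  have : φ x / δ ∉ Icc (-2 : ℝ) (-1) := by
    rintro ⟨h1, h2⟩
    rw [le_div_iff₀ hδ] at h1
    rw [div_le_iff₀ hδ] at h2
    exact hx ⟨by linarith, by linarith⟩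
  simp [layer, deriv_stepDown_eq_zero this]

theorem continuous_of_continuousOn_tsupport {X : Type*} [TopologicalSpace X] {F k : X → ℝ}
    {U : Set X} (hU : IsOpen U) (hF : Continuous F) (hk : ContinuousOn k U)
    (hs : tsupport F ⊆ U) : Continuous fun x => F x * k x := by
  refine continuous_of_tsupport fun x hx => ?_
  have hx' : x ∈ U := hs (closure_mono (Function.support_mul_subset_left F k) hx)
  exact hF.continuousAt.mul (hk.continuousAt (hU.mem_nhds hx'))

namespace IsGraphChart

variable {m : ℕ} {e : Splitting m} {x₀ : RVec (m + 1)} {φ : RVec (m + 1) → ℝ} {a ε ρ : ℝ}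
  (h : IsGraphChart e x₀ φ a ε ρ)

include h

theorem half_le_fderiv_normal {x : RVec (m + 1)} (hx : x ∈ Metric.ball x₀ (2 * ρ)) :
    a / 2 ≤ fderiv ℝ φ x e.normal := by
  have h1 := (fderiv ℝ φ x - a • innerSL ℝ e.normal).le_opNorm e.normal
  have h2 := h.close x hx
  have h3 : (fderiv ℝ φ x - a • innerSL ℝ e.normal) e.normal = fderiv ℝ φ x e.normal - a := by
    simp [norm_normal]
  rw [norm_normal, mul_one, h3, Real.norm_eq_abs] at h1
  have h4 := (abs_le.mp (h1.trans h2)).1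
  have := h.a_pos
  have := h.eps_le
  nlinarith

/-- Writing `Dφ = D + a ⟨normal, ·⟩`, the main parts cancel and at most `2 ε a ‖v‖` remains; `a ≤ 2
∂_normal φ` then gives the factor `4`. Bounding by the normal derivative rather than by `a` lets the
error be integrated against the normal layer itself. -/
theorem abs_fderiv_sub_le {x : RVec (m + 1)} (hx : x ∈ Metric.ball x₀ (2 * ρ))
    (v : RVec (m + 1)) :
    |fderiv ℝ φ x v - inner ℝ e.normal v * fderiv ℝ φ x e.normal|
      ≤ 4 * ε * ‖v‖ * fderiv ℝ φ x e.normal := by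
  set D := fderiv ℝ φ x - a • innerSL ℝ e.normal with hD
  have h2 := h.close x hx
  have h3 : ∀ u, fderiv ℝ φ x u = D u + a * inner ℝ e.normal u := by
    intro u
    simp [hD]
  have ha := h.a_pos
  have hε := h.eps_pos
  have b1 : |D v| ≤ ε * a * ‖v‖ := (D.le_opNorm v).trans (by gcongr)
  have b2 : |D e.normal| ≤ ε * a := by
    refine (D.le_opNorm e.normal).trans ?_
    rw [norm_normal, mul_one]
    exact h2
  have b3 : |inner ℝ e.normal v| ≤ ‖v‖ := by
    simpa [norm_normal] using abs_real_inner_le_norm e.normal v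
  have b4 := h.half_le_fderiv_normal hx
  have h5 : fderiv ℝ φ x v - inner ℝ e.normal v * fderiv ℝ φ x e.normal
      = D v - inner ℝ e.normal v * D e.normal := by
    rw [h3 v, h3 e.normal]
    simp [norm_normal]
    ring
  rw [h5]
  have h6 : |inner ℝ e.normal v * D e.normal| ≤ ‖v‖ * (ε * a) := by
    rw [abs_mul]
    gcongr
  have h7 : 4 * ε * ‖v‖ * (a / 2) ≤ 4 * ε * ‖v‖ * fderiv ℝ φ x e.normal := by gcongr
  have h8 := abs_sub (D v) (inner ℝ e.normal v * D e.normal)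
  linarith

theorem layer_nonneg {x : RVec (m + 1)} (hx : x ∈ Metric.ball x₀ (2 * ρ)) {δ : ℝ} (hδ : 0 < δ) :
    0 ≤ layer φ e.normal δ x := by
  have h1 := h.half_le_fderiv_normal hx
  have h2 := deriv_stepDown_nonpos (φ x / δ)
  have ha := h.a_pos
  refine mul_nonneg ?_ (by linarith)
  rw [neg_nonneg]
  exact div_nonpos_of_nonpos_of_nonneg h2 hδ.le

theorem continuousOn_layer (v : RVec (m + 1)) (δ : ℝ) :
    ContinuousOn (layer φ v δ) (Metric.ball x₀ (2 * ρ)) := by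
  have h1 : ContinuousOn (fun x => deriv stepDown (φ x / δ)) (Metric.ball x₀ (2 * ρ)) :=
    (contDiff_stepDown.continuous_deriv le_rfl).comp_continuousOn (h.smooth.continuousOn.div_const δ)
  exact ((h1.div_const δ).neg).mul
    ((h.smooth.continuousOn_fderiv_of_isOpen Metric.isOpen_ball le_rfl).clm_apply
      continuousOn_const)

/-- The normal layer is an exact derivative along vertical lines, so its integral over a line
crossing the whole step is `1`. -/
theorem hasDerivAt_line {y : RVec m} (hy : y ∈ Metric.ball (0 : RVec m) ρ) {s : ℝ}
    (hs : s ∈ Icc (-ρ) ρ) (δ : ℝ) :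
    HasDerivAt (fun s => -stepDown (φ (normalChart e x₀ (y, s)) / δ))
      (layer φ e.normal δ (normalChart e x₀ (y, s))) s := by
  have h1 : HasDerivAt (fun s => normalChart e x₀ (y, s)) e.normal s := by
    have h2 : ∀ t, normalChart e x₀ (y, t) = normalChart e x₀ (y, 0) + t • e.normal := by
      intro t
      have := normalChart_add_smul e x₀ y 0 t
      rwa [zero_add] at this
    have h3 : (fun s => normalChart e x₀ (y, s))
        = fun t => normalChart e x₀ (y, 0) + t • e.normal := funext h2
    rw [h3]
    simpa using ((hasDerivAt_id s).smul_const e.normal).const_add (normalChart e x₀ (y, 0))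
  have hd := (h.differentiableAt (normalChart_mem_ball e x₀ (p := (y, s)) hy hs)).hasFDerivAt
  have h4 := (hd.comp_hasDerivAt s h1).div_const δ
  have h5 := (contDiff_stepDown.differentiable one_ne_zero
    (φ (normalChart e x₀ (y, s)) / δ)).hasDerivAt
  have h6 := (h5.comp s h4).neg
  refine h6.congr_deriv ?_
  simp only [layer]
  ring

/-- On each vertical line the layer is a probability density living where `-2δ ≤ φ ≤ -δ`, hence
within `(2 / a) (2 δ) = 4 δ / a` of the graph point; it averages `F` over values within `η` of the
one on the graph. The condition `4 δ ≤ a ρ` makes the step run fully from `1` to `0` inside the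
segment. -/
theorem abs_integral_line_sub_le {F : RVec (m + 1) → ℝ} (hF : Continuous F) {η r : ℝ}
    (hη : ∀ x x', dist x x' < r → dist (F x) (F x') < η) {δ : ℝ} (hδ : 0 < δ)
    (hδ1 : 4 * δ / a < r) (hδ2 : 4 * δ ≤ a * ρ)
    {y : RVec m} (hy : y ∈ Metric.ball (0 : RVec m) ρ) :
    |(∫ s in (-ρ)..ρ, F (normalChart e x₀ (y, s)) * layer φ e.normal δ (normalChart e x₀ (y, s)))
      - F (h.graph y)| ≤ η := by
  have hρ := h.rho_pos
  have ha := h.a_pos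
  set c : ℝ → RVec (m + 1) := fun s => normalChart e x₀ (y, s) with hc
  have hcc : Continuous c := (normalChart e x₀).continuous.comp (Continuous.prodMk_right y)
  have hmaps : MapsTo c (Icc (-ρ) ρ) (Metric.ball x₀ (2 * ρ)) := fun s hs =>
    normalChart_mem_ball e x₀ (p := (y, s)) hy hs
  set q : ℝ → ℝ := fun s => layer φ e.normal δ (c s) with hq
  have hle : -ρ ≤ ρ := by linarith
  have hqc : ContinuousOn q (uIcc (-ρ) ρ) := by
    rw [uIcc_of_le hle]
    exact (h.continuousOn_layer e.normal δ).comp hcc.continuousOn hmaps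
  have hqi : IntervalIntegrable q volume (-ρ) ρ := hqc.intervalIntegrable
  have hFqi : IntervalIntegrable (fun s => F (c s) * q s) volume (-ρ) ρ :=
    ((hF.comp hcc).continuousOn.mul hqc).intervalIntegrable
  have hint : ∫ s in (-ρ)..ρ, q s = 1 := by
    rw [intervalIntegral.integral_eq_sub_of_hasDerivAt (fun s hs => h.hasDerivAt_line hy
      (by rwa [uIcc_of_le hle] at hs) δ) hqi]
    have h1 := h.line_right hy
    rw [stepDown_of_ge, stepDown_of_le]
    · ring
    · rw [div_le_iff₀ hδ]
      linarith
    · rw [le_div_iff₀ hδ]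
      linarith
  have e1 : (∫ s in (-ρ)..ρ, F (c s) * q s) - F (h.graph y)
      = ∫ s in (-ρ)..ρ, (F (c s) - F (h.graph y)) * q s := by
    have : F (h.graph y) = ∫ s in (-ρ)..ρ, F (h.graph y) * q s := by
      rw [intervalIntegral.integral_const_mul, hint, mul_one]
    conv_lhs => rw [this]
    rw [← intervalIntegral.integral_sub hFqi (hqi.const_mul _)]
    congr 1
    ext s
    ring
  have hη0 : 0 ≤ η := by
    have hr : 0 < r := lt_of_le_of_lt (by positivity) hδ1
    exact (dist_nonneg.trans_lt (hη x₀ x₀ (by simpa using hr))).le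
  rw [e1]
  have hbound : ∀ s ∈ Icc (-ρ) ρ, |(F (c s) - F (h.graph y)) * q s| ≤ η * q s := by
    intro s hs
    have hq0 : 0 ≤ q s := h.layer_nonneg (hmaps hs) hδ
    rw [abs_mul, abs_of_nonneg hq0]
    by_cases hφ : φ (c s) ∈ Icc (-(2 * δ)) (-δ)
    · refine mul_le_mul_of_nonneg_right ?_ hq0
      have h1 := h.abs_sub_height_le hy hs
      have h2 : |φ (c s)| ≤ 2 * δ := abs_le.mpr ⟨hφ.1, by linarith [hφ.2]⟩
      have h3 : dist (c s) (h.graph y) < r := by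
        rw [dist_eq_norm]
        refine (norm_normalChart_sub_le e x₀ _ _).trans_lt ?_
        simp only [sub_self, norm_zero, zero_add]
        refine (h1.trans (mul_le_mul_of_nonneg_left h2 (by positivity))).trans_lt ?_
        refine lt_of_eq_of_lt ?_ hδ1
        ring
      exact (hη _ _ h3).le
    · have : q s = 0 := layer_eq_zero hδ hφ
      simp [this]
  calc |∫ s in (-ρ)..ρ, (F (c s) - F (h.graph y)) * q s|
      ≤ ∫ s in (-ρ)..ρ, |(F (c s) - F (h.graph y)) * q s| :=
        intervalIntegral.abs_integral_le_integral_abs hle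
    _ ≤ ∫ s in (-ρ)..ρ, η * q s := by
        refine intervalIntegral.integral_mono_on hle ?_ (hqi.const_mul _) hbound
        exact ((((hF.comp hcc).continuousOn.sub continuousOn_const).mul hqc).abs).intervalIntegrable
    _ = η := by rw [intervalIntegral.integral_const_mul, hint, mul_one]

/-- The boundary layers converge to the base measure of the graph. -/
theorem tendsto_integral_layer {F : RVec (m + 1) → ℝ} (hF : Continuous F)
    (hcs : HasCompactSupport F) (hs : tsupport F ⊆ chartCyl e x₀ ρ) :
    Tendsto (fun δ => ∫ x, F x * layer φ e.normal δ x) (𝓝[>] 0)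
      (𝓝 (∫ y in Metric.ball 0 ρ, F (h.graph y))) := by
  have hρ := h.rho_pos
  have ha := h.a_pos
  set D := Metric.ball (0 : RVec m) ρ with hD
  set M := (volume : Measure (RVec m)).real D with hM
  have hM0 : 0 ≤ M := measureReal_nonneg
  have huc := hcs.uniformContinuous_of_continuous hF
  rw [Metric.tendsto_nhds]
  intro η' hη'
  set η := η' / (2 * (M + 1)) with hηdef
  have hη : 0 < η := by positivity
  obtain ⟨r, hr, hηr⟩ := Metric.uniformContinuous_iff.mp huc η hη
  -- The two bounds on `δ` yield `4 δ / a < r` and `4 δ ≤ a ρ`.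
  have hev : ∀ᶠ δ in 𝓝[>] (0 : ℝ), δ < min (a * r / 8) (a * ρ / 4) ∧ 0 < δ :=
    ((gt_mem_nhds (by positivity)).filter_mono nhdsWithin_le_nhds).and self_mem_nhdsWithin
  filter_upwards [hev] with δ ⟨hδlt, hδ⟩
  have hδ1 : 4 * δ / a < r := by
    rw [div_lt_iff₀ ha]
    have := hδlt.trans_le (min_le_left _ _)
    nlinarith
  have hδ2 : 4 * δ ≤ a * ρ := by
    have := hδlt.trans_le (min_le_right _ _)
    linarith
  set J : RVec (m + 1) → ℝ := fun x => F x * layer φ e.normal δ x with hJ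
  have hJc : Continuous J := continuous_of_continuousOn_tsupport Metric.isOpen_ball hF
    (h.continuousOn_layer e.normal δ) (hs.trans (chartCyl_subset_ball e x₀ ρ))
  have hJi : Integrable J := hJc.integrable_of_hasCompactSupport hcs.mul_right
  have hmp := measurePreserving_normalChart e x₀
  have hJi' : Integrable (fun p : RVec m × ℝ => J (normalChart e x₀ p)) (volume.prod volume) :=
    hmp.integrable_comp_of_integrable hJi
  have hF0 : ∀ p : RVec m × ℝ, ¬ (p.1 ∈ D ∧ p.2 ∈ Ioo (-ρ) ρ) → F (normalChart e x₀ p) = 0 := by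
    intro p hp
    refine image_eq_zero_of_notMem_tsupport fun h' => hp ?_
    exact (normalChart_mem_chartCyl e x₀).mp (hs h')
  -- Fubini in chart coordinates; the chart preserves volume, and `F` vanishes outside the cylinder.
  have e1 : ∫ x, J x = ∫ y in D, ∫ s in (-ρ)..ρ, J (normalChart e x₀ (y, s)) := by
    rw [← hmp.integral_comp (normalChart e x₀).measurableEmbedding, integral_prod _ hJi']
    rw [← setIntegral_eq_integral_of_forall_compl_eq_zero (s := D)]
    · refine setIntegral_congr_fun Metric.isOpen_ball.measurableSet fun y hy => ?_
      rw [intervalIntegral.integral_of_le (by linarith),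
        setIntegral_eq_integral_of_forall_compl_eq_zero]
      intro s hs'
      have := hF0 (y, s) fun h' => hs' (Ioo_subset_Ioc_self h'.2)
      simp [hJ, this]
    · intro y hy
      have : ∀ s, J (normalChart e x₀ (y, s)) = 0 := by
        intro s
        have := hF0 (y, s) fun h' => hy h'.1
        simp [hJ, this]
      simp [this]
  have hIi : IntegrableOn (fun y => ∫ s in (-ρ)..ρ, J (normalChart e x₀ (y, s))) D := by
    have h1 : IntegrableOn (fun y => ∫ s, J (normalChart e x₀ (y, s))) D :=
      hJi'.integral_prod_left.integrableOn
    refine h1.congr_fun (fun y hy => ?_) Metric.isOpen_ball.measurableSet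
    simp only
    rw [intervalIntegral.integral_of_le (by linarith),
        setIntegral_eq_integral_of_forall_compl_eq_zero]
    intro s hs'
    have := hF0 (y, s) fun h' => hs' (Ioo_subset_Ioc_self h'.2)
    simp [hJ, this]
  obtain ⟨C, hC⟩ := hcs.exists_bound_of_continuous hF
  have hGi : IntegrableOn (fun y => F (h.graph y)) D := by
    have hfin : IsFiniteMeasure ((volume : Measure (RVec m)).restrict D) :=
      ⟨by simpa using measure_ball_lt_top⟩
    exact Integrable.of_bound ((hF.comp_continuousOn h.continuousOn_graph).aestronglyMeasurable
      Metric.isOpen_ball.measurableSet) C (Eventually.of_forall fun y => hC _)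
  rw [Real.dist_eq, e1, ← integral_sub hIi hGi]
  have hb : ‖∫ y in D, ((∫ s in (-ρ)..ρ, J (normalChart e x₀ (y, s))) - F (h.graph y))‖ ≤ η * M :=
    norm_setIntegral_le_of_norm_le_const measure_ball_lt_top fun y hy =>
      h.abs_integral_line_sub_le hF (fun x x' hxx => hηr hxx) hδ hδ1 hδ2 hy
  refine hb.trans_lt ?_
  have : η * (M + 1) = η' / 2 := by
    rw [hηdef]
    field_simp
  nlinarith

end IsGraphChart

namespace IsGraphChart

variable {m : ℕ} {e : Splitting m} {x₀ : RVec (m + 1)} {φ : RVec (m + 1) → ℝ} {a ε ρ : ℝ}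
  (h : IsGraphChart e x₀ φ a ε ρ)

/-- The layer is supported where `φ ≤ -δ < 0`, which inside the chart means in `Ω`. -/
theorem setIntegral_mul_layer {Ω : Set (RVec (m + 1))}
    (hφΩ : ∀ x ∈ Metric.ball x₀ (2 * ρ), x ∈ Ω ↔ φ x < 0) {F : RVec (m + 1) → ℝ}
    (hs : tsupport F ⊆ chartCyl e x₀ ρ)
    (v : RVec (m + 1)) {δ : ℝ} (hδ : 0 < δ) :
    ∫ x in Ω, F x * layer φ v δ x = ∫ x, F x * layer φ v δ x := by
  refine setIntegral_eq_integral_of_forall_compl_eq_zero fun x hx => ?_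
  by_cases hx1 : x ∈ tsupport F
  · have hxb := chartCyl_subset_ball e x₀ ρ (hs hx1)
    rw [hφΩ x hxb, not_lt] at hx
    rw [layer_eq_zero hδ fun h' => by linarith [h'.2], mul_zero]
  · rw [image_eq_zero_of_notMem_tsupport hx1, zero_mul]

include h

section

variable {ψ : RVec (m + 1) → ℝ} (hψ : ContDiff ℝ 1 ψ) (hs : tsupport ψ ⊆ chartCyl e x₀ ρ) (δ : ℝ)

include hψ hs

theorem contDiff_mul_stepDown : ContDiff ℝ 1 (fun x => ψ x * stepDown (φ x / δ)) := by
  rw [contDiff_iff_contDiffAt]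
  intro x
  by_cases hx : x ∈ tsupport ψ
  · have hφ := h.smooth.contDiffAt (Metric.isOpen_ball.mem_nhds
      (chartCyl_subset_ball e x₀ ρ (hs hx)))
    exact hψ.contDiffAt.mul (contDiff_stepDown.contDiffAt.comp x (hφ.div_const δ))
  · have : (fun x => ψ x * stepDown (φ x / δ)) =ᶠ[𝓝 x] fun _ => 0 := by
      filter_upwards [(isClosed_tsupport ψ).isOpen_compl.mem_nhds hx] with y hy
      simp [image_eq_zero_of_notMem_tsupport hy]
    exact contDiffAt_const.congr_of_eventuallyEq this

theorem partialD_mul_stepDown (k : Fin (m + 1)) (x : RVec (m + 1)) :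
    partialD k (fun x => ψ x * stepDown (φ x / δ)) x
      = partialD k ψ x * stepDown (φ x / δ)
        - ψ x * layer φ (EuclideanSpace.single k 1) δ x := by
  by_cases hx : x ∈ tsupport ψ
  · have hφ := h.differentiableAt (chartCyl_subset_ball e x₀ ρ (hs hx))
    have h1 : HasFDerivAt (fun x => stepDown (φ x / δ))
        (deriv stepDown (φ x / δ) • (δ⁻¹ • fderiv ℝ φ x)) x := by
      have h2 : HasFDerivAt (fun x => φ x / δ) (δ⁻¹ • fderiv ℝ φ x) x := by
        simp_rw [div_eq_inv_mul]
        exact hφ.hasFDerivAt.const_mul δ⁻¹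
      have h3 := (contDiff_stepDown.differentiable one_ne_zero (φ x / δ)).hasDerivAt
      have h4 : HasFDerivAt (stepDown ∘ fun x => φ x / δ)
          (deriv stepDown (φ x / δ) • (δ⁻¹ • fderiv ℝ φ x)) x :=
        HasDerivAt.comp_hasFDerivAt (h₂ := stepDown) x h3 h2
      exact h4
    rw [partialD_mul (hψ.differentiable one_ne_zero x) h1.differentiableAt]
    have h3 : partialD k (fun x => stepDown (φ x / δ)) x
        = -layer φ (EuclideanSpace.single k 1) δ x := by
      unfold partialD layer
      rw [h1.fderiv]
      simp only [smul_apply, smul_eq_mul]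
      ring
    rw [h3]
    ring
  · have z1 : ψ x = 0 := image_eq_zero_of_notMem_tsupport hx
    have z2 : partialD k ψ x = 0 := image_eq_zero_of_notMem_tsupport fun h' =>
      hx (tsupport_partialD_subset h')
    have z3 : partialD k (fun x => ψ x * stepDown (φ x / δ)) x = 0 :=
      image_eq_zero_of_notMem_tsupport fun h' => hx (closure_mono
        (Function.support_mul_subset_left ψ _) (tsupport_partialD_subset h'))
    rw [z1, z2, z3]
    simp

end

variable {Ω : Set (RVec (m + 1))} (hΩ : IsOpen Ω)
  (hφΩ : ∀ x ∈ Metric.ball x₀ (2 * ρ), x ∈ Ω ↔ φ x < 0)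

include hφΩ

/-- The step vanishes where `φ > -δ`, so the truncated function stays off the boundary and becomes
admissible in the weak formulation. -/
theorem tsupport_mul_stepDown_subset {ψ : RVec (m + 1) → ℝ}
    (hs : tsupport ψ ⊆ chartCyl e x₀ ρ) {δ : ℝ} (hδ : 0 < δ) :
    tsupport (fun x => ψ x * stepDown (φ x / δ)) ⊆ Ω := by
  intro x hx
  have hx1 : x ∈ tsupport ψ := closure_mono (Function.support_mul_subset_left ψ _) hx
  have hxb := chartCyl_subset_ball e x₀ ρ (hs hx1)
  rw [hφΩ x hxb]
  have hcont : ContinuousAt φ x := (h.differentiableAt hxb).continuousAt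
  by_contra hcon
  have h1 : ∀ᶠ y in 𝓝 x, -δ < φ y := hcont.eventually (lt_mem_nhds (by linarith))
  have h2 : (fun x => ψ x * stepDown (φ x / δ)) =ᶠ[𝓝 x] 0 := by
    filter_upwards [h1] with y hy
    have : stepDown (φ y / δ) = 0 := stepDown_of_ge (by
      rw [le_div_iff₀ hδ]
      linarith)
    simp [this]
  exact (notMem_tsupport_iff_eventuallyEq.mpr h2) hx

include hΩ

/-- Gauss–Green formula in a graph chart, up to a small relative error. -/
theorem abs_setIntegral_sub_le {k : Fin (m + 1)} {f g : RVec (m + 1) → ℝ} (hf : Continuous f)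
    (hg : IntegrableOn g Ω) (hw : IsWeakPD Ω k f g) {ψ : RVec (m + 1) → ℝ} (hψ : ContDiff ℝ 1 ψ)
    (hc : HasCompactSupport ψ) (hs : tsupport ψ ⊆ chartCyl e x₀ ρ) :
    |(∫ x in Ω, (ψ x * g x + partialD k ψ x * f x))
        - e.normal k * ∫ y in Metric.ball 0 ρ, f (h.graph y) * ψ (h.graph y)|
      ≤ 4 * ε * ∫ y in Metric.ball 0 ρ, |f (h.graph y) * ψ (h.graph y)| := by
  set ek : RVec (m + 1) := EuclideanSpace.single k 1 with hek
  set F : RVec (m + 1) → ℝ := fun x => f x * ψ x with hFdef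
  have hF : Continuous F := hf.mul hψ.continuous
  have hFc : HasCompactSupport F := hc.mul_left
  have hFs : tsupport F ⊆ chartCyl e x₀ ρ :=
    (closure_mono (Function.support_mul_subset_right f ψ)).trans hs
  have hFc' : HasCompactSupport (fun x => |F x|) := hFc.comp_left abs_zero
  have hFs' : tsupport (fun x => |F x|) ⊆ chartCyl e x₀ ρ := by
    refine (closure_mono fun x hx => ?_).trans hFs
    simpa using hx
  have hcd := continuous_partialD (k := k) hψ
  have hdc : HasCompactSupport (partialD k ψ) :=
    hc.of_isClosed_subset (isClosed_tsupport _) tsupport_partialD_subset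
  obtain ⟨C, hC⟩ := hc.exists_bound_of_continuous hψ.continuous
  have i1 : IntegrableOn (fun x => ψ x * g x) Ω :=
    hg.bdd_mul hψ.continuous.aestronglyMeasurable (Eventually.of_forall hC)
  have i2 : IntegrableOn (fun x => partialD k ψ x * f x) Ω :=
    ((hcd.mul hf).integrable_of_hasCompactSupport hdc.mul_right).integrableOn
  have i3 : ∀ v δ, Integrable (fun x => F x * layer φ v δ x) := fun v δ =>
    (continuous_of_continuousOn_tsupport Metric.isOpen_ball hF (h.continuousOn_layer v δ)
      (hFs.trans (chartCyl_subset_ball e x₀ ρ))).integrable_of_hasCompactSupport hFc.mul_right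
  have i4 : ∀ v δ, Integrable (fun x => |F x| * layer φ v δ x) := fun v δ =>
    (continuous_of_continuousOn_tsupport Metric.isOpen_ball hF.abs (h.continuousOn_layer v δ)
      (hFs'.trans (chartCyl_subset_ball e x₀ ρ))).integrable_of_hasCompactSupport hFc'.mul_right
  -- the weak formulation with a test function cut off near the boundary
  have weak : ∀ δ : ℝ, 0 < δ → ∫ x, F x * layer φ ek δ x
      = ∫ x in Ω, (ψ x * stepDown (φ x / δ) * g x + partialD k ψ x * stepDown (φ x / δ) * f x) := by
    intro δ hδ
    have hsm := h.contDiff_mul_stepDown hψ hs δ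
    have h0 := hw.integral_of_contDiff_one hΩ hf hg hsm hc.mul_right
      (h.tsupport_mul_stepDown_subset hφΩ hs hδ)
    simp_rw [h.partialD_mul_stepDown hψ hs δ k] at h0
    have hdcont : Continuous fun x => partialD k ψ x * stepDown (φ x / δ) :=
      continuous_of_continuousOn_tsupport (isOpen_chartCyl e x₀ ρ) hcd
        ((contDiff_stepDown.continuous.comp_continuousOn
          (h.smooth.continuousOn.div_const δ)).mono (chartCyl_subset_ball e x₀ ρ))
        (tsupport_partialD_subset.trans hs)
    have j1 : IntegrableOn (fun x => partialD k ψ x * stepDown (φ x / δ) * f x) Ω :=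
      ((hdcont.mul hf).integrable_of_hasCompactSupport hdc.mul_right.mul_right).integrableOn
    have j2 : IntegrableOn (fun x => ψ x * stepDown (φ x / δ) * g x) Ω := by
      obtain ⟨C', hC'⟩ := (hc.mul_right (f' := fun x => stepDown (φ x / δ))).exists_bound_of_continuous
        hsm.continuous
      exact hg.bdd_mul hsm.continuous.aestronglyMeasurable (Eventually.of_forall hC')
    have j3 : IntegrableOn (fun x => F x * layer φ ek δ x) Ω := (i3 ek δ).integrableOn
    rw [← setIntegral_mul_layer hφΩ hFs ek hδ, integral_add j2 j1]
    have h1 : ∫ x in Ω, (partialD k ψ x * stepDown (φ x / δ) - ψ x * layer φ ek δ x) * f x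
        = (∫ x in Ω, partialD k ψ x * stepDown (φ x / δ) * f x)
          - ∫ x in Ω, F x * layer φ ek δ x := by
      rw [← integral_sub j1 j3]
      congr 1
      ext x
      simp only [hFdef]
      ring
    rw [h1] at h0
    linarith
  -- At each interior point the step equals `1` for small `δ`, so dominated convergence removes the
  -- truncation from the bulk integral.
  have lim1 : Tendsto (fun δ => ∫ x, F x * layer φ ek δ x) (𝓝[>] 0)
      (𝓝 (∫ x in Ω, (ψ x * g x + partialD k ψ x * f x))) := by
    have hev : (fun δ => ∫ x in Ω, (ψ x * stepDown (φ x / δ) * g x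
        + partialD k ψ x * stepDown (φ x / δ) * f x)) =ᶠ[𝓝[>] 0]
        fun δ => ∫ x, F x * layer φ ek δ x := by
      filter_upwards [self_mem_nhdsWithin] with δ hδ using (weak δ hδ).symm
    refine Tendsto.congr' hev ?_
    refine tendsto_integral_filter_of_dominated_convergence
      (fun x => |ψ x * g x| + |partialD k ψ x * f x|) ?_ ?_ (i1.abs.add i2.abs) ?_
    · filter_upwards [self_mem_nhdsWithin] with δ hδ
      have hdcont : Continuous fun x => partialD k ψ x * stepDown (φ x / δ) :=
        continuous_of_continuousOn_tsupport (isOpen_chartCyl e x₀ ρ) hcd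
          ((contDiff_stepDown.continuous.comp_continuousOn
            (h.smooth.continuousOn.div_const δ)).mono (chartCyl_subset_ball e x₀ ρ))
          (tsupport_partialD_subset.trans hs)
      exact ((h.contDiff_mul_stepDown hψ hs δ).continuous.aestronglyMeasurable.mul
        hg.aestronglyMeasurable).add (hdcont.mul hf).aestronglyMeasurable
    · refine Eventually.of_forall fun δ => Eventually.of_forall fun x => ?_
      have hst := stepDown_mem (φ x / δ)
      rw [Real.norm_eq_abs]
      refine (abs_add_le _ _).trans (add_le_add ?_ ?_)
      · rw [mul_right_comm, abs_mul, abs_of_nonneg hst.1]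
        exact mul_le_of_le_one_right (abs_nonneg _) hst.2
      · rw [mul_right_comm, abs_mul, abs_of_nonneg hst.1]
        exact mul_le_of_le_one_right (abs_nonneg _) hst.2
    · refine (ae_restrict_iff' hΩ.measurableSet).mpr (Eventually.of_forall fun x hx => ?_)
      by_cases hx1 : x ∈ tsupport ψ
      · have hneg := (hφΩ x (chartCyl_subset_ball e x₀ ρ (hs hx1))).mp hx
        have hev : ∀ᶠ δ in 𝓝[>] (0 : ℝ), stepDown (φ x / δ) = 1 := by
          filter_upwards [(gt_mem_nhds (show (0 : ℝ) < -φ x / 2 by linarith)).filter_mono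
            nhdsWithin_le_nhds, self_mem_nhdsWithin] with δ hδ1 hδ
          refine stepDown_of_le ?_
          rw [div_le_iff₀ hδ]
          linarith
        refine tendsto_const_nhds.congr' ?_
        filter_upwards [hev] with δ hδ
        rw [hδ]
        ring
      · have z1 : ψ x = 0 := image_eq_zero_of_notMem_tsupport hx1
        have z2 : partialD k ψ x = 0 := image_eq_zero_of_notMem_tsupport fun h' =>
          hx1 (tsupport_partialD_subset h')
        simp [z1, z2]
  have lim2 := h.tendsto_integral_layer hF hFc hFs
  have lim3 := h.tendsto_integral_layer hF.abs hFc' hFs'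
  -- The limit of the layer in direction `ek` is the bulk term, that of the normal layer is the base
  -- integral. For fixed `δ` the two layers are compared pointwise, with relative error `4 ε`.
  refine le_of_tendsto_of_tendsto ((lim1.sub (lim2.const_mul (e.normal k))).abs)
    (lim3.const_mul (4 * ε)) ?_
  filter_upwards [self_mem_nhdsWithin] with δ hδ
  rw [← integral_const_mul, ← integral_sub (i3 ek δ) ((i3 e.normal δ).const_mul _),
    ← integral_const_mul]
  refine abs_integral_le_integral_abs.trans (integral_mono
    ((i3 ek δ).sub ((i3 e.normal δ).const_mul _)).abs ((i4 e.normal δ).const_mul _) fun x => ?_)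
  simp only
  by_cases hx1 : x ∈ tsupport F
  · have hxb := chartCyl_subset_ball e x₀ ρ (hFs hx1)
    have h1 := h.abs_fderiv_sub_le hxb ek
    have h2 : inner ℝ e.normal ek = e.normal k := by
      simp [hek, EuclideanSpace.inner_single_right]
    have h3 : ‖ek‖ = 1 := by simp [hek]
    rw [h2, h3, mul_one] at h1
    have h4 : 0 ≤ -(deriv stepDown (φ x / δ) / δ) :=
      neg_nonneg.mpr (div_nonpos_of_nonpos_of_nonneg (deriv_stepDown_nonpos _) (le_of_lt hδ))
    have h5 : F x * layer φ ek δ x - e.normal k * (F x * layer φ e.normal δ x)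
        = F x * -(deriv stepDown (φ x / δ) / δ)
          * (fderiv ℝ φ x ek - e.normal k * fderiv ℝ φ x e.normal) := by
      simp only [layer]
      ring
    rw [h5, abs_mul, abs_mul, abs_of_nonneg h4]
    calc |F x| * -(deriv stepDown (φ x / δ) / δ)
          * |fderiv ℝ φ x ek - e.normal k * fderiv ℝ φ x e.normal|
        ≤ |F x| * -(deriv stepDown (φ x / δ) / δ) * (4 * ε * fderiv ℝ φ x e.normal) := by
          gcongr
      _ = 4 * ε * (|F x| * layer φ e.normal δ x) := by
          simp only [layer]
          ring
  · simp [image_eq_zero_of_notMem_tsupport hx1]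

end IsGraphChart

/-! ### The outward normal -/

section Normal

/-- A frontier point of an open set is outside it, which gives `φ ≥ 0`; `φ > 0` would persist nearby
and exclude points of `Ω`. -/
theorem map_eq_zero_of_mem_frontier {d : ℕ} {Ω U : Set (RVec d)} (hΩ : IsOpen Ω) (hU : IsOpen U)
    {φ : RVec d → ℝ} (hφ : ContinuousOn φ U) (hφΩ : ∀ y ∈ U, y ∈ Ω ↔ φ y < 0) {x : RVec d}
    (hx : x ∈ frontier Ω) (hxU : x ∈ U) : φ x = 0 := by
  rw [hΩ.frontier_eq] at hx
  have h1 : 0 ≤ φ x := by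
    by_contra hcon
    exact hx.2 ((hφΩ x hxU).mpr (not_le.mp hcon))
  refine le_antisymm ?_ h1
  by_contra hcon
  have hca : ContinuousAt φ x := hφ.continuousAt (hU.mem_nhds hxU)
  have h2 : ∀ᶠ y in 𝓝 x, 0 < φ y := hca.eventually (lt_mem_nhds (not_le.mp hcon))
  obtain ⟨y, hyΩ, hy, hyU⟩ := ((mem_closure_iff_frequently.mp hx.1).and_eventually
    (h2.and (hU.mem_nhds hxU))).exists
  exact absurd ((hφΩ y hyU).mp hyΩ) (not_lt.mpr hy.le)

theorem iff_of_inter_eq {d : ℕ} {Ω U : Set (RVec d)} {φ : RVec d → ℝ}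
    (h : Ω ∩ U = {y ∈ U | φ y < 0}) : ∀ y ∈ U, y ∈ Ω ↔ φ y < 0 := by
  intro y hy
  constructor
  · intro hyΩ
    have : y ∈ Ω ∩ U := ⟨hyΩ, hy⟩
    rw [h] at this
    exact this.2
  · intro hyφ
    have : y ∈ {y ∈ U | φ y < 0} := ⟨hy, hyφ⟩
    rw [← h] at this
    exact this.1

theorem eventually_lt_of_gradient {d : ℕ} {φ : RVec d → ℝ} {x v : RVec d}
    (hφ : DifferentiableAt ℝ φ x) (h0 : φ x = 0) (hv : inner ℝ (gradient φ x) v < 0) :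
    ∀ᶠ t in 𝓝[>] (0 : ℝ), φ (x + t • v) < 0 := by
  have h1 : HasDerivAt (fun t : ℝ => x + t • v) v 0 := by
    simpa using ((hasDerivAt_id (0 : ℝ)).smul_const v).const_add x
  have hφ' : HasFDerivAt φ (fderiv ℝ φ x) (x + (0 : ℝ) • v) := by simpa using hφ.hasFDerivAt
  have h2 := hφ'.comp_hasDerivAt (0 : ℝ) h1
  have h3 : fderiv ℝ φ x v = inner ℝ (gradient φ x) v := by
    simp [gradient]
  have h4 := h2.tendsto_slope_zero_right
  rw [h3] at h4
  filter_upwards [h4.eventually (gt_mem_nhds hv), self_mem_nhdsWithin] with t ht ht0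
  simp only [Function.comp, zero_add, zero_smul, add_zero, h0, sub_zero, smul_eq_mul] at ht
  have ht0' : (0 : ℝ) < t := ht0
  by_contra hcon
  have := mul_nonneg (inv_pos.mpr ht0').le (not_lt.mp hcon)
  linarith

theorem IsOutwardNormal.norm_eq {d : ℕ} {Ω : Set (RVec d)} {x ν : RVec d}
    (h : IsOutwardNormal Ω x ν) : ‖ν‖ = 1 := by
  obtain ⟨-, U, φ, -, -, -, h0, -, rfl⟩ := h
  rw [norm_smul, norm_inv, norm_norm, inv_mul_cancel₀ (norm_ne_zero_iff.mpr h0)]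

/-- If two unit normals differ, a short step in direction `ν' - ν` enters `Ω` according to one
defining function and leaves it according to the other. This makes the chosen `outNormal` computable
in any chart. -/
theorem IsOutwardNormal.unique {d : ℕ} {Ω : Set (RVec d)} (hΩ : IsOpen Ω) {x ν ν' : RVec d}
    (h : IsOutwardNormal Ω x ν) (h' : IsOutwardNormal Ω x ν') : ν = ν' := by
  have hn := h.norm_eq
  have hn' := h'.norm_eq
  obtain ⟨hx, U, φ, hU, hxU, hφ, hg, hφΩ, hν⟩ := h
  obtain ⟨-, U', φ', hU', hxU', hφ', hg', hφΩ', hν'⟩ := h'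
  by_contra hne
  have hlt : inner ℝ ν ν' < 1 := inner_lt_one_iff_real_of_norm_eq_one hn hn' |>.mpr hne
  have key : ∀ {p q : RVec d}, p ≠ 0 → q = ‖p‖⁻¹ • p → ∀ v, inner ℝ p v = ‖p‖ * inner ℝ q v := by
    intro p q hp hq v
    rw [hq, real_inner_smul_left, mul_inv_cancel_left₀ (norm_ne_zero_iff.mpr hp)]
  have d1 : DifferentiableAt ℝ φ x :=
    (hφ.contDiffAt (hU.mem_nhds hxU)).differentiableAt one_ne_zero
  have d2 : DifferentiableAt ℝ φ' x :=
    (hφ'.contDiffAt (hU'.mem_nhds hxU')).differentiableAt one_ne_zero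
  have z1 := map_eq_zero_of_mem_frontier hΩ hU hφ.continuousOn (iff_of_inter_eq hφΩ) hx hxU
  have z2 := map_eq_zero_of_mem_frontier hΩ hU' hφ'.continuousOn (iff_of_inter_eq hφΩ') hx hxU'
  have e1 := eventually_lt_of_gradient (v := ν' - ν) d1 z1 (by
    rw [key hg hν, inner_sub_right, real_inner_self_eq_norm_sq, hn]
    have := norm_pos_iff.mpr hg
    nlinarith)
  have e2 := eventually_lt_of_gradient (φ := fun y => -φ' y) (v := ν' - ν) d2.neg (by simp [z2]) (by
    have : gradient (fun y => -φ' y) x = -gradient φ' x := by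
      simp [gradient, fderiv_fun_neg]
    rw [this, inner_neg_left, key hg' hν', inner_sub_right, real_inner_self_eq_norm_sq, hn',
      real_inner_comm]
    have := norm_pos_iff.mpr hg'
    nlinarith)
  have hcont : Tendsto (fun t : ℝ => x + t • (ν' - ν)) (𝓝[>] 0) (𝓝 x) := by
    have : Continuous fun t : ℝ => x + t • (ν' - ν) := by fun_prop
    simpa using (this.tendsto 0).mono_left nhdsWithin_le_nhds
  obtain ⟨t, h1, h2, h3, h4⟩ := (e1.and (e2.and ((hcont.eventually (hU.mem_nhds hxU)).and
    (hcont.eventually (hU'.mem_nhds hxU'))))).exists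
  have h5 := (iff_of_inter_eq hφΩ _ h3).mpr h1
  have h6 := (iff_of_inter_eq hφΩ' _ h4).mp h5
  linarith

theorem isOutwardNormal_outNormal {d : ℕ} {Ω : Set (RVec d)} {x : RVec d}
    (hx : x ∈ regBoundary Ω) : IsOutwardNormal Ω x (outNormal Ω x) := by
  have hx' : ∃ ν, IsOutwardNormal Ω x ν := hx
  rw [outNormal, dif_pos hx']
  exact hx'.choose_spec

theorem IsOutwardNormal.outNormal_eq {d : ℕ} {Ω : Set (RVec d)} (hΩ : IsOpen Ω) {x ν : RVec d}
    (h : IsOutwardNormal Ω x ν) : outNormal Ω x = ν :=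
  (isOutwardNormal_outNormal ⟨ν, h⟩).unique hΩ h

theorem regBoundary_subset_frontier {d : ℕ} (Ω : Set (RVec d)) : regBoundary Ω ⊆ frontier Ω := by
  rintro x ⟨ν, hν⟩
  exact hν.1

variable {m : ℕ}

/-- Align the splitting with `ν`, take `a = ‖∇φ(x)‖`, and shrink the ball until continuity of the
derivative gives the prescribed relative closeness. -/
theorem IsOutwardNormal.exists_graphChart {Ω : Set (RVec (m + 1))} (hΩ : IsOpen Ω)
    {x ν : RVec (m + 1)} (h : IsOutwardNormal Ω x ν) {ε : ℝ} (hε : 0 < ε) (hε' : ε ≤ 1 / 4) :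
    ∃ (e : Splitting m) (φ : RVec (m + 1) → ℝ) (a ρ : ℝ), IsGraphChart e x φ a ε ρ ∧
      e.normal = ν ∧ ∀ y ∈ Metric.ball x (2 * ρ), y ∈ Ω ↔ φ y < 0 := by
  obtain ⟨e, he⟩ := exists_splitting h.norm_eq
  obtain ⟨hx, U, φ, hU, hxU, hφ, hg, hφΩ, hν⟩ := h
  set a := ‖gradient φ x‖ with ha
  have ha0 : 0 < a := norm_pos_iff.mpr hg
  have hfd : fderiv ℝ φ x = a • innerSL ℝ e.normal := by
    ext v
    have h3 : fderiv ℝ φ x v = inner ℝ (gradient φ x) v := by simp [gradient]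
    rw [h3, he, hν]
    simp only [smul_apply, innerSL_apply_apply, smul_eq_mul, real_inner_smul_left]
    rw [mul_inv_cancel_left₀ ha0.ne']
  have hcont : ContinuousAt (fderiv ℝ φ) x :=
    (hφ.continuousOn_fderiv_of_isOpen hU le_rfl).continuousAt (hU.mem_nhds hxU)
  have hev : ∀ᶠ y in 𝓝 x, dist (fderiv ℝ φ y) (fderiv ℝ φ x) < ε * a :=
    Metric.tendsto_nhds.mp hcont (ε * a) (by positivity)
  obtain ⟨r, hr, hball⟩ := Metric.eventually_nhds_iff_ball.mp (hev.and (hU.mem_nhds hxU))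
  have hr2 : 2 * (r / 2) = r := by ring
  refine ⟨e, φ, a, r / 2, ⟨ha0, hε, hε', by positivity, ?_, ?_, ?_⟩, he, ?_⟩
  · rw [hr2]
    exact hφ.mono fun y hy => (hball y hy).2
  · exact map_eq_zero_of_mem_frontier hΩ hU hφ.continuousOn (iff_of_inter_eq hφΩ) hx hxU
  · intro y hy
    rw [hr2] at hy
    rw [← hfd, ← dist_eq_norm]
    exact (hball y hy).1.le
  · intro y hy
    rw [hr2] at hy
    exact iff_of_inter_eq hφΩ y (hball y hy).2

namespace IsGraphChart

variable {e : Splitting m} {x₀ : RVec (m + 1)} {φ : RVec (m + 1) → ℝ} {a ε ρ : ℝ}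
  (h : IsGraphChart e x₀ φ a ε ρ) {Ω : Set (RVec (m + 1))} (hΩ : IsOpen Ω)
  (hφΩ : ∀ x ∈ Metric.ball x₀ (2 * ρ), x ∈ Ω ↔ φ x < 0)

include h

theorem norm_gradient_sub_le {y : RVec (m + 1)} (hy : y ∈ Metric.ball x₀ (2 * ρ)) :
    ‖gradient φ y - a • e.normal‖ ≤ ε * a := by
  have h1 := h.close y hy
  have h2 : fderiv ℝ φ y - a • innerSL ℝ e.normal
      = innerSL ℝ (gradient φ y - a • e.normal) := by
    ext v
    have h3 : fderiv ℝ φ y v = inner ℝ (gradient φ y) v := by simp [gradient]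
    rw [sub_apply, h3, smul_apply, innerSL_apply_apply, innerSL_apply_apply, inner_sub_left,
      real_inner_smul_left, smul_eq_mul]
  rwa [h2, innerSL_apply_norm] at h1

theorem gradient_ne_zero {y : RVec (m + 1)} (hy : y ∈ Metric.ball x₀ (2 * ρ)) :
    gradient φ y ≠ 0 := by
  intro h0
  have h1 := h.norm_gradient_sub_le hy
  have ha := h.a_pos
  have hε := h.eps_le
  rw [h0, zero_sub, norm_neg, norm_smul, norm_normal, Real.norm_eq_abs, abs_of_pos ha] at h1
  nlinarith

/-- Decompose into the error of the gradient divided by `a` and the error from replacing `1 / a` by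
`1 / ‖∇φ‖`; each contributes at most `ε`. -/
theorem norm_normalized_gradient_sub_le {y : RVec (m + 1)} (hy : y ∈ Metric.ball x₀ (2 * ρ)) :
    ‖‖gradient φ y‖⁻¹ • gradient φ y - e.normal‖ ≤ 2 * ε := by
  set u := gradient φ y with hu
  have h0 : u ≠ 0 := h.gradient_ne_zero hy
  have h1 : ‖u - a • e.normal‖ ≤ ε * a := h.norm_gradient_sub_le hy
  have ha := h.a_pos
  have hun : 0 < ‖u‖ := norm_pos_iff.mpr h0
  have h2 : |‖u‖ - a| ≤ ε * a := by
    have := abs_norm_sub_norm_le u (a • e.normal)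
    rw [norm_smul, norm_normal, Real.norm_eq_abs, abs_of_pos ha, mul_one] at this
    exact this.trans h1
  have h3 : ‖u‖⁻¹ • u - e.normal = a⁻¹ • (u - a • e.normal) + (‖u‖⁻¹ - a⁻¹) • u := by
    rw [smul_sub, smul_smul, inv_mul_cancel₀ ha.ne', one_smul, sub_smul]
    abel
  have h4 : ‖a⁻¹ • (u - a • e.normal)‖ ≤ ε := by
    rw [norm_smul, norm_inv, Real.norm_eq_abs, abs_of_pos ha, inv_mul_le_iff₀ ha]
    linarith
  have h5 : ‖(‖u‖⁻¹ - a⁻¹) • u‖ ≤ ε := by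
    rw [norm_smul, Real.norm_eq_abs]
    have h6 : (‖u‖⁻¹ - a⁻¹) * ‖u‖ = a⁻¹ * (a - ‖u‖) := by
      field_simp
    rw [← abs_of_pos hun, ← abs_mul, abs_of_pos hun, h6, abs_mul, abs_of_pos (inv_pos.mpr ha),
      inv_mul_le_iff₀ ha, abs_sub_comm]
    linarith
  rw [h3]
  exact (norm_add_le _ _).trans (by linarith)

theorem continuousOn_normalized_gradient :
    ContinuousOn (fun y => ‖gradient φ y‖⁻¹ • gradient φ y) (Metric.ball x₀ (2 * ρ)) := by
  have h1 : ContinuousOn (gradient φ) (Metric.ball x₀ (2 * ρ)) :=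
    (InnerProductSpace.toDual ℝ (RVec (m + 1))).symm.continuous.comp_continuousOn
      (h.smooth.continuousOn_fderiv_of_isOpen Metric.isOpen_ball le_rfl)
  exact (h1.norm.inv₀ fun y hy => norm_ne_zero_iff.mpr (h.gradient_ne_zero hy)).smul h1

include hφΩ

theorem isOutwardNormal {y : RVec (m + 1)} (hy : y ∈ frontier Ω)
    (hyb : y ∈ Metric.ball x₀ (2 * ρ)) :
    IsOutwardNormal Ω y (‖gradient φ y‖⁻¹ • gradient φ y) := by
  refine ⟨hy, Metric.ball x₀ (2 * ρ), φ, Metric.isOpen_ball, hyb, h.smooth,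
    h.gradient_ne_zero hyb, ?_, rfl⟩
  ext z
  constructor
  · rintro ⟨h1, h2⟩
    exact ⟨h2, (hφΩ z h2).mp h1⟩
  · rintro ⟨h1, h2⟩
    exact ⟨(hφΩ z h1).mpr h2, h1⟩

include hΩ

/-- Frontier points are zeros of `φ`, and each vertical line has only one. Conversely, points just
below the graph have `φ < 0`, so a graph point is a limit of points of `Ω` without being in `Ω`. -/
theorem frontier_inter_chartCyl :
    frontier Ω ∩ chartCyl e x₀ ρ = h.graph '' Metric.ball 0 ρ := by
  ext x
  constructor
  · rintro ⟨hx, hxc⟩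
    have hxb := chartCyl_subset_ball e x₀ ρ hxc
    have h0 := map_eq_zero_of_mem_frontier hΩ Metric.isOpen_ball h.smooth.continuousOn hφΩ hx hxb
    obtain ⟨⟨y, s⟩, ⟨hy, hs⟩, rfl⟩ := hxc
    refine ⟨y, hy, ?_⟩
    rw [graph, ← h.eq_height hy (Ioo_subset_Icc_self hs) h0]
  · rintro ⟨y, hy, rfl⟩
    have hγ := h.height_mem hy
    have hmem : h.graph y ∈ chartCyl e x₀ ρ := (normalChart_mem_chartCyl e x₀).mpr ⟨hy, hγ⟩
    refine ⟨?_, hmem⟩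
    rw [hΩ.frontier_eq]
    constructor
    · have hlim : Tendsto (fun s => normalChart e x₀ (y, s)) (𝓝[<] (h.height y))
          (𝓝 (h.graph y)) :=
        (((normalChart e x₀).continuous.comp (Continuous.prodMk_right y)).tendsto _).mono_left
          nhdsWithin_le_nhds
      refine mem_closure_of_tendsto hlim ?_
      filter_upwards [self_mem_nhdsWithin, (Ioo_mem_nhds hγ.1 hγ.2 |> mem_nhdsWithin_of_mem_nhds :
        Ioo (-ρ) ρ ∈ 𝓝[<] (h.height y))] with s hs hs'
      rw [hφΩ _ (normalChart_mem_ball e x₀ (p := (y, s)) hy (Ioo_subset_Icc_self hs'))]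
      have h1 := h.half_mul_le_line_sub hy (Ioo_subset_Icc_self hs') (Ioo_subset_Icc_self hγ)
        (le_of_lt hs)
      have h2 := h.map_graph hy
      rw [graph] at h2
      rw [h2] at h1
      have hs'' : s < h.height y := hs
      have ha := h.a_pos
      nlinarith
    · rw [hφΩ _ (h.graph_mem_ball hy), h.map_graph hy]
      exact lt_irrefl 0

end IsGraphChart

/-- One defining function serves all frontier points nearby, so regularity is an open condition
along the boundary. Measurability of the regular part and closedness of the singular part follow. -/
theorem exists_isOpen_regBoundary_eq {Ω : Set (RVec (m + 1))} (hΩ : IsOpen Ω) :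
    ∃ W, IsOpen W ∧ regBoundary Ω = frontier Ω ∩ W := by
  have key : ∀ x : regBoundary Ω, ∃ V, IsOpen V ∧ x.1 ∈ V ∧ frontier Ω ∩ V ⊆ regBoundary Ω := by
    rintro ⟨x, ν, hν⟩
    obtain ⟨e, φ, a, ρ, h, -, hφΩ⟩ := hν.exists_graphChart hΩ (ε := 1 / 4) (by norm_num) le_rfl
    exact ⟨Metric.ball x (2 * ρ), Metric.isOpen_ball,
      Metric.mem_ball_self (by have := h.rho_pos; linarith),
      fun y hy => ⟨_, h.isOutwardNormal hφΩ hy.1 hy.2⟩⟩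
  choose V hV hxV hVs using key
  refine ⟨⋃ x, V x, isOpen_iUnion hV, Subset.antisymm (fun x hx => ?_) ?_⟩
  · exact ⟨regBoundary_subset_frontier Ω hx, mem_iUnion.mpr ⟨⟨x, hx⟩, hxV _⟩⟩
  · rintro x ⟨hx, hx'⟩
    obtain ⟨y, hy⟩ := mem_iUnion.mp hx'
    exact hVs y ⟨hx, hy⟩

theorem measurableSet_regBoundary {Ω : Set (RVec (m + 1))} (hΩ : IsOpen Ω) :
    MeasurableSet (regBoundary Ω) := by
  obtain ⟨W, hW, h⟩ := exists_isOpen_regBoundary_eq hΩ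
  rw [h]
  exact isClosed_frontier.measurableSet.inter hW.measurableSet

/-- By uniqueness of the normal, near a regular point the field is the normalised gradient of a
single defining function. -/
theorem continuousOn_outNormal {Ω : Set (RVec (m + 1))} (hΩ : IsOpen Ω) :
    ContinuousOn (outNormal Ω) (regBoundary Ω) := by
  rintro x ⟨ν, hν⟩
  obtain ⟨e, φ, a, ρ, h, -, hφΩ⟩ := hν.exists_graphChart hΩ (ε := 1 / 4) (by norm_num) le_rfl
  have hxb : x ∈ Metric.ball x (2 * ρ) :=
    Metric.mem_ball_self (by have := h.rho_pos; linarith)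
  have heq : ∀ y ∈ regBoundary Ω ∩ Metric.ball x (2 * ρ),
      outNormal Ω y = ‖gradient φ y‖⁻¹ • gradient φ y := fun y hy =>
    (h.isOutwardNormal hφΩ (regBoundary_subset_frontier Ω hy.1) hy.2).outNormal_eq hΩ
  have hc := (h.continuousOn_normalized_gradient.continuousAt
    (Metric.isOpen_ball.mem_nhds hxb)).continuousWithinAt (s := regBoundary Ω)
  refine hc.congr_of_eventuallyEq ?_ (heq x ⟨⟨ν, hν⟩, hxb⟩)
  filter_upwards [self_mem_nhdsWithin, mem_nhdsWithin_of_mem_nhds (Metric.isOpen_ball.mem_nhds hxb)]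
    with y hy1 hy2 using heq y ⟨hy1, hy2⟩

theorem outNormal_of_notMem {d : ℕ} {Ω : Set (RVec d)} {x : RVec d} (hx : x ∉ regBoundary Ω) :
    outNormal Ω x = 0 := by
  have hx' : ¬ ∃ ν, IsOutwardNormal Ω x ν := hx
  rw [outNormal, dif_neg hx']

theorem norm_outNormal_le {d : ℕ} (Ω : Set (RVec d)) (x : RVec d) : ‖outNormal Ω x‖ ≤ 1 := by
  by_cases hx : x ∈ regBoundary Ω
  · exact (isOutwardNormal_outNormal hx).norm_eq.le
  · rw [outNormal_of_notMem hx, norm_zero]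
    exact zero_le_one

theorem measurable_outNormal {Ω : Set (RVec (m + 1))} (hΩ : IsOpen Ω) :
    Measurable (outNormal Ω) := by
  classical
  have : outNormal Ω = (regBoundary Ω).piecewise (outNormal Ω) fun _ => 0 := by
    ext1 x
    by_cases hx : x ∈ regBoundary Ω
    · simp [hx]
    · rw [piecewise_eq_of_notMem _ _ _ hx, outNormal_of_notMem hx]
  rw [this]
  exact (continuousOn_outNormal hΩ).measurable_piecewise continuousOn_const
    (measurableSet_regBoundary hΩ)

end Normal

/-! ### The Gauss–Green formula -/

section GaussGreen

variable {m : ℕ}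

theorem surfMeasure_succ (Ω : Set (RVec (m + 1))) :
    surfMeasure Ω = (μH[(m : ℝ)] : Measure (RVec (m + 1))).restrict (frontier Ω) := by
  unfold surfMeasure
  push_cast
  rw [add_sub_cancel_right]

instance isAddHaarMeasure_hausdorff :
    Measure.IsAddHaarMeasure (μH[(m : ℝ)] : Measure (RVec m)) := by
  have := isAddHaarMeasure_hausdorffMeasure (E := RVec m)
  rwa [finrank_euclideanSpace_fin] at this

/-- The ratio of the (not normalized) Hausdorff measure and the Lebesgue measure on `ℝᵐ`. -/
noncomputable def hausdorffRatio (m : ℕ) : ℝ :=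
  Measure.addHaarScalarFactor (μH[(m : ℝ)] : Measure (RVec m)) volume

theorem hausdorffRatio_pos : 0 < hausdorffRatio m :=
  Measure.addHaarScalarFactor_pos_of_isAddHaarMeasure _ _

theorem setIntegral_hausdorff (s : Set (RVec m)) (f : RVec m → ℝ) :
    ∫ y in s, f y ∂μH[(m : ℝ)] = hausdorffRatio m * ∫ y in s, f y := by
  rw [Measure.isAddLeftInvariant_eq_smul (μH[(m : ℝ)] : Measure (RVec m)) volume,
    Measure.restrict_smul, integral_smul_nnreal_measure]
  rfl

theorem abs_coord_le_norm {d : ℕ} (v : RVec d) (k : Fin d) : |v k| ≤ ‖v‖ := by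
  simpa using PiLp.norm_apply_le v k

/-- The three summands are the local errors: direction of the layer, distortion of the graph
measure, oscillation of the normal. -/
theorem exists_small_eps (m : ℕ) {η : ℝ} (hη : 0 < η) :
    ∃ ε : ℝ, 0 < ε ∧ ε ≤ 1 / 4 ∧ 4 * ε + ((1 + 2 * ε) ^ m - 1) + 2 * ε ≤ η := by
  have hc : Continuous fun ε : ℝ => 4 * ε + ((1 + 2 * ε) ^ m - 1) + 2 * ε := by fun_prop
  have h0 : Tendsto (fun ε : ℝ => 4 * ε + ((1 + 2 * ε) ^ m - 1) + 2 * ε) (𝓝[>] 0) (𝓝 0) := by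
    simpa using (hc.tendsto 0).mono_left nhdsWithin_le_nhds
  obtain ⟨ε, h1, h2, h3⟩ := ((h0.eventually (gt_mem_nhds hη)).and
    (((gt_mem_nhds (show (0 : ℝ) < 1 / 4 by norm_num)).filter_mono nhdsWithin_le_nhds).and
      self_mem_nhdsWithin)).exists
  exact ⟨ε, h3, le_of_lt h2, h1.le⟩

/-- The defect in the Gauss–Green formula, for the function `f` multiplied by a cut-off `ψ`. -/
noncomputable def gaussGreenDefect (Ω : Set (RVec (m + 1))) (k : Fin (m + 1))
    (f g ψ : RVec (m + 1) → ℝ) : ℝ :=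
  hausdorffRatio m * (∫ x in Ω, (ψ x * g x + partialD k ψ x * f x))
    - ∫ x, f x * ψ x * outNormal Ω x k ∂surfMeasure Ω

variable {Ω : Set (RVec (m + 1))} (hΩ : IsOpen Ω) (hfin : IsFiniteMeasure (surfMeasure Ω))

include hΩ hfin

theorem integrable_mul_outNormal {F : RVec (m + 1) → ℝ} (hF : Continuous F)
    (hc : HasCompactSupport F) (k : Fin (m + 1)) :
    Integrable (fun x => F x * outNormal Ω x k) (surfMeasure Ω) := by
  obtain ⟨C, hC⟩ := hc.exists_bound_of_continuous hF
  have hm : Measurable fun x => outNormal Ω x k :=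
    (EuclideanSpace.proj (𝕜 := ℝ) k).continuous.measurable.comp (measurable_outNormal hΩ)
  refine Integrable.of_bound (hF.measurable.mul hm).aestronglyMeasurable C
    (Eventually.of_forall fun x => ?_)
  rw [norm_mul]
  have h1 : ‖outNormal Ω x k‖ ≤ 1 := (abs_coord_le_norm _ k).trans (norm_outNormal_le Ω x)
  exact (mul_le_of_le_one_right (norm_nonneg _) h1).trans (hC x)

/-- The error is relative to `∫ |f ψ|`, and the neighbourhood depends on `η` and `x` but not on `k`,
`f`, `g` or `ψ`. Both features are needed to sum over a partition of unity. -/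
theorem exists_nhds_abs_gaussGreenDefect_le {x : RVec (m + 1)} (hx : x ∈ regBoundary Ω) {η : ℝ}
    (hη : 0 < η) : ∃ V, IsOpen V ∧ x ∈ V ∧ ∀ (k : Fin (m + 1)) (f g ψ : RVec (m + 1) → ℝ),
      Continuous f → IntegrableOn g Ω → IsWeakPD Ω k f g → ContDiff ℝ 1 ψ →
      HasCompactSupport ψ → tsupport ψ ⊆ V →
      |gaussGreenDefect Ω k f g ψ| ≤ η * ∫ x, |f x * ψ x| ∂surfMeasure Ω := by
  obtain ⟨ν, hν⟩ := hx
  obtain ⟨ε, hε, hε', hεη⟩ := exists_small_eps m hη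
  obtain ⟨e, φ, a, ρ, h, -, hφΩ⟩ := hν.exists_graphChart hΩ hε hε'
  refine ⟨chartCyl e x ρ, isOpen_chartCyl e x ρ, mem_chartCyl_self e x h.rho_pos, ?_⟩
  intro k f g ψ hf hg hw hψ hc hs
  set F : RVec (m + 1) → ℝ := fun x => f x * ψ x with hFdef
  have hF : Continuous F := hf.mul hψ.continuous
  have hFc : HasCompactSupport F := hc.mul_left
  have hF0 : ∀ y, y ∉ chartCyl e x ρ → F y = 0 := fun y hy => by
    simp [hFdef, image_eq_zero_of_notMem_tsupport fun h' => hy (hs h')]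
  set S := h.graph '' Metric.ball 0 ρ with hS
  have hSeq : frontier Ω ∩ chartCyl e x ρ = S := h.frontier_inter_chartCyl hΩ hφΩ
  have hSsub : S ⊆ frontier Ω := hSeq ▸ inter_subset_left
  have hred : ∀ T : RVec (m + 1) → ℝ, (∀ y, y ∉ chartCyl e x ρ → T y = 0) →
      ∫ y, T y ∂surfMeasure Ω = ∫ y in S, T y ∂μH[(m : ℝ)] := by
    intro T hT
    rw [surfMeasure_succ]
    refine setIntegral_eq_of_subset_of_forall_sdiff_eq_zero isClosed_frontier.measurableSet hSsub ?_
    rintro y ⟨hy1, hy2⟩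
    exact hT y fun h' => hy2 (hSeq ▸ ⟨hy1, h'⟩)
  have hredi : ∀ T : RVec (m + 1) → ℝ, Integrable T (surfMeasure Ω) →
      IntegrableOn T S μH[(m : ℝ)] := by
    intro T hT
    rw [surfMeasure_succ] at hT
    exact IntegrableOn.mono_set hT hSsub
  have key1 := h.abs_setIntegral_sub_le hΩ hφΩ hf hg hw hψ hc hs
  obtain ⟨key2, key3⟩ := h.abs_integral_graph_sub_le hF hFc
  rw [setIntegral_hausdorff, setIntegral_hausdorff] at key2
  rw [setIntegral_hausdorff] at key3
  set G := ∫ y in Metric.ball 0 ρ, F (h.graph y) with hG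
  set G' := ∫ y in Metric.ball 0 ρ, |F (h.graph y)| with hG'
  set A := ∫ y in S, |F y| ∂μH[(m : ℝ)] with hA
  have hFi : Integrable F (surfMeasure Ω) := by
    obtain ⟨C, hC⟩ := hFc.exists_bound_of_continuous hF
    exact Integrable.of_bound hF.aestronglyMeasurable C (Eventually.of_forall hC)
  have hFni := integrable_mul_outNormal hΩ hfin hF hFc k
  -- Across the chart the true normal stays within `2 ε` of the fixed direction `e.normal`.
  have key4 : |(∫ y in S, F y * outNormal Ω y k ∂μH[(m : ℝ)])
      - e.normal k * ∫ y in S, F y ∂μH[(m : ℝ)]| ≤ 2 * ε * A := by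
    rw [← integral_const_mul, ← integral_sub (hredi _ hFni) ((hredi _ hFi).const_mul _), hA,
      ← integral_const_mul]
    refine abs_integral_le_integral_abs.trans (setIntegral_mono_on
      ((hredi _ hFni).sub ((hredi _ hFi).const_mul _)).abs ((hredi _ hFi).abs.const_mul _)
      h.measurableSet_graph fun y hy => ?_)
    have hy' : y ∈ frontier Ω ∩ chartCyl e x ρ := hSeq ▸ hy
    have hyb := chartCyl_subset_ball e x ρ hy'.2
    have h1 := (h.isOutwardNormal hφΩ hy'.1 hyb).outNormal_eq hΩ
    have h2 := h.norm_normalized_gradient_sub_le hyb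
    rw [← h1] at h2
    have h3 := (abs_coord_le_norm (outNormal Ω y - e.normal) k).trans h2
    have h4 : F y * outNormal Ω y k - e.normal k * F y
        = (outNormal Ω y - e.normal) k * F y := by
      simp only [PiLp.sub_apply]
      ring
    simp only [h4, abs_mul]
    gcongr
  have hκ := hausdorffRatio_pos (m := m)
  have hnk : |e.normal k| ≤ 1 := (abs_coord_le_norm _ k).trans (norm_normal e).le
  rw [gaussGreenDefect, hred (fun y => f y * ψ y * outNormal Ω y k) (fun y hy => by
    have := hF0 y hy
    simp only [hFdef] at this
    rw [this, zero_mul]), hred (fun y => |f y * ψ y|) (fun y hy => by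
    have := hF0 y hy
    simp only [hFdef] at this
    rw [this, abs_zero])]
  set I := ∫ x in Ω, (ψ x * g x + partialD k ψ x * f x) with hI
  change |hausdorffRatio m * I - ∫ y in S, F y * outNormal Ω y k ∂μH[(m : ℝ)]| ≤ η * A
  have hA0 : 0 ≤ A := integral_nonneg fun _ => abs_nonneg _
  have hK0 : 0 ≤ (1 + 2 * ε) ^ m - 1 := by
    have : 1 ≤ (1 + 2 * ε) ^ m := one_le_pow₀ (by linarith)
    linarith
  have t1 : |hausdorffRatio m * (I - e.normal k * G)| ≤ 4 * ε * A := by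
    rw [abs_mul, abs_of_pos hκ]
    calc hausdorffRatio m * |I - e.normal k * G| ≤ hausdorffRatio m * (4 * ε * G') := by
          gcongr
      _ = 4 * ε * (hausdorffRatio m * G') := by ring
      _ ≤ 4 * ε * A := by gcongr
  have t2 : |e.normal k * ((∫ y in S, F y ∂μH[(m : ℝ)]) - hausdorffRatio m * G)|
      ≤ ((1 + 2 * ε) ^ m - 1) * A := by
    rw [abs_mul]
    calc |e.normal k| * |(∫ y in S, F y ∂μH[(m : ℝ)]) - hausdorffRatio m * G|
        ≤ 1 * (((1 + 2 * ε) ^ m - 1) * (hausdorffRatio m * G')) := by gcongr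
      _ ≤ ((1 + 2 * ε) ^ m - 1) * A := by
          rw [one_mul]
          gcongr
  -- From the bulk to the base of the graph, from the base to the graph itself, and from the fixed
  -- to the variable normal.
  have hsplit : hausdorffRatio m * I - ∫ y in S, F y * outNormal Ω y k ∂μH[(m : ℝ)]
      = hausdorffRatio m * (I - e.normal k * G)
        - e.normal k * ((∫ y in S, F y ∂μH[(m : ℝ)]) - hausdorffRatio m * G)
        - ((∫ y in S, F y * outNormal Ω y k ∂μH[(m : ℝ)])
          - e.normal k * ∫ y in S, F y ∂μH[(m : ℝ)]) := by ring
  rw [hsplit]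
  refine (abs_sub _ _).trans ((add_le_add ((abs_sub _ _).trans (add_le_add t1 t2)) key4).trans ?_)
  have := mul_le_mul_of_nonneg_right hεη hA0
  linarith

end GaussGreen

/-! ### Vanishing of the defect away from the singular set. -/

section Globalize

variable {m : ℕ} {Ω : Set (RVec (m + 1))} (hΩ : IsOpen Ω)
  (hfin : IsFiniteMeasure (surfMeasure Ω))

theorem partialD_sum {d : ℕ} {ι : Type*} (t : Finset ι) (k : Fin d) {ψ : ι → RVec d → ℝ}
    (hψ : ∀ i ∈ t, Differentiable ℝ (ψ i)) (x : RVec d) :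
    partialD k (fun x => ∑ i ∈ t, ψ i x) x = ∑ i ∈ t, partialD k (ψ i) x := by
  unfold partialD
  rw [fderiv_fun_sum fun i hi => hψ i hi x]
  simp

theorem integrableOn_defect {k : Fin (m + 1)} {f g ψ : RVec (m + 1) → ℝ} (hf : Continuous f)
    (hg : IntegrableOn g Ω) (hψ : ContDiff ℝ 1 ψ) (hc : HasCompactSupport ψ) :
    IntegrableOn (fun x => ψ x * g x + partialD k ψ x * f x) Ω := by
  obtain ⟨C, hC⟩ := hc.exists_bound_of_continuous hψ.continuous
  have hdc : HasCompactSupport (partialD k ψ) :=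
    hc.of_isClosed_subset (isClosed_tsupport _) tsupport_partialD_subset
  have i1 : IntegrableOn (fun x => ψ x * g x) Ω :=
    hg.bdd_mul hψ.continuous.aestronglyMeasurable (Eventually.of_forall hC)
  have i2 : IntegrableOn (fun x => partialD k ψ x * f x) Ω :=
    (((continuous_partialD hψ).mul hf).integrable_of_hasCompactSupport hdc.mul_right).integrableOn
  exact i1.add i2

include hΩ hfin

theorem gaussGreenDefect_sum {ι : Type*} (t : Finset ι) {k : Fin (m + 1)}
    {f g : RVec (m + 1) → ℝ} (hf : Continuous f) (hg : IntegrableOn g Ω)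
    {ψ : ι → RVec (m + 1) → ℝ} (hψ : ∀ i ∈ t, ContDiff ℝ 1 (ψ i))
    (hc : ∀ i ∈ t, HasCompactSupport (ψ i)) :
    gaussGreenDefect Ω k f g (fun x => ∑ i ∈ t, ψ i x)
      = ∑ i ∈ t, gaussGreenDefect Ω k f g (ψ i) := by
  simp only [gaussGreenDefect]
  rw [Finset.sum_sub_distrib, ← Finset.mul_sum, ← integral_finsetSum, ← integral_finsetSum]
  · congr 2
    · congr 1
      ext x
      rw [partialD_sum t k (fun i hi => (hψ i hi).differentiable one_ne_zero), Finset.sum_mul,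
        Finset.sum_mul, Finset.sum_add_distrib]
    · ext x
      rw [Finset.mul_sum, Finset.sum_mul]
  · intro i hi
    exact integrable_mul_outNormal hΩ hfin (hf.mul (hψ i hi).continuous) (hc i hi).mul_left k
  · intro i hi
    exact integrableOn_defect hf hg (hψ i hi) (hc i hi)

/-- For every `η` the support is covered by finitely many neighbourhoods with relative error `η`; a
partition of unity gives total defect at most `η A` with `A` independent of `η`. -/
theorem gaussGreenDefect_eq_zero {k : Fin (m + 1)} {f g ψ : RVec (m + 1) → ℝ}
    (hf : Continuous f) (hg : IntegrableOn g Ω) (hw : IsWeakPD Ω k f g) (hψ : ContDiff ℝ ∞ ψ)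
    (hc : HasCompactSupport ψ) (hs : Disjoint (tsupport ψ) (frontier Ω \ regBoundary Ω)) :
    gaussGreenDefect Ω k f g ψ = 0 := by
  have hψ1 : ContDiff ℝ 1 ψ := hψ.of_le (by exact_mod_cast le_top)
  set A := ∫ x, |f x * ψ x| ∂surfMeasure Ω with hA
  have hA0 : 0 ≤ A := integral_nonneg fun _ => abs_nonneg _
  suffices hsuff : ∀ η > 0, |gaussGreenDefect Ω k f g ψ| ≤ η * A by
    by_contra hne
    have hpos : 0 < |gaussGreenDefect Ω k f g ψ| := abs_pos.mpr hne
    -- With this `η` the bound would put the nonzero defect below half of itself.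
    have h1 := hsuff (|gaussGreenDefect Ω k f g ψ| / (2 * (A + 1))) (by positivity)
    rw [div_mul_eq_mul_div, le_div_iff₀ (by positivity)] at h1
    nlinarith
  intro η hη
  have key : ∀ x : tsupport ψ, ∃ V, IsOpen V ∧ x.1 ∈ V ∧ ∀ χ : RVec (m + 1) → ℝ,
      ContDiff ℝ ∞ χ → HasCompactSupport χ → tsupport χ ⊆ V →
      |gaussGreenDefect Ω k f g χ| ≤ η * ∫ x, |f x * χ x| ∂surfMeasure Ω := by
    rintro ⟨x, hx⟩
    have houtside : ∀ V : Set (RVec (m + 1)), Disjoint V (frontier Ω) →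
        ∀ χ : RVec (m + 1) → ℝ, tsupport χ ⊆ V →
        ∫ x, f x * χ x * outNormal Ω x k ∂surfMeasure Ω = 0 := by
      intro V hV χ hχ
      rw [surfMeasure_succ]
      refine setIntegral_eq_zero_of_forall_eq_zero fun y hy => ?_
      have : χ y = 0 := image_eq_zero_of_notMem_tsupport fun h' =>
        disjoint_left.mp hV (hχ h') hy
      rw [this, mul_zero, zero_mul]
    by_cases hxf : x ∈ frontier Ω
    · have hreg : x ∈ regBoundary Ω := by
        by_contra h'
        exact disjoint_left.mp hs hx ⟨hxf, h'⟩
      obtain ⟨V, hV, hxV, h⟩ := exists_nhds_abs_gaussGreenDefect_le hΩ hfin hreg hη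
      exact ⟨V, hV, hxV, fun χ hχ hχc hχs =>
        h k f g χ hf hg hw (hχ.of_le (by exact_mod_cast le_top)) hχc hχs⟩
    · by_cases hxΩ : x ∈ Ω
      -- Inside `Ω` the bulk term vanishes by the definition of weak derivative and there is no
      -- boundary term.
      · refine ⟨Ω, hΩ, hxΩ, fun χ hχ hχc hχs => ?_⟩
        have h0 : gaussGreenDefect Ω k f g χ = 0 := by
          have hχ1 : ContDiff ℝ 1 χ := hχ.of_le (by exact_mod_cast le_top)
          have hdisj : Disjoint Ω (frontier Ω) := by
            rw [hΩ.frontier_eq]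
            exact disjoint_sdiff_right
          rw [gaussGreenDefect, houtside Ω hdisj χ hχs]
          have h1 := hw χ ⟨hχ, hχc, hχs⟩
          obtain ⟨C, hC⟩ := hχc.exists_bound_of_continuous hχ.continuous
          have hdc : HasCompactSupport (partialD k χ) :=
            hχc.of_isClosed_subset (isClosed_tsupport _) tsupport_partialD_subset
          have i1 : IntegrableOn (fun x => χ x * g x) Ω :=
            hg.bdd_mul hχ.continuous.aestronglyMeasurable (Eventually.of_forall hC)
          have i2 : IntegrableOn (fun x => partialD k χ x * f x) Ω :=
            (((continuous_partialD hχ1).mul hf).integrable_of_hasCompactSupport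
              hdc.mul_right).integrableOn
          rw [integral_add i1 i2, h1]
          ring
        rw [h0, abs_zero]
        exact mul_nonneg hη.le (integral_nonneg fun _ => abs_nonneg _)
      · have hxc : x ∈ (closure Ω)ᶜ := by
          intro h'
          exact hxf (hΩ.frontier_eq ▸ ⟨h', hxΩ⟩)
        refine ⟨(closure Ω)ᶜ, isClosed_closure.isOpen_compl, hxc, fun χ hχ hχc hχs => ?_⟩
        have h0 : gaussGreenDefect Ω k f g χ = 0 := by
          have hdisj : Disjoint (closure Ω)ᶜ (frontier Ω) :=
            disjoint_compl_left.mono_right frontier_subset_closure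
          rw [gaussGreenDefect, houtside _ hdisj χ hχs]
          have h1 : ∫ x in Ω, (χ x * g x + partialD k χ x * f x) = 0 := by
            refine setIntegral_eq_zero_of_forall_eq_zero fun y hy => ?_
            have hy' : y ∉ tsupport χ := fun h' => hχs h' (subset_closure hy)
            have z1 : χ y = 0 := image_eq_zero_of_notMem_tsupport hy'
            have z2 : partialD k χ y = 0 := image_eq_zero_of_notMem_tsupport fun h' =>
              hy' (tsupport_partialD_subset h')
            rw [z1, z2, zero_mul, zero_mul, add_zero]
          rw [h1]
          ring
        rw [h0, abs_zero]
        exact mul_nonneg hη.le (integral_nonneg fun _ => abs_nonneg _)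
  choose V hV hxV hVkey using key
  have hK : IsCompact (tsupport ψ) := hc
  obtain ⟨t, ht⟩ := hK.elim_finite_subcover V hV
    (fun x hx => mem_iUnion.mpr ⟨⟨x, hx⟩, hxV _⟩)
  obtain ⟨p, hp⟩ := SmoothPartitionOfUnity.exists_isSubordinate
    (modelWithCornersSelf ℝ (RVec (m + 1))) (isClosed_tsupport ψ) (fun i : t => V i.1)
    (fun i => hV i.1) (fun x hx => by
      obtain ⟨i, hi, hxi⟩ := mem_iUnion₂.mp (ht hx)
      exact mem_iUnion.mpr ⟨⟨i, hi⟩, hxi⟩)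
  have hp1 : ∀ x ∈ tsupport ψ, ∑ i, p i x = 1 := by
    intro x hx
    rw [← finsum_eq_sum_of_fintype]
    exact p.sum_eq_one hx
  have hsm : ∀ i, ContDiff ℝ ∞ (fun x => p i x * ψ x) := fun i =>
    (p i).contMDiff.contDiff.mul hψ
  have hcs : ∀ i, HasCompactSupport (fun x => p i x * ψ x) := fun i => hc.mul_left
  have hss : ∀ i, tsupport (fun x => p i x * ψ x) ⊆ V i.1 := fun i =>
    (closure_mono (Function.support_mul_subset_left (p i) ψ)).trans (hp i)
  have hdecomp : ψ = fun x => ∑ i, p i x * ψ x := by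
    ext x
    rw [← Finset.sum_mul]
    by_cases hx : x ∈ tsupport ψ
    · rw [hp1 x hx, one_mul]
    · rw [image_eq_zero_of_notMem_tsupport hx, mul_zero]
  have hint : ∀ i, Integrable (fun x => |f x * (p i x * ψ x)|) (surfMeasure Ω) := by
    intro i
    have hcont : Continuous fun x => f x * (p i x * ψ x) := hf.mul (hsm i).continuous
    obtain ⟨C, hC⟩ := (hcs i).mul_left (f := f) |>.exists_bound_of_continuous hcont
    exact (Integrable.of_bound hcont.aestronglyMeasurable C (Eventually.of_forall hC)).abs
  -- Nonnegative weights summing to `1` split the mass of `|f ψ|` exactly, so the number of patches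
  -- does not enter the bound.
  have hAsum : A = ∑ i, ∫ x, |f x * (p i x * ψ x)| ∂surfMeasure Ω := by
    rw [← integral_finsetSum _ fun i _ => hint i, hA]
    congr 1
    ext x
    have : ∀ i, |f x * (p i x * ψ x)| = p i x * |f x * ψ x| := fun i => by
      rw [mul_left_comm, abs_mul, abs_of_nonneg (p.nonneg i x)]
    simp_rw [this]
    rw [← Finset.sum_mul]
    by_cases hx : x ∈ tsupport ψ
    · rw [hp1 x hx, one_mul]
    · rw [image_eq_zero_of_notMem_tsupport hx, mul_zero, abs_zero, mul_zero]
  rw [hAsum]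
  conv_lhs => rw [hdecomp]
  rw [gaussGreenDefect_sum hΩ hfin Finset.univ hf hg
    (fun i _ => (hsm i).of_le (by exact_mod_cast le_top)) (fun i _ => hcs i), Finset.mul_sum]
  exact (Finset.abs_sum_le_sum_abs _ _).trans
    (Finset.sum_le_sum fun i _ => hVkey i.1 _ (hsm i) (hcs i) (hss i))

end Globalize

/-! ### Cut-offs near sets of vanishing surface measure -/

section Cutoff

/-- Vanishing measure provides a countable cover by small sets with small `∑ diam ^ m`. Each set
meeting `S` is put in an open ball centred in `S` with radius slightly above its diameter, and
compactness makes the cover finite. -/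
theorem exists_finite_cover_of_hausdorffMeasure_eq_zero {X : Type*} [Nonempty X]
    [MetricSpace X] [MeasurableSpace X] [BorelSpace X] {S : Set X} (hS : IsCompact S) {m : ℕ}
    (h0 : μH[(m : ℝ)] S = 0) {ε : ℝ} (hε : 0 < ε) :
    ∃ (t : Finset ℕ) (c : ℕ → X) (r : ℕ → ℝ), (∀ i ∈ t, 0 < r i ∧ r i < ε ∧ c i ∈ S) ∧
      S ⊆ ⋃ i ∈ t, Metric.ball (c i) (r i) ∧ ∑ i ∈ t, r i ^ m < ε := by
  rw [Measure.hausdorffMeasure_apply] at h0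
  have h1 := (iSup_eq_bot.mp h0) (ENNReal.ofReal (ε / 2))
  have h2 := (iSup_eq_bot.mp h1) (by simpa using hε)
  have h3 : (⨅ (t : ℕ → Set X) (_ : S ⊆ ⋃ n, t n)
      (_ : ∀ n, Metric.ediam (t n) ≤ ENNReal.ofReal (ε / 2)),
      ∑' n, ⨆ _ : (t n).Nonempty, Metric.ediam (t n) ^ (m : ℝ)) < ENNReal.ofReal (ε / 2) := by
    rw [h2]
    simpa using hε
  simp only [iInf_lt_iff] at h3
  obtain ⟨T, hT, hTd, hsum⟩ := h3
  -- Summable slack pays for the strict enlargement of the radii, needed because diameters may be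
  -- zero and balls are open.
  obtain ⟨δ, hδ, hδs⟩ := ENNReal.exists_pos_sum_of_countable
    (show ENNReal.ofReal (ε / 2) ≠ 0 by simpa using hε) ℕ
  have hfin : ∀ n, Metric.ediam (T n) ≠ ⊤ := fun n => ((hTd n).trans_lt ENNReal.ofReal_lt_top).ne
  have hr : ∀ n, ∃ r : ℝ, (Metric.ediam (T n)).toReal < r ∧ r < ε ∧
      r ^ m < (Metric.ediam (T n)).toReal ^ m + δ n := by
    intro n
    set a := (Metric.ediam (T n)).toReal with ha
    have haε : a < ε := by
      have := ENNReal.toReal_mono ENNReal.ofReal_ne_top (hTd n)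
      rw [ENNReal.toReal_ofReal (by positivity)] at this
      linarith
    have hc : Tendsto (fun r : ℝ => r ^ m) (𝓝[>] a) (𝓝 (a ^ m)) :=
      ((continuous_pow m).tendsto a).mono_left nhdsWithin_le_nhds
    have hlt : a ^ m < a ^ m + δ n := by
      have : (0 : ℝ) < δ n := hδ n
      linarith
    obtain ⟨r, h1, h2, h3⟩ := ((hc.eventually (gt_mem_nhds hlt)).and
      (((gt_mem_nhds haε).filter_mono nhdsWithin_le_nhds).and self_mem_nhdsWithin)).exists
    exact ⟨r, h3, h2, h1⟩
  choose r hr1 hr2 hr3 using hr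
  by_cases hSe : S.Nonempty
  swap
  · rw [not_nonempty_iff_eq_empty] at hSe
    subst hSe
    exact ⟨∅, fun _ => Classical.arbitrary X, r, by simp, by simp, by simpa using hε⟩
  obtain ⟨x₀, hx₀⟩ := hSe
  have hc : ∀ n, ∃ c, c ∈ S ∧ ((T n ∩ S).Nonempty → c ∈ T n) := by
    intro n
    by_cases h : (T n ∩ S).Nonempty
    · obtain ⟨c, hc⟩ := h
      exact ⟨c, hc.2, fun _ => hc.1⟩
    · exact ⟨x₀, hx₀, fun h' => absurd h' h⟩
  choose c hcS hcT using hc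
  -- Sets missing `S` are discarded. For `m = 0` this matters: an empty set contributes nothing to
  -- the Hausdorff sum, but its ball would contribute `r ^ 0 = 1`.
  set N : Set ℕ := {n | (T n ∩ S).Nonempty} with hN
  obtain ⟨t, ht⟩ := hS.elim_finite_subcover (fun n : N => Metric.ball (c n) (r n))
    (fun n => Metric.isOpen_ball) (fun y hy => by
      obtain ⟨n, hn⟩ := mem_iUnion.mp (hT hy)
      have hnN : n ∈ N := ⟨y, hn, hy⟩
      refine mem_iUnion.mpr ⟨⟨n, hnN⟩, ?_⟩
      rw [Metric.mem_ball, dist_edist]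
      exact (ENNReal.toReal_mono (hfin n) (Metric.edist_le_ediam_of_mem hn (hcT n hnN))).trans_lt
        (hr1 n))
  refine ⟨t.map (Function.Embedding.subtype _), c, r, fun i _ => ⟨ENNReal.toReal_nonneg.trans_lt
    (hr1 i), hr2 i, hcS i⟩, ?_, ?_⟩
  · intro y hy
    obtain ⟨n, hn, hyn⟩ := mem_iUnion₂.mp (ht hy)
    exact mem_iUnion₂.mpr ⟨n, Finset.mem_map.mpr ⟨n, hn, rfl⟩, hyn⟩
  · have hrpos : ∀ n, 0 ≤ r n := fun n => (ENNReal.toReal_nonneg.trans_lt (hr1 n)).le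
    have hle : ENNReal.ofReal (∑ i ∈ t.map (Function.Embedding.subtype _), r i ^ m)
        < ENNReal.ofReal ε := by
      rw [ENNReal.ofReal_sum_of_nonneg fun i _ => pow_nonneg (hrpos i) m]
      have hterm : ∀ n ∈ t.map (Function.Embedding.subtype (· ∈ N)), ENNReal.ofReal (r n ^ m)
          ≤ (⨆ _ : (T n).Nonempty, Metric.ediam (T n) ^ (m : ℝ)) + δ n := by
        intro n hn
        obtain ⟨n', -, rfl⟩ := Finset.mem_map.mp hn
        have hne : (T n').Nonempty := n'.2.mono inter_subset_left
        simp only [Function.Embedding.subtype_apply, hne, iSup_pos]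
        refine (ENNReal.ofReal_le_ofReal (hr3 n').le).trans ?_
        rw [ENNReal.ofReal_add (by positivity) (by positivity), ENNReal.ofReal_coe_nnreal,
          ENNReal.ofReal_pow ENNReal.toReal_nonneg, ENNReal.ofReal_toReal (hfin n'),
          ENNReal.rpow_natCast]
      refine (Finset.sum_le_sum hterm).trans_lt ?_
      refine (ENNReal.sum_le_tsum _).trans_lt ?_
      rw [ENNReal.tsum_add]
      refine (ENNReal.add_lt_add hsum hδs).trans_le ?_
      rw [← ENNReal.ofReal_add (by positivity) (by positivity)]
      exact ENNReal.ofReal_le_ofReal (by linarith)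
    exact (ENNReal.ofReal_lt_ofReal_iff hε).mp hle

end Cutoff

section Cutoff

variable {d : ℕ}

/-- A fixed smooth bump function, equal to `1` on the unit ball. -/
noncomputable def unitBump (d : ℕ) : ContDiffBump (0 : RVec d) where
  rIn := 1
  rOut := 2
  rIn_pos := one_pos
  rIn_lt_rOut := one_lt_two

/-- The unit bump function transported to the ball with centre `c` and radius `r`. -/
noncomputable def ballBump (c : RVec d) (r : ℝ) : RVec d → ℝ :=
  fun x => unitBump d (r⁻¹ • (x - c))

theorem contDiff_ballBump (c : RVec d) (r : ℝ) : ContDiff ℝ ∞ (ballBump c r) :=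
  (unitBump d).contDiff.comp ((contDiff_id.sub contDiff_const).const_smul r⁻¹)

theorem partialD_ballBump (k : Fin d) (c : RVec d) (r : ℝ) (x : RVec d) :
    partialD k (ballBump c r) x = r⁻¹ * partialD k (unitBump d) (r⁻¹ • (x - c)) := by
  have h1 : HasFDerivAt (fun x : RVec d => r⁻¹ • (x - c))
      (r⁻¹ • ContinuousLinearMap.id ℝ (RVec d)) x :=
    ((hasFDerivAt_id x).sub_const c).const_smul r⁻¹
  have hd : Differentiable ℝ (unitBump d) :=
    ((unitBump d).contDiff (n := 1)).differentiable one_ne_zero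
  have h2 := (hd (r⁻¹ • (x - c))).hasFDerivAt.comp x h1
  have h3 : HasFDerivAt (ballBump c r) _ x := h2
  unfold partialD
  rw [h3.fderiv]
  simp

theorem hasCompactSupport_partialD_unitBump (k : Fin d) :
    HasCompactSupport (partialD k (unitBump d)) :=
  (unitBump d).hasCompactSupport.of_isClosed_subset (isClosed_tsupport _) tsupport_partialD_subset

/-- Scaling: the derivative gains `r⁻¹` and the volume `r ^ (m + 1)`. The resulting power `r ^ m` is
the one controlled by the covering sum. -/
theorem integrable_partialD_ballBump {m : ℕ} (k : Fin (m + 1)) (c : RVec (m + 1)) {r : ℝ}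
    (hr : 0 < r) : Integrable (partialD k (ballBump c r)) ∧
      ∫ x, |partialD k (ballBump c r) x|
        = r ^ m * ∫ x, |partialD k (unitBump (m + 1)) x| := by
  have hi : Integrable (partialD k (unitBump (m + 1))) :=
    (continuous_partialD (unitBump (m + 1)).contDiff).integrable_of_hasCompactSupport
      (hasCompactSupport_partialD_unitBump k)
  have heq : partialD k (ballBump c r)
      = fun x => r⁻¹ * partialD k (unitBump (m + 1)) (r⁻¹ • (x - c)) :=
    funext fun x => partialD_ballBump k c r x
  rw [heq]
  refine ⟨?_, ?_⟩
  · have := (hi.comp_smul (inv_ne_zero hr.ne')).comp_sub_right c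
    exact this.const_mul _
  · simp_rw [abs_mul]
    rw [integral_const_mul, integral_sub_right_eq_self
      (fun x => |partialD k (unitBump (m + 1)) (r⁻¹ • x)|) c,
      Measure.integral_comp_inv_smul_of_nonneg volume
        (fun x => |partialD k (unitBump (m + 1)) x|) hr.le,
      finrank_euclideanSpace_fin, abs_of_pos (inv_pos.mpr hr), smul_eq_mul, pow_succ]
    field_simp

theorem prod_one_sub_ballBump_mem_Icc (t : Finset ℕ) (c : ℕ → RVec d) (r : ℕ → ℝ) (x : RVec d) :
    ∏ i ∈ t, (1 - ballBump (c i) (r i) x) ∈ Icc (0 : ℝ) 1 := by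
  have h : ∀ i, 1 - ballBump (c i) (r i) x ∈ Icc (0 : ℝ) 1 := fun i =>
    ⟨sub_nonneg.mpr (unitBump d).le_one, sub_le_self _ (unitBump d).nonneg⟩
  exact ⟨Finset.prod_nonneg fun i _ => (h i).1, Finset.prod_le_one (fun i _ => (h i).1)
    fun i _ => (h i).2⟩

theorem contDiff_prod_one_sub_ballBump (t : Finset ℕ) (c : ℕ → RVec d) (r : ℕ → ℝ) :
    ContDiff ℝ ∞ fun x => ∏ i ∈ t, (1 - ballBump (c i) (r i) x) :=
  contDiff_prod fun i _ => contDiff_const.sub (contDiff_ballBump (c i) (r i))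

/-- Leibniz rule, with all undifferentiated factors in `[0, 1]`. -/
theorem abs_partialD_prod_one_sub_ballBump_le (t : Finset ℕ) (c : ℕ → RVec d) (r : ℕ → ℝ)
    (k : Fin d) (x : RVec d) :
    |partialD k (fun x => ∏ i ∈ t, (1 - ballBump (c i) (r i) x)) x|
      ≤ ∑ i ∈ t, |partialD k (ballBump (c i) (r i)) x| := by
  classical
  induction t using Finset.induction_on with
  | empty => simp [partialD]
  | insert a t ha ih =>
    have hd : ∀ i, DifferentiableAt ℝ (fun x => 1 - ballBump (c i) (r i) x) x := fun i =>
      ((contDiff_const.sub (contDiff_ballBump (c i) (r i))).differentiable (by simp)) x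
    have hp : DifferentiableAt ℝ (fun x => ∏ i ∈ t, (1 - ballBump (c i) (r i) x)) x :=
      ((contDiff_prod_one_sub_ballBump t c r).differentiable (by simp)) x
    simp_rw [Finset.prod_insert ha]
    rw [partialD_mul (hd a) hp, Finset.sum_insert ha]
    have h1 : partialD k (fun x => 1 - ballBump (c a) (r a) x) x
        = -partialD k (ballBump (c a) (r a)) x := by
      unfold partialD
      rw [fderiv_const_sub]
      simp
    have h2 := prod_one_sub_ballBump_mem_Icc t c r x
    have h3 : 1 - ballBump (c a) (r a) x ∈ Icc (0 : ℝ) 1 := by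
      simpa using prod_one_sub_ballBump_mem_Icc {a} c r x
    rw [h1]
    refine (abs_add_le _ _).trans (add_le_add ?_ ?_)
    · rw [abs_mul, abs_neg, abs_of_nonneg h2.1]
      exact mul_le_of_le_one_right (abs_nonneg _) h2.2
    · rw [abs_mul, abs_of_nonneg h3.1]
      exact (mul_le_of_le_one_left (abs_nonneg _) h3.2).trans ih

/-- Cut-off functions vanishing near a compact set of zero `m`-dimensional measure in `ℝᵐ⁺¹`,
with gradients small in `L¹`. -/
theorem exists_cutoff_of_hausdorffMeasure_eq_zero {m : ℕ} {S : Set (RVec (m + 1))}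
    (hS : IsCompact S) (h0 : μH[(m : ℝ)] S = 0) {ε : ℝ} (hε : 0 < ε) :
    ∃ η : RVec (m + 1) → ℝ, ContDiff ℝ ∞ η ∧ (∀ x, η x ∈ Icc (0 : ℝ) 1) ∧
      Disjoint (tsupport η) S ∧ (∀ x, (∀ y ∈ S, 2 * ε ≤ dist x y) → η x = 1) ∧
      ∀ k, Integrable (partialD k η) ∧
        ∫ x, |partialD k η x| ≤ ε * ∫ x, |partialD k (unitBump (m + 1)) x| := by
  obtain ⟨t, c, r, htr, htS, hsum⟩ := exists_finite_cover_of_hausdorffMeasure_eq_zero hS h0 hε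
  have hsm := contDiff_prod_one_sub_ballBump t c r
  refine ⟨_, hsm, prod_one_sub_ballBump_mem_Icc t c r, ?_, ?_, fun k => ?_⟩
  · have hopen : IsOpen (⋃ i ∈ t, Metric.ball (c i) (r i)) :=
      isOpen_biUnion fun i _ => Metric.isOpen_ball
    have hsupp : Function.support (fun x => ∏ i ∈ t, (1 - ballBump (c i) (r i) x))
        ⊆ (⋃ i ∈ t, Metric.ball (c i) (r i))ᶜ := fun x hx hx' => hx ?_
    · exact Disjoint.mono_right htS (disjoint_compl_left.mono_left
        (closure_minimal hsupp hopen.isClosed_compl))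
    obtain ⟨i, hi, hxi⟩ := mem_iUnion₂.mp hx'
    refine Finset.prod_eq_zero hi ?_
    have hri := (htr i hi).1
    have : ballBump (c i) (r i) x = 1 := by
      refine (unitBump (m + 1)).one_of_mem_closedBall ?_
      rw [mem_closedBall_zero_iff, norm_smul, norm_inv, Real.norm_of_nonneg hri.le,
        ← dist_eq_norm]
      exact (inv_mul_le_iff₀ hri).mpr (by simpa [unitBump] using (Metric.mem_ball.mp hxi).le)
    rw [this, sub_self]
  · intro x hx
    refine Finset.prod_eq_one fun i hi => ?_
    obtain ⟨hri, hriε, hcS⟩ := htr i hi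
    -- The bump vanishes beyond `2 r_i < 2 ε` from its centre, and the centre lies in `S`.
    have : ballBump (c i) (r i) x = 0 := by
      refine (unitBump (m + 1)).zero_of_le_dist ?_
      rw [dist_zero_right, norm_smul, norm_inv, Real.norm_of_nonneg hri.le, ← dist_eq_norm,
        ← div_eq_inv_mul, le_div_iff₀ hri]
      have := hx _ hcS
      simp only [unitBump]
      linarith
    rw [this, sub_zero]
  · have hle := abs_partialD_prod_one_sub_ballBump_le t c r k
    have hint : Integrable fun x => ∑ i ∈ t, |partialD k (ballBump (c i) (r i)) x| :=
      integrable_finsetSum t fun i hi => (integrable_partialD_ballBump k (c i) (htr i hi).1).1.abs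
    have hmeas : AEStronglyMeasurable
        (partialD k fun x => ∏ i ∈ t, (1 - ballBump (c i) (r i) x)) :=
      (continuous_partialD (hsm.of_le (by exact_mod_cast le_top))).aestronglyMeasurable
    have hi : Integrable (partialD k fun x => ∏ i ∈ t, (1 - ballBump (c i) (r i) x)) :=
      hint.mono' hmeas (Eventually.of_forall hle)
    refine ⟨hi, (integral_mono hi.abs hint hle).trans ?_⟩
    rw [integral_finsetSum _ fun i hi =>
      (integrable_partialD_ballBump k (c i) (htr i hi).1).1.abs,
      Finset.sum_congr rfl fun i hi => (integrable_partialD_ballBump k (c i) (htr i hi).1).2,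
      ← Finset.sum_mul]
    exact mul_le_mul_of_nonneg_right hsum.le (integral_nonneg fun _ => abs_nonneg _)

end Cutoff

/-! ### The Gauss–Green formula up to the singular set. -/

section GaussGreen

variable {m : ℕ} {Ω : Set (RVec (m + 1))}

theorem isClosed_singular (Ω : Set (RVec (m + 1))) (hΩ : IsOpen Ω) :
    IsClosed (frontier Ω \ regBoundary Ω) := by
  obtain ⟨W, hW, h⟩ := exists_isOpen_regBoundary_eq hΩ
  rw [h, sdiff_self_inter]
  exact isClosed_frontier.sdiff hW

/-- The Gauss–Green formula on a domain with piecewise `C¹` boundary, for continuous functions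
with an integrable weak derivative. -/
theorem IsPiecewiseC1Domain.gaussGreen (hΩ : IsPiecewiseC1Domain Ω) {k : Fin (m + 1)}
    {f g : RVec (m + 1) → ℝ} (hf : Continuous f) (hg : IntegrableOn g Ω)
    (hw : IsWeakPD Ω k f g) :
    hausdorffRatio m * ∫ x in Ω, g x = ∫ x, f x * outNormal Ω x k ∂surfMeasure Ω := by
  have hfin : IsFiniteMeasure (surfMeasure Ω) := ⟨hΩ.finite_boundary⟩
  set S := frontier Ω \ regBoundary Ω with hSdef
  have hKc : IsCompact (closure Ω) := hΩ.isBounded.isCompact_closure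
  have hScl : IsClosed S := isClosed_singular Ω hΩ.isOpen
  have hS : IsCompact S := hKc.of_isClosed_subset hScl (sdiff_subset.trans frontier_subset_closure)
  have hS0 : surfMeasure Ω S = 0 := hΩ.null_singular
  have hH : μH[(m : ℝ)] S = 0 := by
    rwa [surfMeasure_succ, Measure.restrict_apply hScl.measurableSet,
      inter_eq_left.mpr sdiff_subset] at hS0
  obtain ⟨M, hM⟩ := hKc.exists_bound_of_continuousOn hf.continuousOn
  -- `χ` equals `1` near the closure of `Ω`; it only supplies compact support.
  obtain ⟨χ, hχ, ⟨U, hU, hKU, hχ1⟩, hχ01⟩ := exists_test_one isOpen_univ hKc (subset_univ _)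
  have hpos : ∀ j : ℕ, (0 : ℝ) < 1 / ((j : ℝ) + 1) := fun j => by positivity
  choose η hη hη01 hηS hη1 hηd using fun j : ℕ =>
    exists_cutoff_of_hausdorffMeasure_eq_zero hS hH (hpos j)
  have hlim0 : Tendsto (fun j : ℕ => 1 / ((j : ℝ) + 1)) atTop (𝓝 0) :=
    tendsto_one_div_add_atTop_nhds_zero_nat
  have hptw : ∀ x, x ∉ S → ∀ᶠ j in atTop, η j x = 1 := by
    intro x hx
    obtain ⟨δ, hδ, hball⟩ := Metric.isOpen_iff.mp hScl.isOpen_compl x hx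
    filter_upwards [hlim0.eventually (gt_mem_nhds (half_pos hδ))] with j hj
    refine hη1 j x fun y hy => ?_
    by_contra hlt
    exact hball (Metric.mem_ball'.mpr (by linarith)) hy
  have hdefect : ∀ j, gaussGreenDefect Ω k f g (fun x => χ x * η j x) = 0 := fun j =>
    gaussGreenDefect_eq_zero hΩ.isOpen hfin hf hg hw (hχ.smooth.mul (hη j))
      hχ.compactSupp.mul_right
      ((hηS j).mono_left (closure_mono (Function.support_mul_subset_right χ (η j))))
  have hΩm : MeasurableSet Ω := hΩ.isOpen.measurableSet
  have hbulk : ∀ j, ∫ x in Ω, (χ x * η j x * g x + partialD k (fun x => χ x * η j x) x * f x)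
      = (∫ x in Ω, η j x * g x) + ∫ x in Ω, partialD k (η j) x * f x := by
    intro j
    rw [← integral_add (f := fun x => η j x * g x) (g := fun x => partialD k (η j) x * f x)]
    · refine setIntegral_congr_fun hΩm fun x hx => ?_
      have hxU := hKU (subset_closure hx)
      have hev : (fun x => χ x * η j x) =ᶠ[𝓝 x] η j :=
        eventually_of_mem (hU.mem_nhds hxU) fun y hy => by simp only [hχ1 y hy, one_mul]
      simp only [hχ1 x hxU, one_mul, partialD, hev.fderiv_eq]
    · exact hg.bdd_mul (c := 1) (hη j).continuous.aestronglyMeasurable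
        (Eventually.of_forall fun x => by
          rw [Real.norm_of_nonneg (hη01 j x).1]; exact (hη01 j x).2)
    · refine ((hηd j k).1.integrableOn.bdd_mul (c := M) hf.aestronglyMeasurable
        ((ae_restrict_mem hΩm).mono fun x hx => hM x (subset_closure hx))).congr ?_
      exact Eventually.of_forall fun x => mul_comm _ _
  have hl1 : Tendsto (fun j => ∫ x in Ω, η j x * g x) atTop (𝓝 (∫ x in Ω, g x)) := by
    refine tendsto_integral_of_dominated_convergence (fun x => ‖g x‖)
      (fun j => (hη j).continuous.aestronglyMeasurable.mul hg.aestronglyMeasurable) hg.norm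
      (fun j => Eventually.of_forall fun x => ?_) ?_
    · rw [norm_mul, Real.norm_of_nonneg (hη01 j x).1]
      exact mul_le_of_le_one_left (norm_nonneg _) (hη01 j x).2
    · filter_upwards [ae_restrict_mem hΩm] with x hx
      have hxS : x ∉ S := fun h => by
        have := h.1
        rw [hΩ.isOpen.frontier_eq] at this
        exact this.2 hx
      exact tendsto_const_nhds.congr' ((hptw x hxS).mono fun j hj => by simp only [hj, one_mul])
  -- The cut-off gradients tend to zero in `L¹`, and `f` is bounded on the closure: the singular set
  -- produces no extra term.
  have hl2 : Tendsto (fun j => ∫ x in Ω, partialD k (η j) x * f x) atTop (𝓝 0) := by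
    set D := ∫ x, |partialD k (unitBump (m + 1)) x|
    refine squeeze_zero_norm (a := fun j : ℕ => 1 / ((j : ℝ) + 1) * D * |M|) (fun j => ?_) ?_
    · have hi := (hηd j k).1
      refine (norm_integral_le_of_norm_le (hi.abs.integrableOn.mul_const |M|)
        ((ae_restrict_mem hΩm).mono fun x hx => ?_)).trans ?_
      · rw [norm_mul]
        exact mul_le_mul_of_nonneg_left ((hM x (subset_closure hx)).trans (le_abs_self _))
          (abs_nonneg _)
      · rw [integral_mul_const]
        refine mul_le_mul_of_nonneg_right ?_ (abs_nonneg _)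
        exact (setIntegral_le_integral hi.abs (Eventually.of_forall fun _ => abs_nonneg _)).trans
          (hηd j k).2
    · simpa using (hlim0.mul_const D).mul_const |M|
  -- The cut-offs tend to `1` off the null set `S`, dominated by a constant on a finite measure.
  have hl3 : Tendsto (fun j => ∫ x, f x * (χ x * η j x) * outNormal Ω x k ∂surfMeasure Ω) atTop
      (𝓝 (∫ x, f x * outNormal Ω x k ∂surfMeasure Ω)) := by
    have hmn : Measurable fun x => outNormal Ω x k :=
      (EuclideanSpace.proj (𝕜 := ℝ) k).continuous.measurable.comp (measurable_outNormal hΩ.isOpen)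
    have hfr : ∀ᵐ x ∂surfMeasure Ω, x ∈ frontier Ω := by
      rw [surfMeasure_succ]
      exact ae_restrict_mem isClosed_frontier.measurableSet
    refine tendsto_integral_of_dominated_convergence (fun _ => M)
      (fun j => (((hf.mul (hχ.smooth.continuous.mul (hη j).continuous)).measurable).mul
        hmn).aestronglyMeasurable) (integrable_const M) (fun j => ?_) ?_
    · filter_upwards [hfr] with x hx
      have h1 := hM x (frontier_subset_closure hx)
      have h2 : |outNormal Ω x k| ≤ 1 := (abs_coord_le_norm _ _).trans (norm_outNormal_le Ω x)
      have h3 : |χ x * η j x| ≤ 1 := by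
        rw [abs_of_nonneg (mul_nonneg (hχ01 x).1 (hη01 j x).1)]
        exact mul_le_one₀ (hχ01 x).2 (hη01 j x).1 (hη01 j x).2
      have hM0 : 0 ≤ M := (norm_nonneg _).trans h1
      rw [norm_mul, norm_mul, Real.norm_eq_abs (χ x * η j x), Real.norm_eq_abs (outNormal Ω x k)]
      calc ‖f x‖ * |χ x * η j x| * |outNormal Ω x k| ≤ M * 1 * 1 := by gcongr
        _ = M := by ring
    · have hae : ∀ᵐ x ∂surfMeasure Ω, x ∉ S := measure_eq_zero_iff_ae_notMem.mp hS0
      filter_upwards [hfr, hae] with x hx hxS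
      refine tendsto_const_nhds.congr' ((hptw x hxS).mono fun j hj => ?_)
      simp only [hj, hχ1 x (hKU (frontier_subset_closure hx)), mul_one]
  have hl12 := (hl1.add hl2).const_mul (hausdorffRatio m)
  rw [add_zero] at hl12
  refine tendsto_nhds_unique hl12 (hl3.congr fun j => ?_)
  have h := hdefect j
  rw [gaussGreenDefect, hbulk] at h
  linarith

end GaussGreen

/-! ### Weak derivatives of continuous functions and of Sobolev functions -/

section WeakCalculus

variable {d : ℕ} {Ω : Set (RVec d)} {k : Fin d}

/-- `f` is continuous on `ℝᵈ` and has the integrable weak partial derivative `g` in `Ω`. -/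
structure HasIntegrableWeakPD (Ω : Set (RVec d)) (k : Fin d) (f g : RVec d → ℝ) : Prop where
  cont : Continuous f
  int : IntegrableOn g Ω
  weak : IsWeakPD Ω k f g

theorem integrableOn_continuous_mul (hΩ : Bornology.IsBounded Ω) {f g : RVec d → ℝ}
    (hf : Continuous f) (hg : IntegrableOn g Ω) : IntegrableOn (fun x => f x * g x) Ω := by
  obtain ⟨M, hM⟩ := hΩ.isCompact_closure.exists_bound_of_continuousOn hf.continuousOn
  refine Integrable.bdd_mul (c := M) hg hf.aestronglyMeasurable ?_
  have hcl : ∀ᵐ x ∂volume.restrict (closure Ω), ‖f x‖ ≤ M :=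
    (ae_restrict_mem isClosed_closure.measurableSet).mono fun x hx => hM x hx
  exact ae_mono (Measure.restrict_mono subset_closure le_rfl) hcl

theorem HasIntegrableWeakPD.mul (hΩ : IsOpen Ω) (hb : Bornology.IsBounded Ω)
    {f₁ g₁ f₂ g₂ : RVec d → ℝ} (h₁ : HasIntegrableWeakPD Ω k f₁ g₁)
    (h₂ : HasIntegrableWeakPD Ω k f₂ g₂) :
    HasIntegrableWeakPD Ω k (fun x => f₁ x * f₂ x) (fun x => f₁ x * g₂ x + g₁ x * f₂ x) where
  cont := h₁.cont.mul h₂.cont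
  int := by
    have h := integrableOn_continuous_mul hb h₂.cont h₁.int
    simp_rw [mul_comm (f₂ _)] at h
    exact (integrableOn_continuous_mul hb h₁.cont h₂.int).add h
  weak := h₁.weak.mul hΩ h₁.cont h₁.int h₂.cont h₂.int h₂.weak

theorem HasIntegrableWeakPD.exp (hΩ : IsOpen Ω) (hb : Bornology.IsBounded Ω)
    {f g : RVec d → ℝ} (h : HasIntegrableWeakPD Ω k f g) :
    HasIntegrableWeakPD Ω k (fun x => Real.exp (f x)) (fun x => Real.exp (f x) * g x) where
  cont := Real.continuous_exp.comp h.cont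
  int := integrableOn_continuous_mul hb (Real.continuous_exp.comp h.cont) h.int
  weak := h.weak.exp hΩ h.cont h.int

theorem HasIntegrableWeakPD.sum (hb : Bornology.IsBounded Ω) {ι : Type*} (t : Finset ι)
    {f g : ι → RVec d → ℝ} (h : ∀ i ∈ t, HasIntegrableWeakPD Ω k (f i) (g i)) :
    HasIntegrableWeakPD Ω k (fun x => ∑ i ∈ t, f i x) (fun x => ∑ i ∈ t, g i x) where
  cont := continuous_finsetSum t fun i hi => (h i hi).cont
  int := integrable_finsetSum t fun i hi => (h i hi).int
  weak := by
    intro φ hφ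
    have hK : IntegrableOn (fun _ => (1 : ℝ)) Ω := by
      refine integrableOn_const (hb.measure_lt_top.ne)
    have hφ1 : ContDiff ℝ 1 φ := hφ.smooth.of_le (by exact_mod_cast le_top)
    simp_rw [Finset.mul_sum]
    rw [integral_finsetSum, integral_finsetSum, ← Finset.sum_neg_distrib]
    · exact Finset.sum_congr rfl fun i hi => (h i hi).weak φ hφ
    · exact fun i hi => integrableOn_continuous_mul hb hφ1.continuous (h i hi).int
    · intro i hi
      have := integrableOn_continuous_mul hb ((continuous_partialD (k := k) hφ1).mul (h i hi).cont)
        hK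
      simp only [mul_one] at this
      exact this

theorem multiD_single (k : Fin d) (f : RVec d → ℝ) : multiD (Pi.single k 1) f = partialD k f := by
  have key : ∀ l : List (Fin d), l.Nodup →
      l.foldr (fun j g => (partialD j)^[(Pi.single k 1 : Fin d → ℕ) j] g) f
        = if k ∈ l then partialD k f else f := by
    intro l
    induction l with
    | nil => simp
    | cons a l ih =>
      intro hl
      rw [List.nodup_cons] at hl
      rw [List.foldr_cons, ih hl.2]
      by_cases hak : a = k
      · subst hak
        simp [hl.1]
      · simp [Ne.symm hak]
  unfold multiD
  rw [key _ (List.nodup_finRange d), if_pos (List.mem_finRange k)]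

/-- A continuous functional commutes with the integrals in the vector-valued definition, reducing it
to the scalar calculus above. -/
theorem isWeakPD_sobPD {F : Type} [NormedAddCommGroup F] [NormedSpace ℝ F] [CompleteSpace F]
    {s : ℝ} (hs : 1 ≤ ⌊s⌋₊) (u : SobolevH Ω s F) (ℓ : F →L[ℝ] ℝ) :
    IsWeakPD Ω k (fun x => ℓ (sobFun u x)) (fun x => ℓ (sobPD u k x)) := by
  intro φ hφ
  have hφ' : ContDiff ℝ ∞ φ ∧ HasCompactSupport φ := ⟨hφ.smooth, hφ.compactSupp⟩
  have h := u.2.1 ⟨Pi.single k 1, by simpa using hs⟩ φ hφ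
  simp only [multiD_single, Finset.sum_pi_single', Finset.mem_univ, if_true, pow_one] at h
  have h' : ∫ x in Ω, partialD k φ x • sobFun u x
      = (-1 : ℝ) • ∫ x in Ω, φ x • sobPD u k x := by
    rw [sobPD, dif_pos hs]
    exact h
  have h2 := congrArg ℓ h'
  rw [map_smul, ← ℓ.integral_comp_comm (integrable_test_smul (partialD_smooth k hφ') _),
    ← ℓ.integral_comp_comm (integrable_test_smul hφ' _)] at h2
  simpa only [map_smul, smul_eq_mul, neg_mul, one_mul] using h2

theorem integrableOn_clm_Lp {F : Type} [NormedAddCommGroup F] [NormedSpace ℝ F]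
    (hb : Bornology.IsBounded Ω) (f : Lp F 2 (volume.restrict Ω)) (ℓ : F →L[ℝ] ℝ) :
    IntegrableOn (fun x => ℓ (f x)) Ω := by
  have : IsFiniteMeasure (volume.restrict Ω) := ⟨by simpa using hb.measure_lt_top⟩
  exact ℓ.integrable_comp ((Lp.memLp f).integrable one_le_two)

theorem IsContRep.hasIntegrableWeakPD {F : Type} [NormedAddCommGroup F] [NormedSpace ℝ F]
    [CompleteSpace F] (hb : Bornology.IsBounded Ω) (hΩ : MeasurableSet Ω) {s : ℝ}
    (hs : 1 ≤ ⌊s⌋₊) {u : SobolevH Ω s F} {v : RVec d → F} (hv : IsContRep u v)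
    (ℓ : F →L[ℝ] ℝ) {f : RVec d → ℝ} (hf : Continuous f) (hfv : ∀ x ∈ closure Ω, f x = ℓ (v x)) :
    HasIntegrableWeakPD Ω k f (fun x => ℓ (sobPD u k x)) where
  cont := hf
  int := integrableOn_clm_Lp hb _ ℓ
  weak := by
    refine (isWeakPD_sobPD hs u ℓ).congr ?_ EventuallyEq.rfl
    filter_upwards [hv.ae_eq, ae_restrict_mem hΩ] with x h1 h2
    rw [← h1, hfv x (subset_closure h2)]

/-- Tietze extension. The calculus above is stated for functions continuous on all of `ℝᵈ`, while
Gauss–Green only sees values on the closure. -/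
theorem exists_continuous_eq_on_closure {f : RVec d → ℝ} (hf : ContinuousOn f (closure Ω)) :
    ∃ f' : RVec d → ℝ, Continuous f' ∧ ∀ x ∈ closure Ω, f' x = f x := by
  obtain ⟨F, hF⟩ := ContinuousMap.exists_restrict_eq isClosed_closure
    (⟨(closure Ω).domRestrict f, continuousOn_iff_continuous_domRestrict.mp hf⟩ : C(closure Ω, ℝ))
  exact ⟨F, F.continuous, fun x hx => DFunLike.congr_fun hF ⟨x, hx⟩⟩

theorem hasIntegrableWeakPD_of_contDiffOn (hΩ : IsOpen Ω) (hb : Bornology.IsBounded Ω)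
    {a f : RVec d → ℝ} (ha : ContDiffOn ℝ 1 a Ω) {M : ℝ} (hM : ∀ x ∈ Ω, ‖fderiv ℝ a x‖ ≤ M)
    (hf : Continuous f) (hfa : ∀ x ∈ closure Ω, f x = a x) :
    HasIntegrableWeakPD Ω k f (partialD k a) where
  cont := hf
  int := by
    have hc : ContinuousOn (partialD k a) Ω :=
      (ha.continuousOn_fderiv_of_isOpen hΩ le_rfl).clm_apply continuousOn_const
    refine IntegrableOn.of_bound hb.measure_lt_top (hc.aestronglyMeasurable hΩ.measurableSet) M ?_
    filter_upwards [ae_restrict_mem hΩ.measurableSet] with x hx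
    refine (ContinuousLinearMap.le_opNorm _ _).trans ?_
    simpa using hM x hx
  weak := by
    refine (IsWeakPD.of_contDiffOn hΩ ha).congr ?_ EventuallyEq.rfl
    filter_upwards [ae_restrict_mem hΩ.measurableSet] with x hx
    rw [hfa x (subset_closure hx)]

end WeakCalculus

/-! ### The boundary flux -/

section Flux

variable {m n : ℕ} {Ω : Set (RVec (m + 1))}
  {A : Fin (m + 1) → RVec (m + 1) → Matrix (Fin n) (Fin n) ℝ}
  {lam : RVec (m + 1) → RVec (m + 1) → Fin n → ℝ}
  {T : RVec (m + 1) → RVec (m + 1) → Matrix (Fin n) (Fin n) ℝ}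

theorem norm_outNormal_of_mem {x : RVec (m + 1)} (hx : x ∈ regBoundary Ω) :
    ‖outNormal Ω x‖ = 1 :=
  (isOutwardNormal_outNormal hx).norm_eq

theorem IsPencilDiag.pencil_eq (hT : IsPencilDiag Ω A lam T) {x : RVec (m + 1)}
    (hx : x ∈ regBoundary Ω) :
    pencil A x (outNormal Ω x) = T x (outNormal Ω x) * Matrix.diagonal (lam x (outNormal Ω x))
      * (T x (outNormal Ω x))ᵀ := by
  have hf := regBoundary_subset_frontier Ω hx
  have h1 := hT.orth x hf _ (norm_outNormal_of_mem hx)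
  have h2 := mul_eq_one_comm.mp h1
  rw [← hT.diag x hf _ (norm_outNormal_of_mem hx)]
  simp only [← mul_assoc]
  rw [h2, one_mul, mul_assoc, h2, mul_one]

theorem IsPencilDiag.quadForm_eq (hT : IsPencilDiag Ω A lam T) {x : RVec (m + 1)}
    (hx : x ∈ regBoundary Ω) (v : RVec n) :
    WithLp.ofLp v ⬝ᵥ (pencil A x (outNormal Ω x) *ᵥ WithLp.ofLp v)
      = ∑ i, lam x (outNormal Ω x) i * charVar Ω T x v i ^ 2 := by
  rw [hT.pencil_eq hx, ← Matrix.mulVec_mulVec, ← Matrix.mulVec_mulVec, Matrix.dotProduct_mulVec,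
    ← Matrix.mulVec_transpose]
  simp only [charVar, dotProduct, Matrix.mulVec_diagonal]
  exact Finset.sum_congr rfl fun i _ => by ring

/-- The columns of an orthogonal matrix are unit vectors. -/
theorem IsPencilDiag.abs_apply_le (hT : IsPencilDiag Ω A lam T) {x : RVec (m + 1)}
    (hx : x ∈ regBoundary Ω) (i j : Fin n) : |T x (outNormal Ω x) i j| ≤ 1 := by
  have h1 := hT.orth x (regBoundary_subset_frontier Ω hx) _ (norm_outNormal_of_mem hx)
  have h2 := congrFun (congrFun h1 j) j
  rw [Matrix.mul_apply, Matrix.one_apply_eq] at h2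
  simp only [Matrix.transpose_apply] at h2
  have h3 := Finset.single_le_sum (f := fun l => T x (outNormal Ω x) l j * T x (outNormal Ω x) l j)
    (fun l _ => mul_self_nonneg _) (Finset.mem_univ i)
  rw [h2] at h3
  exact abs_le_one_iff_mul_self_le_one.mpr h3

theorem ae_mem_regBoundary (hΩ : IsPiecewiseC1Domain Ω) :
    ∀ᵐ x ∂surfMeasure Ω, x ∈ regBoundary Ω := by
  have hfr : ∀ᵐ x ∂surfMeasure Ω, x ∈ frontier Ω := by
    rw [surfMeasure_succ]
    exact ae_restrict_mem isClosed_frontier.measurableSet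
  filter_upwards [hfr, measure_eq_zero_iff_ae_notMem.mp hΩ.null_singular] with x h1 h2
  by_contra h3
  exact h2 ⟨h1, h3⟩

/-- Real functions which are measurable and bounded along the boundary. -/
def IsBoundaryBdd (Ω : Set (RVec (m + 1))) (f : RVec (m + 1) → ℝ) : Prop :=
  AEStronglyMeasurable f (surfMeasure Ω) ∧ ∃ M : ℝ, ∀ᵐ x ∂surfMeasure Ω, |f x| ≤ M

theorem IsBoundaryBdd.mul {f g : RVec (m + 1) → ℝ} (hf : IsBoundaryBdd Ω f)
    (hg : IsBoundaryBdd Ω g) : IsBoundaryBdd Ω fun x => f x * g x := by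
  obtain ⟨hf, M, hM⟩ := hf
  obtain ⟨hg, N, hN⟩ := hg
  refine ⟨hf.mul hg, M * N, ?_⟩
  filter_upwards [hM, hN] with x h1 h2
  rw [abs_mul]
  exact mul_le_mul h1 h2 (abs_nonneg _) ((abs_nonneg _).trans h1)

theorem IsBoundaryBdd.sum {ι : Type*} (t : Finset ι) {f : ι → RVec (m + 1) → ℝ}
    (hf : ∀ i ∈ t, IsBoundaryBdd Ω (f i)) : IsBoundaryBdd Ω fun x => ∑ i ∈ t, f i x := by
  classical
  induction t using Finset.induction_on with
  | empty => exact ⟨by simpa using aestronglyMeasurable_const, 0, by simp⟩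
  | insert a t ha ih =>
    obtain ⟨h1, M, hM⟩ := hf a (Finset.mem_insert_self a t)
    obtain ⟨h2, N, hN⟩ := ih fun i hi => hf i (Finset.mem_insert_of_mem hi)
    simp_rw [Finset.sum_insert ha]
    refine ⟨h1.add h2, M + N, ?_⟩
    filter_upwards [hM, hN] with x h3 h4
    exact (abs_add_le _ _).trans (add_le_add h3 h4)

theorem IsBoundaryBdd.congr {f g : RVec (m + 1) → ℝ} (hf : IsBoundaryBdd Ω f)
    (h : f =ᵐ[surfMeasure Ω] g) : IsBoundaryBdd Ω g := by
  obtain ⟨hf, M, hM⟩ := hf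
  refine ⟨hf.congr h, M, ?_⟩
  filter_upwards [hM, h] with x h1 h2
  rwa [← h2]

theorem IsBoundaryBdd.integrable (hΩ : IsPiecewiseC1Domain Ω) {f : RVec (m + 1) → ℝ}
    (hf : IsBoundaryBdd Ω f) : Integrable f (surfMeasure Ω) := by
  have hfin : IsFiniteMeasure (surfMeasure Ω) := ⟨hΩ.finite_boundary⟩
  obtain ⟨hf, M, hM⟩ := hf
  exact Integrable.of_bound hf M hM

theorem isBoundaryBdd_of_continuousOn (hΩ : IsPiecewiseC1Domain Ω) {f : RVec (m + 1) → ℝ}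
    (hf : ContinuousOn f (closure Ω)) : IsBoundaryBdd Ω f := by
  have hfc : ContinuousOn f (frontier Ω) := hf.mono frontier_subset_closure
  obtain ⟨M, hM⟩ := hΩ.isBounded.isCompact_closure.exists_bound_of_continuousOn hf
  refine ⟨?_, M, ?_⟩
  · rw [surfMeasure_succ]
    exact hfc.aestronglyMeasurable isClosed_frontier.measurableSet
  · filter_upwards [ae_mem_regBoundary hΩ] with x hx
    exact hM x (frontier_subset_closure (regBoundary_subset_frontier Ω hx))

theorem isBoundaryBdd_outNormal (hΩ : IsOpen Ω) (k : Fin (m + 1)) :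
    IsBoundaryBdd Ω fun x => outNormal Ω x k :=
  ⟨((EuclideanSpace.proj (𝕜 := ℝ) k).continuous.measurable.comp
    (measurable_outNormal hΩ)).aestronglyMeasurable, 1, Eventually.of_forall fun x =>
      (abs_coord_le_norm _ _).trans (norm_outNormal_le Ω x)⟩

theorem IsPencilDiag.isBoundaryBdd (hΩ : IsPiecewiseC1Domain Ω) (hT : IsPencilDiag Ω A lam T)
    (i j : Fin n) : IsBoundaryBdd Ω fun x => T x (outNormal Ω x) i j :=
  ⟨hT.meas i j, 1, (ae_mem_regBoundary hΩ).mono fun _ hx => hT.abs_apply_le hx i j⟩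

/-- The eigenvalue is a diagonal entry of `Tᵀ A* T`, so it inherits measurability and boundedness
from `T`, the normal and the coefficients. -/
theorem IsPencilDiag.isBoundaryBdd_lam (hΩ : IsPiecewiseC1Domain Ω) (hT : IsPencilDiag Ω A lam T)
    (hA : ∀ k i j, ContinuousOn (fun x => A k x i j) (closure Ω)) (i : Fin n) :
    IsBoundaryBdd Ω fun x => lam x (outNormal Ω x) i := by
  have h : IsBoundaryBdd Ω fun x => ∑ q, (∑ p, T x (outNormal Ω x) p i *
      ∑ k, outNormal Ω x k * A k x p q) * T x (outNormal Ω x) q i :=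
    .sum _ fun q _ => .mul (.sum _ fun p _ => .mul (hT.isBoundaryBdd hΩ p i)
      (.sum _ fun k _ => .mul (isBoundaryBdd_outNormal hΩ.isOpen k)
        (isBoundaryBdd_of_continuousOn hΩ (hA k p q)))) (hT.isBoundaryBdd hΩ q i)
  refine h.congr ?_
  filter_upwards [ae_mem_regBoundary hΩ] with x hx
  have h1 := congrFun (congrFun (hT.diag x (regBoundary_subset_frontier Ω hx) _
    (norm_outNormal_of_mem hx)) i) i
  rw [Matrix.diagonal_apply_eq] at h1
  rw [← h1]
  simp only [Matrix.mul_apply, Matrix.transpose_apply, pencil, Matrix.sum_apply,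
    Matrix.smul_apply, smul_eq_mul]

theorem IsPencilDiag.isBoundaryBdd_charVar (hΩ : IsPiecewiseC1Domain Ω)
    (hT : IsPencilDiag Ω A lam T) {v : RVec (m + 1) → RVec n}
    (hv : ContinuousOn v (closure Ω)) (i : Fin n) :
    IsBoundaryBdd Ω fun x => charVar Ω T x (v x) i := by
  have h : IsBoundaryBdd Ω fun x => ∑ j, T x (outNormal Ω x) j i * v x j :=
    .sum _ fun j _ => .mul (hT.isBoundaryBdd hΩ j i) (isBoundaryBdd_of_continuousOn hΩ
      ((EuclideanSpace.proj (𝕜 := ℝ) j).continuous.comp_continuousOn hv))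
  exact h

/-- Under the feedback boundary condition the weighted flux through the boundary is
nonnegative. -/
theorem IsPencilDiag.flux_nonneg (hΩ : IsPiecewiseC1Domain Ω) (hT : IsPencilDiag Ω A lam T)
    (hA : ∀ k i j, ContinuousOn (fun x => A k x i j) (closure Ω))
    {v : RVec (m + 1) → RVec n} (hv : ContinuousOn v (closure Ω)) {μ : RVec (m + 1) → ℝ}
    (hμ : ContinuousOn μ (closure Ω)) {u u' : RVec (m + 1) → RVec n}
    (hu : ∀ x ∈ regBoundary Ω,
      WithLp.ofLp (u x) = T x (outNormal Ω x) *ᵥ WithLp.ofLp (u' x))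
    (hbc : ∀ i, ∀ x ∈ gammaMinus Ω lam i, charVar Ω T x (v x) i = charVar Ω T x (u x) i)
    (hle : -∑ i, ∫ x in gammaMinus Ω lam i,
        lam x (outNormal Ω x) i * (u' x i) ^ 2 * Real.exp (μ x) ∂surfMeasure Ω
      ≤ ∑ i, ∫ x in gammaPlus Ω lam i,
        lam x (outNormal Ω x) i * (charVar Ω T x (v x) i) ^ 2 * Real.exp (μ x)
          ∂surfMeasure Ω) :
    0 ≤ ∫ x, (WithLp.ofLp (v x) ⬝ᵥ (pencil A x (outNormal Ω x) *ᵥ WithLp.ofLp (v x)))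
      * Real.exp (μ x) ∂surfMeasure Ω := by
  have hint : ∀ i, Integrable (fun x => lam x (outNormal Ω x) i * (charVar Ω T x (v x) i) ^ 2
      * Real.exp (μ x)) (surfMeasure Ω) := by
    intro i
    have hq := hT.isBoundaryBdd_charVar hΩ hv i
    have := ((hT.isBoundaryBdd_lam hΩ hA i).mul (hq.mul hq)).mul
      (isBoundaryBdd_of_continuousOn hΩ (Real.continuous_exp.comp_continuousOn hμ))
    simp_rw [pow_two]
    exact this.integrable hΩ
  have hreg := ae_mem_regBoundary hΩ
  have hregm : NullMeasurableSet (regBoundary Ω) (surfMeasure Ω) :=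
    (measurableSet_regBoundary hΩ.isOpen).nullMeasurableSet
  have hminus : ∀ i, NullMeasurableSet (gammaMinus Ω lam i) (surfMeasure Ω) := fun i =>
    hregm.inter (nullMeasurableSet_lt (hT.isBoundaryBdd_lam hΩ hA i).1.aemeasurable
      aemeasurable_const)
  -- Orthogonality cancels `Tᵀ T`, so on the inflow part the control component is the characteristic
  -- variable itself.
  have hq : ∀ i, ∀ x ∈ gammaMinus Ω lam i, u' x i = charVar Ω T x (v x) i := by
    intro i x hx
    rw [hbc i x hx, charVar, hu x hx.1, Matrix.mulVec_mulVec,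
      hT.orth x (regBoundary_subset_frontier Ω hx.1) _ (norm_outNormal_of_mem hx.1),
      Matrix.one_mulVec]
  have hmq : ∀ i, ∫ x in gammaMinus Ω lam i,
      lam x (outNormal Ω x) i * (u' x i) ^ 2 * Real.exp (μ x) ∂surfMeasure Ω
      = ∫ x in gammaMinus Ω lam i,
      lam x (outNormal Ω x) i * (charVar Ω T x (v x) i) ^ 2 * Real.exp (μ x) ∂surfMeasure Ω := by
    intro i
    refine integral_congr_ae ?_
    filter_upwards [ae_restrict_mem₀ (hminus i)] with x hx
    rw [hq i x hx]
  have hsplit : ∀ i, ∫ x, lam x (outNormal Ω x) i * (charVar Ω T x (v x) i) ^ 2 * Real.exp (μ x)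
      ∂surfMeasure Ω = (∫ x in gammaPlus Ω lam i, lam x (outNormal Ω x) i *
        (charVar Ω T x (v x) i) ^ 2 * Real.exp (μ x) ∂surfMeasure Ω)
      + ∫ x in gammaMinus Ω lam i,
      lam x (outNormal Ω x) i * (charVar Ω T x (v x) i) ^ 2 * Real.exp (μ x) ∂surfMeasure Ω := by
    intro i
    have hdisj : Disjoint (gammaPlus Ω lam i) (gammaMinus Ω lam i) :=
      disjoint_left.mpr fun x h1 h2 => absurd h2.2 (not_lt.mpr h1.2)
    rw [← setIntegral_union₀ hdisj.aedisjoint (hminus i) (hint i).integrableOn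
      (hint i).integrableOn]
    -- The two parts exhaust the regular boundary, which has full surface measure.
    refine (setIntegral_eq_integral_of_ae_compl_eq_zero ?_).symm
    filter_upwards [hreg] with x hx hx'
    exact absurd ((le_or_gt 0 (lam x (outNormal Ω x) i)).imp (fun h => ⟨hx, h⟩)
      fun h => ⟨hx, h⟩) hx'
  have hmain : ∫ x, (WithLp.ofLp (v x) ⬝ᵥ (pencil A x (outNormal Ω x) *ᵥ WithLp.ofLp (v x)))
      * Real.exp (μ x) ∂surfMeasure Ω = ∑ i, ∫ x, lam x (outNormal Ω x) i *
      (charVar Ω T x (v x) i) ^ 2 * Real.exp (μ x) ∂surfMeasure Ω := by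
    rw [← integral_finsetSum _ fun i _ => hint i]
    refine integral_congr_ae ?_
    filter_upwards [hreg] with x hx
    rw [hT.quadForm_eq hx, Finset.sum_mul]
  rw [hmain]
  simp_rw [hsplit, ← hmq]
  rw [Finset.sum_add_distrib]
  linarith

end Flux

/-! ### The energy identity in the domain -/

section Energy

variable {m n : ℕ} {Ω : Set (RVec (m + 1))}
  {A : Fin (m + 1) → RVec (m + 1) → Matrix (Fin n) (Fin n) ℝ}
  {B : RVec (m + 1) → Matrix (Fin n) (Fin n) ℝ}

/-- The weak partial derivative `∂_k (vᵀ A^(k) v e^μ)`, where `p` and `μ'` stand for `∂_k v`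
and `∂_k μ`. -/
noncomputable def fluxDensity (k : Fin (m + 1))
    (A : Fin (m + 1) → RVec (m + 1) → Matrix (Fin n) (Fin n) ℝ) (v p : RVec (m + 1) → RVec n)
    (μ μ' : RVec (m + 1) → ℝ) (x : RVec (m + 1)) : ℝ :=
  (WithLp.ofLp (v x) ⬝ᵥ
      ((Matrix.of fun i j => partialD k (fun y => A k y i j) x) *ᵥ WithLp.ofLp (v x))
    + 2 * (WithLp.ofLp (v x) ⬝ᵥ (A k x *ᵥ WithLp.ofLp (p x)))
    + μ' x * (WithLp.ofLp (v x) ⬝ᵥ (A k x *ᵥ WithLp.ofLp (v x)))) * Real.exp (μ x)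

theorem Matrix.IsSymm.dotProduct_mulVec_comm {M : Matrix (Fin n) (Fin n) ℝ} (hM : M.IsSymm)
    (v w : Fin n → ℝ) : v ⬝ᵥ (M *ᵥ w) = w ⬝ᵥ (M *ᵥ v) := by
  rw [Matrix.dotProduct_mulVec, ← Matrix.mulVec_transpose, hM.eq, dotProduct_comm]

theorem dotProduct_mulVec_eq_sum (v w : Fin n → ℝ) (M : Matrix (Fin n) (Fin n) ℝ) :
    v ⬝ᵥ (M *ᵥ w) = ∑ i, ∑ j, M i j * v i * w j := by
  simp only [dotProduct, Matrix.mulVec, Finset.mul_sum]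
  exact Finset.sum_congr rfl fun i _ => Finset.sum_congr rfl fun j _ => by ring

variable {s : ℝ} (hΩ : IsPiecewiseC1Domain Ω) (hAB : IsSymmetricSystem Ω A B) (hs : 1 ≤ ⌊s⌋₊)
  {V : SobolevH Ω s (RVec n)} {v : RVec (m + 1) → RVec n} (hv : IsContRep V v)
  {N : SobolevH Ω s ℝ} {μ : RVec (m + 1) → ℝ} (hμ : IsContRep N μ)

include hΩ hAB hs hv hμ

/-- Each summand of the flux is a product of a coefficient, two components of `v` and `e^μ`, all
continuous with integrable weak derivatives, a class closed under sums, products and `exp`. -/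
theorem exists_hasIntegrableWeakPD_flux (k : Fin (m + 1)) :
    ∃ f g : RVec (m + 1) → ℝ, HasIntegrableWeakPD Ω k f g ∧
      (∀ x ∈ closure Ω,
        f x = (WithLp.ofLp (v x) ⬝ᵥ (A k x *ᵥ WithLp.ofLp (v x))) * Real.exp (μ x)) ∧
      ∀ x ∈ Ω, g x = fluxDensity k A v (sobPD V k) μ (sobPD N k) x := by
  choose a hac ha using fun i j => exists_continuous_eq_on_closure (hAB.contA k i j)
  choose M hM using fun i j => hAB.bddA k i j
  have hvi : ∀ i, ContinuousOn (fun x => v x i) (closure Ω) := fun i =>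
    (EuclideanSpace.proj (𝕜 := ℝ) i).continuous.comp_continuousOn hv.cont
  choose v₁ hvc hvv using fun i => exists_continuous_eq_on_closure (hvi i)
  obtain ⟨e, hec, he⟩ := exists_continuous_eq_on_closure hμ.cont
  have hb := hΩ.isBounded
  have hm := hΩ.isOpen.measurableSet
  have h1 : ∀ i j, HasIntegrableWeakPD Ω k (a i j) (partialD k fun y => A k y i j) := fun i j =>
    hasIntegrableWeakPD_of_contDiffOn hΩ.isOpen hb (hAB.smoothA k i j) (hM i j) (hac i j) (ha i j)
  have h2 : ∀ i, HasIntegrableWeakPD Ω k (v₁ i) (fun x => sobPD V k x i) := fun i =>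
    hv.hasIntegrableWeakPD hb hm hs (EuclideanSpace.proj (𝕜 := ℝ) i) (hvc i) (hvv i)
  have h3 : HasIntegrableWeakPD Ω k e (fun x => sobPD N k x) :=
    hμ.hasIntegrableWeakPD hb hm hs (ContinuousLinearMap.id ℝ ℝ) hec he
  have h4 := HasIntegrableWeakPD.sum hb Finset.univ fun i _ =>
    HasIntegrableWeakPD.sum hb Finset.univ fun j _ =>
      (((h1 i j).mul hΩ.isOpen hb (h2 i)).mul hΩ.isOpen hb (h2 j)).mul hΩ.isOpen hb
        (h3.exp hΩ.isOpen hb)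
  refine ⟨_, _, h4, fun x hx => ?_, fun x hx => ?_⟩
  · rw [dotProduct_mulVec_eq_sum, Finset.sum_mul]
    refine Finset.sum_congr rfl fun i _ => ?_
    rw [Finset.sum_mul]
    refine Finset.sum_congr rfl fun j _ => ?_
    rw [ha i j x hx, hvv i x hx, hvv j x hx, he x hx]
  · have hx' := subset_closure hx
    -- Symmetry of `A k` merges the two terms where the derivative falls on `v`, giving the factor
    -- `2` in `fluxDensity`.
    have hsym := (hAB.symm k x hx').dotProduct_mulVec_comm (WithLp.ofLp (v x))
      (WithLp.ofLp (sobPD V k x))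
    rw [fluxDensity, two_mul]
    nth_rewrite 2 [hsym]
    simp only [dotProduct_mulVec_eq_sum, Finset.mul_sum, Finset.sum_mul,
      ← Finset.sum_add_distrib, Matrix.of_apply]
    refine Finset.sum_congr rfl fun i _ => Finset.sum_congr rfl fun j _ => ?_
    rw [ha i j x hx', hvv i x hx', hvv j x hx', he x hx']
    ring

theorem integrableOn_fluxDensity (k : Fin (m + 1)) :
    IntegrableOn (fluxDensity k A v (sobPD V k) μ (sobPD N k)) Ω := by
  obtain ⟨f, g, h, -, hg⟩ := exists_hasIntegrableWeakPD_flux hΩ hAB hs hv hμ k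
  exact h.int.congr_fun hg hΩ.isOpen.measurableSet

theorem integral_sum_fluxDensity :
    hausdorffRatio m * ∫ x in Ω, ∑ k, fluxDensity k A v (sobPD V k) μ (sobPD N k) x
      = ∫ x, (WithLp.ofLp (v x) ⬝ᵥ (pencil A x (outNormal Ω x) *ᵥ WithLp.ofLp (v x)))
        * Real.exp (μ x) ∂surfMeasure Ω := by
  choose f g h hf hg using exists_hasIntegrableWeakPD_flux hΩ hAB hs hv hμ
  rw [integral_finsetSum _ fun k _ => integrableOn_fluxDensity hΩ hAB hs hv hμ k, Finset.mul_sum]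
  have h1 : ∀ k, hausdorffRatio m * ∫ x in Ω, fluxDensity k A v (sobPD V k) μ (sobPD N k) x
      = ∫ x, f k x * outNormal Ω x k ∂surfMeasure Ω := by
    intro k
    rw [← hΩ.gaussGreen (h k).cont (h k).int (h k).weak]
    congr 1
    exact (setIntegral_congr_fun hΩ.isOpen.measurableSet (hg k)).symm
  simp_rw [h1]
  rw [← integral_finsetSum _ fun k _ =>
    ((isBoundaryBdd_of_continuousOn hΩ (h k).cont.continuousOn).mul
      (isBoundaryBdd_outNormal hΩ.isOpen k)).integrable hΩ]
  refine integral_congr_ae ?_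
  filter_upwards [ae_mem_regBoundary hΩ] with x hx
  have hx' := frontier_subset_closure (regBoundary_subset_frontier Ω hx)
  simp_rw [hf _ x hx', pencil, Matrix.sum_mulVec, dotProduct_sum, Finset.sum_mul,
    Matrix.smul_mulVec, dotProduct_smul, smul_eq_mul]
  exact Finset.sum_congr rfl fun k _ => by ring

end Energy

/-! ### Weighted square integrals along differentiable curves -/

section Weighted

variable {X : Type*} [MeasurableSpace X] {ν : Measure X} {F : Type*} [NormedAddCommGroup F]
  [InnerProductSpace ℝ F]

/-- Multiplication by a bounded weight is a bounded symmetric operator `M` on `L²`, and the integral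
is the quadratic form `⟨f, M f⟩`; differentiate it as an inner product. -/
theorem hasDerivAt_integral_inner_mul {ρ : X → ℝ} (hρ : AEStronglyMeasurable ρ ν) {C : ℝ}
    (hC : ∀ᵐ x ∂ν, ‖ρ x‖ ≤ C) {f : ℝ → Lp F 2 ν} {f' : Lp F 2 ν} {t : ℝ}
    (hf : HasDerivAt f f' t) :
    HasDerivAt (fun r => ∫ x, inner ℝ (f r x) (f r x) * ρ x ∂ν)
      (∫ x, 2 * inner ℝ (f t x) (f' x) * ρ x ∂ν) t := by
  have hρ' : MemLp ρ ⊤ ν := memLp_top_of_bound hρ C hC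
  set M : Lp F 2 ν →L[ℝ] Lp F 2 ν :=
    (ContinuousLinearMap.lsmul ℝ ℝ).holderL ν ⊤ 2 2 hρ'.toLp with hM
  have hMc : ∀ g : Lp F 2 ν, M g =ᵐ[ν] fun x => ρ x • g x := by
    intro g
    filter_upwards [(ContinuousLinearMap.lsmul ℝ ℝ).coeFn_holder (r := 2) hρ'.toLp g,
      hρ'.coeFn_toLp] with x h1 h2
    rw [hM, ContinuousLinearMap.holderL_apply_apply, h1, h2]
    rfl
  have hin : ∀ g h : Lp F 2 ν, inner ℝ g (M h) = ∫ x, inner ℝ (g x) (h x) * ρ x ∂ν := by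
    intro g h
    rw [L2.inner_def]
    refine integral_congr_ae ?_
    filter_upwards [hMc h] with x hx
    rw [hx, real_inner_smul_right, mul_comm]
  have h := hf.inner ℝ (M.hasFDerivAt.comp_hasDerivAt t hf)
  have hsymm : inner ℝ f' (M (f t)) = inner ℝ (f t) (M f') := by
    rw [hin, hin]
    exact integral_congr_ae (Eventually.of_forall fun x => by
      simp only [real_inner_comm (f' x)])
  refine (h.congr_deriv ?_).congr_of_eventuallyEq (Eventually.of_forall fun r => (hin _ _).symm)
  simp only [Function.comp_apply]
  rw [hsymm, hin, ← two_mul, ← integral_const_mul]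
  exact integral_congr_ae (Eventually.of_forall fun x => by ring)

end Weighted

/-! ### Decay of the Lyapunov function -/

section Lyapunov

/-- Extracting the slot of index `0` is continuous and linear, so a time derivative in `H^s` is one
in `L²`. -/
theorem HasDerivAt.sobFun {d : ℕ} {F : Type} [NormedAddCommGroup F] [NormedSpace ℝ F]
    {Ω : Set (RVec d)} {s : ℝ} {W : ℝ → SobolevH Ω s F} {W' : SobolevH Ω s F} {t : ℝ}
    (h : HasDerivAt W W' t) : HasDerivAt (fun r => sobFun (W r)) (sobFun W') t := by
  let S : SobolevH Ω s F →L[ℝ] Lp F 2 (volume.restrict Ω) :=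
    (PiLp.proj 2 (fun _ : MIdx d ⌊s⌋₊ => Lp F 2 (volume.restrict Ω)) ⟨0, by simp⟩).comp
      ((WithLp.fstL 2 ℝ _ _).comp (SobolevH Ω s F).subtypeL)
  exact S.hasFDerivAt.comp_hasDerivAt t h

theorem inner_eq_dotProduct {n : ℕ} (v w : RVec n) :
    inner ℝ v w = WithLp.ofLp v ⬝ᵥ WithLp.ofLp w := by
  rw [EuclideanSpace.inner_eq_star_dotProduct, dotProduct_comm]
  simp

variable {m n : ℕ} {Ω : Set (RVec (m + 1))}
  {A : Fin (m + 1) → RVec (m + 1) → Matrix (Fin n) (Fin n) ℝ}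
  {B : RVec (m + 1) → Matrix (Fin n) (Fin n) ℝ}

theorem lyapunovL_eq {s : ℝ} {w : ℝ → RVec (m + 1) → RVec n} {V : SobolevH Ω s (RVec n)} {t : ℝ}
    (h : IsContRep V (w t)) (μ : RVec (m + 1) → ℝ) :
    lyapunovL Ω μ w t = ∫ x in Ω, inner ℝ (sobFun V x) (sobFun V x) * Real.exp (μ x) := by
  refine integral_congr_ae ?_
  filter_upwards [h.ae_eq] with x hx
  rw [← hx, inner_eq_dotProduct]

theorem sourceMatrix_quadForm (x : RVec (m + 1)) (v : Fin n → ℝ) :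
    v ⬝ᵥ (sourceMatrix A B x *ᵥ v)
      = ∑ k, v ⬝ᵥ ((Matrix.of fun i j => partialD k (fun y => A k y i j) x) *ᵥ v)
        - 2 * (v ⬝ᵥ (B x *ᵥ v)) := by
  have hB : v ⬝ᵥ ((B x)ᵀ *ᵥ v) = v ⬝ᵥ (B x *ᵥ v) := by
    rw [Matrix.mulVec_transpose, Matrix.dotProduct_mulVec, dotProduct_comm]
  rw [sourceMatrix, Matrix.sub_mulVec, Matrix.sum_mulVec, dotProduct_sub, dotProduct_sum,
    Matrix.smul_mulVec, Matrix.smul_mulVec, Matrix.add_mulVec, dotProduct_smul, dotProduct_smul,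
    dotProduct_add, hB]
  simp only [smul_eq_mul]
  ring

/-- Eliminate `f'` by the equation. Adding the flux density cancels the terms in `p` and leaves the
source form plus the form of `∑ μ'_k A_k`, which are bounded by `CB |v|²` and `-CA |v|²`. -/
theorem energy_density_le {CA CB : ℝ} {v f' : Fin n → ℝ} {p : Fin (m + 1) → Fin n → ℝ}
    {μ' : Fin (m + 1) → ℝ} {x : RVec (m + 1)} {E : ℝ} (hE : 0 ≤ E)
    (hpde : f' + ∑ k, A k x *ᵥ p k + B x *ᵥ v = 0)
    (hpot : (-(CA • (1 : Matrix (Fin n) (Fin n) ℝ) + ∑ k, μ' k • A k x)).PosSemidef)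
    (hsrc : v ⬝ᵥ (sourceMatrix A B x *ᵥ v) ≤ CB * (v ⬝ᵥ v)) :
    2 * (v ⬝ᵥ f') * E ≤ -(∑ k, (v ⬝ᵥ
        ((Matrix.of fun i j => partialD k (fun y => A k y i j) x) *ᵥ v)
      + 2 * (v ⬝ᵥ (A k x *ᵥ p k)) + μ' k * (v ⬝ᵥ (A k x *ᵥ v))) * E)
      + -(CA - CB) * ((v ⬝ᵥ v) * E) := by
  have h1 : v ⬝ᵥ f' = -(∑ k, v ⬝ᵥ (A k x *ᵥ p k)) - v ⬝ᵥ (B x *ᵥ v) := by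
    have := congrArg (v ⬝ᵥ ·) hpde
    simp only [dotProduct_add, dotProduct_sum, dotProduct_zero] at this
    linarith
  have h2 : CA * (v ⬝ᵥ v) + ∑ k, μ' k * (v ⬝ᵥ (A k x *ᵥ v)) ≤ 0 := by
    have := hpot.dotProduct_mulVec_nonneg v
    simp only [star_trivial, Matrix.neg_mulVec, Matrix.add_mulVec, Matrix.smul_mulVec,
      Matrix.one_mulVec, Matrix.sum_mulVec, dotProduct_neg, dotProduct_add, dotProduct_sum,
      dotProduct_smul, smul_eq_mul] at this
    linarith
  rw [sourceMatrix_quadForm] at hsrc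
  rw [← Finset.sum_mul, Finset.sum_add_distrib, Finset.sum_add_distrib, ← Finset.mul_sum, h1]
  have h3 : 0 ≤ -(CA * (v ⬝ᵥ v) + ∑ k, μ' k * (v ⬝ᵥ (A k x *ᵥ v)))
      + (CB * (v ⬝ᵥ v) - (∑ k, v ⬝ᵥ
        ((Matrix.of fun i j => partialD k (fun y => A k y i j) x) *ᵥ v)
        - 2 * (v ⬝ᵥ (B x *ᵥ v)))) := by linarith
  have h4 := mul_nonneg h3 hE
  linarith

/-- The weighted energy of a solution decays as soon as the boundary flux is nonnegative. -/
theorem hasDerivAt_lyapunovL (hΩ : IsPiecewiseC1Domain Ω) (hAB : IsSymmetricSystem Ω A B)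
    {s : ℝ} (hs : 1 ≤ ⌊s⌋₊) {CA CB : ℝ} {N : SobolevH Ω s ℝ} {μ : RVec (m + 1) → ℝ}
    (hμ : IsContRep N μ)
    (hpot : ∀ᵐ x ∂volume.restrict Ω,
      (-(CA • (1 : Matrix (Fin n) (Fin n) ℝ) + ∑ k, sobPD N k x • A k x)).PosSemidef)
    {w : ℝ → RVec (m + 1) → RVec n} {W : ℝ → SobolevH Ω s (RVec n)} {t : ℝ}
    (hW : DifferentiableAt ℝ W t) (hrep : ∀ᶠ r in 𝓝 t, IsContRep (W r) (w r))
    (hpde : ∀ᵐ x ∂volume.restrict Ω,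
        WithLp.ofLp (sobFun (deriv W t) x) + ∑ k, A k x *ᵥ WithLp.ofLp (sobPD (W t) k x)
          + B x *ᵥ WithLp.ofLp (w t x) = 0)
    (hsrc : ∀ x ∈ Ω, WithLp.ofLp (w t x) ⬝ᵥ (sourceMatrix A B x *ᵥ WithLp.ofLp (w t x))
            ≤ CB * ‖w t x‖ ^ 2)
    (hflux : 0 ≤ ∫ x, (WithLp.ofLp (w t x) ⬝ᵥ
      (pencil A x (outNormal Ω x) *ᵥ WithLp.ofLp (w t x))) * Real.exp (μ x) ∂surfMeasure Ω) :
    ∃ D, HasDerivAt (lyapunovL Ω μ w) D t ∧ D ≤ -(CA - CB) * lyapunovL Ω μ w t := by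
  have hm := hΩ.isOpen.measurableSet
  have hv := hrep.self_of_nhds
  have hEc : ContinuousOn (fun x => Real.exp (μ x)) (closure Ω) :=
    Real.continuous_exp.comp_continuousOn hμ.cont
  obtain ⟨M, hM⟩ := hΩ.isBounded.isCompact_closure.exists_bound_of_continuousOn hEc
  have hEm : AEStronglyMeasurable (fun x => Real.exp (μ x)) (volume.restrict Ω) :=
    (hEc.mono subset_closure).aestronglyMeasurable hm
  have hEb : ∀ᵐ x ∂volume.restrict Ω, ‖Real.exp (μ x)‖ ≤ M :=
    (ae_restrict_mem hm).mono fun x hx => hM x (subset_closure hx)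
  have hd := hasDerivAt_integral_inner_mul hEm hEb hW.hasDerivAt.sobFun
  refine ⟨_, hd.congr_of_eventuallyEq (hrep.mono fun r hr => lyapunovL_eq hr μ), ?_⟩
  -- Gauss–Green transfers the sign of the boundary flux to the bulk divergence, since
  -- `hausdorffRatio` is positive.
  have hflux' : 0 ≤ ∫ x in Ω, ∑ k, fluxDensity k A (w t) (sobPD (W t) k) μ (sobPD N k) x := by
    rw [← integral_sum_fluxDensity hΩ hAB hs hv hμ] at hflux
    exact nonneg_of_mul_nonneg_right hflux hausdorffRatio_pos
  have hGi : Integrable (fun x => ∑ k, fluxDensity k A (w t) (sobPD (W t) k) μ (sobPD N k) x)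
      (volume.restrict Ω) :=
    integrable_finsetSum _ fun k _ => integrableOn_fluxDensity hΩ hAB hs hv hμ k
  have hin : ∀ f g : Lp (RVec n) 2 (volume.restrict Ω),
      Integrable (fun x => inner ℝ (f x) (g x) * Real.exp (μ x)) (volume.restrict Ω) :=
    fun f g => (L2.integrable_inner (𝕜 := ℝ) f g).mul_bdd (c := M) hEm hEb
  have hi1 : Integrable (fun x => 2 * inner ℝ (sobFun (W t) x) (sobFun (deriv W t) x)
      * Real.exp (μ x)) (volume.restrict Ω) := by
    simp_rw [mul_assoc]
    exact (hin _ _).const_mul 2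
  have hi2 := (hin (sobFun (W t)) (sobFun (W t))).const_mul (-(CA - CB))
  have hmono := integral_mono_ae hi1 (hGi.neg.add hi2) (by
    filter_upwards [hpde, hpot, hv.ae_eq, ae_restrict_mem hm] with x h1 h2 h3 hx
    have h4 := hsrc x hx
    rw [← real_inner_self_eq_norm_sq, inner_eq_dotProduct] at h4
    rw [inner_eq_dotProduct, Pi.add_apply, Pi.neg_apply, inner_eq_dotProduct, ← h3]
    exact energy_density_le (Real.exp_pos _).le h1 h2 h4)
  refine hmono.trans ?_
  rw [integral_add' hGi.neg hi2, integral_neg', integral_const_mul, lyapunovL_eq hv]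
  linarith

end Lyapunov

/-! ### Gronwall's inequality and exponential stability. -/

section Gronwall

/-- Exponential decay on an interval from a differential inequality. -/
theorem le_exp_mul_of_deriv_le {f : ℝ → ℝ} {c a b : ℝ} (hab : a ≤ b)
    (hf : ∀ r ∈ Icc a b, ∃ D, HasDerivAt f D r ∧ D ≤ -c * f r) :
    f b ≤ Real.exp (-c * (b - a)) * f a := by
  choose! D hD hDle using hf
  have hd : ∀ r ∈ Icc a b, HasDerivAt (fun r => f r * Real.exp (c * r))
      (D r * Real.exp (c * r) + f r * (Real.exp (c * r) * c)) r := fun r hr =>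
    (hD r hr).mul (((hasDerivAt_id r).const_mul c).exp.congr_deriv (by simp))
  -- The integrating factor `e^{c r}` turns the differential inequality into monotonicity.
  have hanti : AntitoneOn (fun r => f r * Real.exp (c * r)) (Icc a b) := by
    refine antitoneOn_of_deriv_nonpos (convex_Icc a b)
      (fun r hr => (hd r hr).continuousAt.continuousWithinAt)
      (fun r hr => (hd r (interior_subset hr)).differentiableAt.differentiableWithinAt)
      fun r hr => ?_
    rw [(hd r (interior_subset hr)).deriv]
    have := hDle r (interior_subset hr)
    nlinarith [Real.exp_pos (c * r)]
  have h := hanti (left_mem_Icc.mpr hab) (right_mem_Icc.mpr hab) hab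
  simp only at h
  have h2 : Real.exp (-c * (b - a)) = Real.exp (c * a) / Real.exp (c * b) := by
    rw [← Real.exp_sub]
    ring_nf
  rw [h2, div_mul_eq_mul_div, le_div_iff₀ (Real.exp_pos _)]
  linarith

end Gronwall

section Stability

variable {d n : ℕ} {Ω : Set (RVec d)} {s : ℝ}

theorem integral_inner_self_mul_exp_mem_Icc (hΩ : MeasurableSet Ω) {μ : RVec d → ℝ} {K : ℝ}
    (hμ : ContinuousOn μ Ω) (hK : ∀ x ∈ Ω, |μ x| ≤ K)
    (f : Lp (RVec n) 2 (volume.restrict Ω)) :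
    ∫ x in Ω, inner ℝ (f x) (f x) * Real.exp (μ x)
      ∈ Icc (Real.exp (-K) * ‖f‖ ^ 2) (Real.exp K * ‖f‖ ^ 2) := by
  have hi := L2.integrable_inner (𝕜 := ℝ) f f
  have hEm : AEStronglyMeasurable (fun x => Real.exp (μ x)) (volume.restrict Ω) :=
    (Real.continuous_exp.comp_continuousOn hμ).aestronglyMeasurable hΩ
  have hi' : Integrable (fun x => inner ℝ (f x) (f x) * Real.exp (μ x)) (volume.restrict Ω) :=
    hi.mul_bdd (c := Real.exp K) hEm ((ae_restrict_mem hΩ).mono fun x hx => by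
      rw [Real.norm_of_nonneg (Real.exp_pos _).le]
      exact Real.exp_le_exp.mpr (abs_le.mp (hK x hx)).2)
  rw [← real_inner_self_eq_norm_sq, L2.inner_def, ← integral_const_mul, ← integral_const_mul]
  constructor
  · refine integral_mono_ae (hi.const_mul _) hi' ((ae_restrict_mem hΩ).mono fun x hx => ?_)
    simp only
    rw [mul_comm]
    exact mul_le_mul_of_nonneg_left (Real.exp_le_exp.mpr (abs_le.mp (hK x hx)).1)
      real_inner_self_nonneg
  · refine integral_mono_ae hi' (hi.const_mul _) ((ae_restrict_mem hΩ).mono fun x hx => ?_)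
    simp only
    rw [mul_comm]
    exact mul_le_mul_of_nonneg_right (Real.exp_le_exp.mpr (abs_le.mp (hK x hx)).2)
      real_inner_self_nonneg

theorem IsContRep.eLpNorm_eq {F : Type} [NormedAddCommGroup F] [NormedSpace ℝ F]
    {u : SobolevH Ω s F} {v : RVec d → F} (h : IsContRep u v) :
    eLpNorm v 2 (volume.restrict Ω) = ENNReal.ofReal ‖sobFun u‖ := by
  rw [eLpNorm_congr_ae h.ae_eq, ofReal_norm, Lp.enorm_def]

theorem isOpen_timeInterval (τ : EReal) : IsOpen {t : ℝ | 0 < t ∧ (t : EReal) < τ} :=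
  isOpen_Ioi.inter (isOpen_Iio.preimage continuous_coe_real_ereal)

end Stability

theorem theorem1 {d n : ℕ} (hd : 1 ≤ d) {s : ℝ} (hs : 1 + (d : ℝ) / 2 ≤ s)
    (Ω : Set (RVec d)) (hΩ : IsPiecewiseC1Domain Ω)
    (A : Fin d → RVec d → Matrix (Fin n) (Fin n) ℝ) (B : RVec d → Matrix (Fin n) (Fin n) ℝ)
    (hAB : IsSymmetricSystem Ω A B)
    (lam : RVec d → RVec d → Fin n → ℝ) (T : RVec d → RVec d → Matrix (Fin n) (Fin n) ℝ)
    (hT : IsPencilDiag Ω A lam T)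
    (CA CB : ℝ) (hCA : 0 < CA) (hCB : 0 ≤ CB) (hAB' : CB < CA)
    (μ : RVec d → ℝ) (hμ : IsLyapunovPotential Ω s A CA μ) :
    ∃ C₁ > (0 : ℝ), ∃ C₂ > (0 : ℝ),
      ∀ (τ : EReal) (w : ℝ → RVec d → RVec n) (u u' : ℝ → RVec d → RVec n),
        0 < τ →
        IsSolution Ω s A B τ w →
        -- the estimate defining `CB`
        (∀ t : ℝ, 0 < t → (t : EReal) < τ → ∀ x ∈ Ω,
          WithLp.ofLp (w t x) ⬝ᵥ (sourceMatrix A B x *ᵥ WithLp.ofLp (w t x))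
            ≤ CB * ‖w t x‖ ^ 2) →
        -- controls `u = T u'`
        (∀ t : ℝ, 0 < t → (t : EReal) < τ → ∀ x ∈ regBoundary Ω,
          WithLp.ofLp (u t x) = T x (outNormal Ω x) *ᵥ WithLp.ofLp (u' t x)) →
        -- boundary condition on the inflow parts
        (∀ t : ℝ, 0 < t → (t : EReal) < τ → ∀ i, ∀ x ∈ gammaMinus Ω lam i,
          charVar Ω T x (w t x) i = charVar Ω T x (u t x) i) →
        -- weighted boundary inequality for the controls
        (∀ t : ℝ, 0 < t → (t : EReal) < τ →
          -∑ i, ∫ x in gammaMinus Ω lam i,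
              lam x (outNormal Ω x) i * (u' t x i) ^ 2 * Real.exp (μ x) ∂surfMeasure Ω
            ≤ ∑ i, ∫ x in gammaPlus Ω lam i,
              lam x (outNormal Ω x) i * (charVar Ω T x (w t x) i) ^ 2 * Real.exp (μ x)
                ∂surfMeasure Ω) →
        (∀ t : ℝ, 0 < t → (t : EReal) < τ →
          DifferentiableAt ℝ (lyapunovL Ω μ w) t ∧
          deriv (lyapunovL Ω μ w) t ≤ -(CA - CB) * lyapunovL Ω μ w t) ∧
        (∀ t : ℝ, 0 ≤ t → (t : EReal) < τ →
          eLpNorm (w t) 2 (volume.restrict Ω)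
            ≤ ENNReal.ofReal (C₁ * Real.exp (-C₂ * t)) *
              eLpNorm (w 0) 2 (volume.restrict Ω)) := by
  -- Writing `d = m + 1` turns the dimension `d - 1` of the surface measure into the natural number
  -- `m`.
  obtain ⟨m, rfl⟩ : ∃ m, d = m + 1 := ⟨d - 1, (Nat.sub_add_cancel hd).symm⟩
  have hs1 : 1 ≤ ⌊s⌋₊ := by
    refine Nat.le_floor ?_
    have : (0 : ℝ) ≤ ((m + 1 : ℕ) : ℝ) / 2 := by positivity
    push_cast at this hs ⊢
    linarith
  obtain ⟨N, hN, hpot⟩ := hμ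
  obtain ⟨K, hK⟩ := hΩ.isBounded.isCompact_closure.exists_bound_of_continuousOn hN.cont
  have hm := hΩ.isOpen.measurableSet
  have hK0 : 0 ≤ K := by
    obtain ⟨x, hx⟩ := hΩ.isConnected.nonempty
    exact (norm_nonneg _).trans (hK x (subset_closure hx))
  set c := CA - CB with hc
  have hc0 : 0 < c := sub_pos.mpr hAB'
  -- With `|μ| ≤ K`, passing from the norm to `L` and back costs `e^{2K}` for squared norms, hence
  -- `e^K` for norms; the rate is halved for the same reason.
  refine ⟨Real.exp K, Real.exp_pos K, c / 2, half_pos hc0, ?_⟩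
  intro τ w u u' _ hsol hsrc hu hbc hle
  obtain ⟨W, hW, hWt⟩ := hsol.pde
  have hopen := isOpen_timeInterval τ
  have hderiv : ∀ t : ℝ, 0 < t → (t : EReal) < τ →
      ∃ D, HasDerivAt (lyapunovL Ω μ w) D t ∧ D ≤ -c * lyapunovL Ω μ w t := by
    intro t ht0 htτ
    have hnhds := hopen.mem_nhds (show t ∈ {t : ℝ | 0 < t ∧ (t : EReal) < τ} from ⟨ht0, htτ⟩)
    exact hasDerivAt_lyapunovL hΩ hAB hs1 hN hpot
      ((hW.contDiffAt hnhds).differentiableAt one_ne_zero)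
      (eventually_of_mem hnhds fun r hr => (hWt r hr.1 hr.2).1) (hWt t ht0 htτ).2
      (hsrc t ht0 htτ) (hT.flux_nonneg hΩ hAB.contA (hWt t ht0 htτ).1.cont hN.cont
        (hu t ht0 htτ) (hbc t ht0 htτ) (hle t ht0 htτ))
  refine ⟨fun t ht0 htτ => ?_, fun t ht0 htτ => ?_⟩
  · obtain ⟨D, hD, hDle⟩ := hderiv t ht0 htτ
    exact ⟨hD.differentiableAt, hD.deriv ▸ hDle⟩
  rcases ht0.eq_or_lt with rfl | ht0
  -- At `t = 0` the claim is just `C₁ ≥ 1`, which follows from `0 ≤ K`.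
  · rw [mul_zero, Real.exp_zero, mul_one]
    refine le_mul_of_one_le_left zero_le ?_
    rw [← ENNReal.ofReal_one]
    exact ENNReal.ofReal_le_ofReal (Real.one_le_exp hK0)
  have hLmem : ∀ r : ℝ, 0 < r → (r : EReal) < τ → lyapunovL Ω μ w r
      ∈ Icc (Real.exp (-K) * ‖sobFun (W r)‖ ^ 2) (Real.exp K * ‖sobFun (W r)‖ ^ 2) := by
    intro r hr0 hrτ
    rw [lyapunovL_eq (hWt r hr0 hrτ).1]
    exact integral_inner_self_mul_exp_mem_Icc hm (hN.cont.mono subset_closure)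
      (fun x hx => hK x (subset_closure hx)) _
  -- The differential inequality holds only for positive times, so decay starts at some `r > 0`; the
  -- triangle inequality brings in `w 0`, and `r → 0` follows.
  have hstep : ∀ r : ℝ, 0 < r → r ≤ t →
      eLpNorm (w t) 2 (volume.restrict Ω)
        ≤ ENNReal.ofReal (Real.exp K * Real.exp (-(c / 2) * (t - r)))
          * (eLpNorm (w r - w 0) 2 (volume.restrict Ω)
            + eLpNorm (w 0) 2 (volume.restrict Ω)) := by
    intro r hr0 hrt
    have hrτ : (r : EReal) < τ := (EReal.coe_le_coe_iff.mpr hrt).trans_lt htτ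
    have hg := le_exp_mul_of_deriv_le hrt fun q hq => hderiv q (hr0.trans_le hq.1)
      ((EReal.coe_le_coe_iff.mpr hq.2).trans_lt htτ)
    have h1 : ‖sobFun (W t)‖
        ≤ Real.exp K * Real.exp (-(c / 2) * (t - r)) * ‖sobFun (W r)‖ := by
      refine abs_le_of_sq_le_sq' ?_ (by positivity) |>.2
      have h2 := (hLmem t ht0 htτ).1.trans (hg.trans
        (mul_le_mul_of_nonneg_left (hLmem r hr0 hrτ).2 (Real.exp_pos _).le))
      have h3 := mul_le_mul_of_nonneg_left h2 (Real.exp_pos K).le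
      rw [← mul_assoc, ← Real.exp_add, add_neg_cancel, Real.exp_zero, one_mul] at h3
      refine h3.trans_eq ?_
      have h4 : Real.exp (-c * (t - r)) = Real.exp (-(c / 2) * (t - r)) ^ 2 := by
        rw [← Real.exp_nat_mul]
        congr 1
        push_cast
        ring
      rw [h4]
      ring
    have hw0 := hsol.initial_memLp
    have hwr : AEStronglyMeasurable (w r) (volume.restrict Ω) :=
      (Lp.aestronglyMeasurable (sobFun (W r))).congr (hWt r hr0 hrτ).1.ae_eq.symm
    calc eLpNorm (w t) 2 (volume.restrict Ω)
        ≤ ENNReal.ofReal (Real.exp K * Real.exp (-(c / 2) * (t - r)) * ‖sobFun (W r)‖) := by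
          rw [(hWt t ht0 htτ).1.eLpNorm_eq]
          exact ENNReal.ofReal_le_ofReal h1
      _ = ENNReal.ofReal (Real.exp K * Real.exp (-(c / 2) * (t - r)))
          * eLpNorm (w r) 2 (volume.restrict Ω) := by
          rw [ENNReal.ofReal_mul (by positivity), (hWt r hr0 hrτ).1.eLpNorm_eq]
      _ ≤ _ := by
          refine mul_le_mul_right ?_ _
          have := eLpNorm_add_le (hwr.sub hw0.1) hw0.1 (p := 2) one_le_two
          rwa [sub_add_cancel] at this
  have hlim : Tendsto (fun r => ENNReal.ofReal (Real.exp K * Real.exp (-(c / 2) * (t - r)))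
      * (eLpNorm (w r - w 0) 2 (volume.restrict Ω) + eLpNorm (w 0) 2 (volume.restrict Ω)))
      (𝓝[>] 0) (𝓝 (ENNReal.ofReal (Real.exp K * Real.exp (-(c / 2) * t))
        * eLpNorm (w 0) 2 (volume.restrict Ω))) := by
    have hexp : Continuous fun r : ℝ => Real.exp K * Real.exp (-(c / 2) * (t - r)) := by fun_prop
    have h1 : Tendsto (fun r => ENNReal.ofReal (Real.exp K * Real.exp (-(c / 2) * (t - r))))
        (𝓝[>] 0) (𝓝 (ENNReal.ofReal (Real.exp K * Real.exp (-(c / 2) * t)))) := by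
      have := (ENNReal.continuous_ofReal.comp hexp).tendsto 0
      simp only [Function.comp_apply, sub_zero] at this
      exact this.mono_left nhdsWithin_le_nhds
    have h2 := hsol.initial.add_const (eLpNorm (w 0) 2 (volume.restrict Ω))
    rw [zero_add] at h2
    exact ENNReal.Tendsto.mul h1 (Or.inr hsol.initial_memLp.2.ne) h2 (Or.inr ENNReal.ofReal_ne_top)
  -- The `L²` attainment of the initial values removes the term `w r - w 0` in the limit.
  refine ge_of_tendsto hlim ?_
  filter_upwards [Ioc_mem_nhdsGT ht0] with r hr
  exact hstep r hr.1 hr.2
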